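/- For every $m$ let $\|\cdot\|$ be a norm on $\mathbb{R}^m$, evaluable in $O(m)$ time (for instance the Euclidean norm). The earth mover's distance (EMD) between two finite samples in $\mathbb{R}^m$ is $$\mathrm{dist}(x,y)=\sup_f\Big|\frac1M\sum_{i=1}^M f(x_i)-\frac1N\sum_{j=1}^N f(y_j)\Big|,$$ the supremum being over the continuous $f:\mathbb{R}^m\to\mathbb{R}$ with $|f(u)-f(v)|\le\|u-v\|$, where $M,N$ are the sample sizes. Let the training, reference and detection sets $S_T,S_R,S_D$ consist of $nk$ points of $\mathbb{R}^m$ each, and let $\alpha\in\mathbb{R}$ be a significance level. Consider two tests, each of which returns a p-value $p$ and declares drift if and only if $p<\alpha$. (a) *Permutation testing* ($n,k,B\ge1$). Let $d=\mathrm{dist}(S_T\cup S_R,S_D)$. For $b=1,\dots,B$, permute the $3nk$ pooled points by independent uniformly random permutations, and let $d_b^*$ be the distance between the first $2nk$ and the last $nk$ points. Then $p=\frac1B\sum_{b=1}^B\mathbf 1\{|d_b^*|\ge|d|\}$. (b) *Batched distance algorithm* ($n\ge2$, $k\ge1$). Split each set into $n$ batches of $k$ consecutive points, put $\delta_b=\mathrm{dist}(S_{T_b},S_{R_b})-\mathrm{dist}(S_{T_b},S_{D_b})$,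 and let $p$ be the p-value of the two-tailed one-sample t-test of mean zero on $\delta_1,\dots,\delta_n$, with $n-1$ degrees of freedom. If the sample variance is $0$, put $p=1$ when the sample mean is $0$ and $p=0$ otherwise. Time is the worst-case number of steps of a single program (independent of the input) on a real RAM with unit-cost operations $+,-,\times,/,\sqrt{\cdot},\arctan$ and comparison on real numbers, unit-cost addition, truncated subtraction and comparison on natural numbers used as counters and addresses, conversion of natural numbers to reals, and unit-cost uniform draws from $\{0,\dots,r\}$. The implied constants depend only on the norms. Then the EMD between two samples of size $N\ge1$ can be computed exactly by a deterministic program in time $O(N^3+mN^2)$. Permutation testing with the EMD can be carried out in time $O\big(B(n^3k^3+mn^2k^2)\big)$, the output having exactly the distribution described in (a). The batched distance algorithm with the EMD can be carried out by a deterministic program in time $O\big(n(k^3+mk^2)\big)$. Thus batching lowers the runtime bound from $B(n^3k^3+mn^2k^2)$ to $n(k^3+mk^2)$, that is, by a factor of at least $nB$: $nB\cdot n(k^3+mk^2)\le B(n^3k^3+mn^2k^2)$. -/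

import Mathlib

open MeasureTheory

/-! ## The machine model: a randomized real RAM

Programs are written in a structured imperative language (assignments, conditionals, loops) over
natural-number registers and arrays, used for counters and addresses, and real registers and
arrays. A program is a fixed finite text and does not depend on the input. One execution step
evaluates one assignment or one test; the expressions in it are part of the fixed text, hence
consist of boundedly many elementary operations. The natural-number operations are addition and
truncated subtraction; the real operations are `+ - * /`, square root, arctangent, and conversion
of a natural number to a real number (with the conventions `x / 0 = 0`, and `√x = 0` for `x < 0`);
the program text contains no real constants. There is no
rounding operation from the reals to the natural numbers. -/

/-- The memory. Natural-number registers, real registers, one-dimensional arrays of natural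
numbers, and two-dimensional arrays of real numbers. The first argument is the name of
the register or array. -/
structure Mem where
  nreg : ℕ → ℕ
  rreg : ℕ → ℝ
  narr : ℕ → ℕ → ℕ
  rarr : ℕ → ℕ → ℕ → ℝ

/-- Natural-number expressions. -/
inductive NExp where
  | const (c : ℕ)
  | reg (x : ℕ)
  | arr (a : ℕ) (i : NExp)
  | add (e f : NExp)
  | sub (e f : NExp)

def NExp.eval (s : Mem) : NExp → ℕ
  | .const c => c
  | .reg x => s.nreg x
  | .arr a i => s.narr a (i.eval s)
  | .add e f => e.eval s + f.eval s
  | .sub e f => e.eval s - f.eval s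

/-- Real expressions. -/
inductive RExp where
  | ofNat (e : NExp)
  | reg (x : ℕ)
  | arr (a : ℕ) (i j : NExp)
  | add (e f : RExp)
  | sub (e f : RExp)
  | mul (e f : RExp)
  | div (e f : RExp)
  | sqrt (e : RExp)
  | arctan (e : RExp)

noncomputable def RExp.eval (s : Mem) : RExp → ℝ
  | .ofNat e => (e.eval s : ℝ)
  | .reg x => s.rreg x
  | .arr a i j => s.rarr a (i.eval s) (j.eval s)
  | .add e f => e.eval s + f.eval s
  | .sub e f => e.eval s - f.eval s
  | .mul e f => e.eval s * f.eval s
  | .div e f => e.eval s / f.eval s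
  | .sqrt e => Real.sqrt (e.eval s)
  | .arctan e => Real.arctan (e.eval s)

/-- Tests. -/
inductive BExp where
  | nlt (e f : NExp)
  | rlt (e f : RExp)
  | not (b : BExp)
  | and (b c : BExp)

def BExp.Holds (s : Mem) : BExp → Prop
  | .nlt e f => e.eval s < f.eval s
  | .rlt e f => e.eval s < f.eval s
  | .not b => ¬ b.Holds s
  | .and b c => b.Holds s ∧ c.Holds s

/-- Programs. `rand x e` draws a uniformly random element of `{0, …, e}` into the
natural-number register `x`, independently of all earlier draws. -/
inductive Prog where
  | skip
  | nset (x : ℕ) (e : NExp)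
  | rset (x : ℕ) (e : RExp)
  | nput (a : ℕ) (i : NExp) (e : NExp)
  | rput (a : ℕ) (i j : NExp) (e : RExp)
  | rand (x : ℕ) (e : NExp)
  | seq (P Q : Prog)
  | ite (b : BExp) (P Q : Prog)
  | loop (b : BExp) (P : Prog)

/-- The program makes no random draws. -/
def Prog.Deterministic : Prog → Prop
  | .rand _ _ => False
  | .seq P Q => P.Deterministic ∧ Q.Deterministic
  | .ite _ P Q => P.Deterministic ∧ Q.Deterministic
  | .loop _ P => P.Deterministic
  | _ => True

def Mem.setN (s : Mem) (x : ℕ) (v : ℕ) : Mem :=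
  { s with nreg := Function.update s.nreg x v }

noncomputable def Mem.setR (s : Mem) (x : ℕ) (v : ℝ) : Mem :=
  { s with rreg := Function.update s.rreg x v }

def Mem.putN (s : Mem) (a i : ℕ) (v : ℕ) : Mem :=
  { s with narr := Function.update s.narr a (Function.update (s.narr a) i v) }

noncomputable def Mem.putR (s : Mem) (a i j : ℕ) (v : ℝ) : Mem :=
  let row := Function.update (s.rarr a i) j v
  { s with rarr := Function.update s.rarr a (Function.update (s.rarr a) i row) }

/-- A configuration: the list of programs still to be executed, in order, and the memory.
The machine has halted when the list is empty. -/
abbrev Config := List Prog × Mem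

open Classical in
/-- One step of the machine, as a distribution over the next configuration. -/
noncomputable def step : Config → PMF Config
  | ([], s) => PMF.pure ([], s)
  | (.skip :: K, s) => PMF.pure (K, s)
  | (.nset x e :: K, s) => PMF.pure (K, s.setN x (e.eval s))
  | (.rset x e :: K, s) => PMF.pure (K, s.setR x (e.eval s))
  | (.nput a i e :: K, s) => PMF.pure (K, s.putN a (i.eval s) (e.eval s))
  | (.rput a i j e :: K, s) => PMF.pure (K, s.putR a (i.eval s) (j.eval s) (e.eval s))
  | (.rand x e :: K, s) =>
      (PMF.uniformOfFintype (Fin (e.eval s + 1))).map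
        fun v : Fin (e.eval s + 1) => (K, s.setN x v.val)
  | (.seq P Q :: K, s) => PMF.pure (P :: Q :: K, s)
  | (.ite b P Q :: K, s) => PMF.pure ((if b.Holds s then P else Q) :: K, s)
  | (.loop b P :: K, s) => PMF.pure (if b.Holds s then P :: .loop b P :: K else K, s)

/-- The distribution of the configuration after `t` steps. -/
noncomputable def run : ℕ → Config → PMF Config
  | 0, c => PMF.pure c
  | t + 1, c => (step c).bind (run t)

/-- The result read off a configuration by `out`, or `none` if the machine has not halted. -/
def result {α : Type} (out : Mem → α) : Config → Option α
  | ([], s) => some (out s)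
  | (_ :: _, _) => none

/-- Started on memory `s`, the program `P` halts within `t` steps, whatever the random draws,
and its output, read off the final memory by `out`, has distribution `μ`. -/
def HaltsWithin {α : Type} (P : Prog) (s : Mem) (t : ℕ) (out : Mem → α) (μ : PMF α) : Prop :=
  (run t ([P], s)).map (result out) = μ.map some

/-- The norms `ν m` on `ℝ^m`, `m ∈ ℕ`, can be evaluated in time `O(m)`: one deterministic program
that finds `m` in natural-number register `0` and the coordinates of `x` in row `0` of real
array `0`, with arbitrary values in all other memory cells, leaves `ν m x` in real
register `0` after at most `C * (m + 1)` steps. -/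
def EvaluableInLinearTime (ν : ∀ m : ℕ, Seminorm ℝ (Fin m → ℝ)) : Prop :=
  ∃ P : Prog, P.Deterministic ∧ ∃ C : ℕ, ∀ (m : ℕ) (x : Fin m → ℝ) (s : Mem),
    s.nreg 0 = m → (∀ j : Fin m, s.rarr 0 0 j = x j) →
      HaltsWithin P s (C * (m + 1)) (fun s' => s'.rreg 0) (PMF.pure (ν m x))

/-! ## Earth mover's distance -/

/-- The integral probability metric of a class `F` of functions. -/
noncomputable def ipm {m : ℕ} (F : Set ((Fin m → ℝ) → ℝ)) (P Q : Measure (Fin m → ℝ)) : ℝ :=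
  sSup ((fun f => |(∫ x, f x ∂P) - ∫ x, f x ∂Q|) '' F)

/-- The continuous functions that are 1-Lipschitz for the norm `p`. -/
def lipClass {m : ℕ} (p : Seminorm ℝ (Fin m → ℝ)) : Set ((Fin m → ℝ) → ℝ) :=
  {f | Continuous f ∧ ∀ x y, |f x - f y| ≤ p (x - y)}

/-- The empirical distribution of a sample. -/
noncomputable def empirical {m N : ℕ} (x : Fin N → Fin m → ℝ) : Measure (Fin m → ℝ) :=
  (N : ENNReal)⁻¹ • ∑ i, Measure.dirac (x i)

/-- The earth mover's distance between two samples. -/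
noncomputable def emd {m M N : ℕ} (p : Seminorm ℝ (Fin m → ℝ))
    (x : Fin M → Fin m → ℝ) (y : Fin N → Fin m → ℝ) : ℝ :=
  ipm (lipClass p) (empirical x) (empirical y)

/-! ## The two drift tests

Both return the p-value, and the decision: `1` if drift is detected, `0` otherwise. -/

open Classical in
noncomputable def verdict (α p : ℝ) : ℝ × ℕ := (p, if p < α then 1 else 0)

/-- `ℙ(|X| ≥ |t|)` for `X` with Student's t-distribution with `d` degrees of freedom, the
distribution whose density is proportional to `(1 + x² / d) ^ (-(d + 1) / 2)`. -/
noncomputable def studentTwoTailed (d : ℕ) (t : ℝ) : ℝ :=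
  (∫ x in {x : ℝ | |t| ≤ |x|}, (1 + x ^ 2 / (d : ℝ)) ^ (-((d : ℝ) + 1) / 2)) /
    ∫ x : ℝ, (1 + x ^ 2 / (d : ℝ)) ^ (-((d : ℝ) + 1) / 2)

noncomputable def sampleMean {n : ℕ} (δ : Fin n → ℝ) : ℝ := (∑ i, δ i) / (n : ℝ)

noncomputable def sampleVar {n : ℕ} (δ : Fin n → ℝ) : ℝ :=
  (∑ i, (δ i - sampleMean δ) ^ 2) / ((n : ℝ) - 1)

open Classical in
/-- The p-value of the two-tailed t-test of the hypothesis of mean zero (`n ≥ 2`). If the sample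
variance vanishes, the t-statistic is undefined; the p-value is then `0` if the sample mean is
nonzero (infinite t-statistic) and `1` if the sample mean is zero. -/
noncomputable def tTestPValue {n : ℕ} (δ : Fin n → ℝ) : ℝ :=
  if sampleVar δ = 0 then (if sampleMean δ = 0 then 1 else 0)
  else studentTwoTailed (n - 1) (sampleMean δ / (Real.sqrt (sampleVar δ) / Real.sqrt n))

/-- The `b`-th of the `n` consecutive batches of size `k` of a data set. -/
def batch {n k m : ℕ} (S : Fin (n * k) → Fin m → ℝ) (b : Fin n) : Fin k → Fin m → ℝ :=
  fun j => S (finProdFinEquiv (b, j))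

/-- The batched distance algorithm with the earth mover's distance. -/
noncomputable def batchedTest {n k m : ℕ} (p : Seminorm ℝ (Fin m → ℝ)) (α : ℝ)
    (T R D : Fin (n * k) → Fin m → ℝ) : ℝ × ℕ :=
  verdict α (tTestPValue fun b : Fin n =>
    emd p (batch T b) (batch R b) - emd p (batch T b) (batch D b))

/-- The distance between the first `N + N` and the last `N` points of the pooled data, after
rearrangement by `σ`. -/
noncomputable def splitEmd {N m : ℕ} (p : Seminorm ℝ (Fin m → ℝ))
    (z : Fin (N + N + N) → Fin m → ℝ) (σ : Equiv.Perm (Fin (N + N + N))) : ℝ :=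
  emd p (fun i : Fin (N + N) => z (σ (Fin.castAdd N i)))
    (fun j : Fin N => z (σ (Fin.natAdd (N + N) j)))

open Classical in
/-- The permutation p-value obtained from the permutations `σ 1, …, σ B`. -/
noncomputable def permPValue {N m B : ℕ} (p : Seminorm ℝ (Fin m → ℝ))
    (z : Fin (N + N + N) → Fin m → ℝ) (σ : Fin B → Equiv.Perm (Fin (N + N + N))) : ℝ :=
  1 / (B : ℝ) * ∑ b, if |splitEmd p z 1| ≤ |splitEmd p z (σ b)| then (1 : ℝ) else 0

/-- Permutation testing with the earth mover's distance: the distribution of its output, the `B`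
permutations being independent and uniformly distributed. -/
noncomputable def permTest {N m : ℕ} (p : Seminorm ℝ (Fin m → ℝ)) (B : ℕ) (α : ℝ)
    (T R D : Fin N → Fin m → ℝ) : PMF (ℝ × ℕ) :=
  (PMF.uniformOfFintype (Fin B → Equiv.Perm (Fin (N + N + N)))).map fun σ =>
    verdict α (permPValue p (Fin.append (Fin.append T R) D) σ)

/-! ## Input and output conventions -/

/-- The array that holds a sample: point `i` in row `i`, zero elsewhere. -/
noncomputable def sampleArray {N m : ℕ} (x : Fin N → Fin m → ℝ) : ℕ → ℕ → ℝ :=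
  fun i j => if h : i < N ∧ j < m then x ⟨i, h.1⟩ ⟨j, h.2⟩ else 0

/-- Input of the distance computation: the sample size, the dimension and the two samples. -/
noncomputable def emdInput {N m : ℕ} (x y : Fin N → Fin m → ℝ) : Mem where
  nreg := fun r => if r = 0 then N else if r = 1 then m else 0
  rreg := fun _ => 0
  narr := fun _ _ => 0
  rarr := fun a => if a = 0 then sampleArray x else if a = 1 then sampleArray y else fun _ _ => 0

/-- Input of the drift tests: the parameters `n, k, m, B`, the significance level and the
training, reference and detection sets. (`B` is set to `0` for the batched test.) -/
noncomputable def driftInput {n k m : ℕ} (B : ℕ) (α : ℝ) (T R D : Fin (n * k) → Fin m → ℝ) :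
    Mem where
  nreg := fun r => if r = 0 then n else if r = 1 then k else if r = 2 then m
    else if r = 3 then B else 0
  rreg := fun r => if r = 0 then α else 0
  narr := fun _ _ => 0
  rarr := fun a => if a = 0 then sampleArray T else if a = 1 then sampleArray R
    else if a = 2 then sampleArray D else fun _ _ => 0

/-- Output of the drift tests: p-value and decision. -/
def driftOutput (s : Mem) : ℝ × ℕ := (s.rreg 0, s.nreg 0)

/-! ## Big-step semantics of programs without random draws -/

-- For two samples of the same size the earth mover's distance is the least mean cost of an
-- assignment. Any assignment bounds the supremum over Lipschitz functions from above. If dual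
-- variables `u`, `v` are feasible and tight on the assigned pairs, the function `z ↦ min_j (p (z -
-- y j) - v j)` is Lipschitz and attains the bound. This is `emd_eq_of_dual`. An algorithm therefore
-- only has to deliver an assignment together with such a certificate, and optimality need not be
-- discussed separately. The Hungarian method does this (`hungarian_term`): in each of `N` phases an
-- alternating tree absorbs at most `N + 1` columns, each at linear cost because the least slacks
-- are maintained, and then one path is flipped. That makes `O(N³)`; filling the cost matrix takes
-- `N²` evaluations of the norm, hence `O(m N²)`.
--
-- The batched test needs `2 n` distances between samples of size `k` and one p-value. The
-- substitution `x = √d tan θ` turns the integral of Student's density into an integral of a power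
-- of the cosine (`studentTwoTailed_eq`), and the reduction formula `cosInt_add_two` evaluates it
-- exactly in `O(n)` steps from an arctangent and square roots.
--
-- Permutation testing compares `2 N` points with `N` points. Repeating each of the `N` points does
-- not change the empirical distribution (`emd_append_self`), so the equal-size solver applies with
-- size `2 N`. Fisher–Yates produces an exactly uniform permutation in linear time
-- (`fisherYates_eq`), and `B` successive draws are the same as one uniform tuple
-- (`permOutcome_eq`).
--
-- The programs are verified in a Hoare logic that counts steps: `Term` for executions without
-- random draws, `Res` for the output distribution of a whole stack of programs. The norm evaluator
-- is known only through the distribution of its output. `exec_of_haltsWithin` recovers an actual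
-- execution from it, and a renaming keeps its memory apart from that of the surrounding program.

infixr:60 " ;; " => Prog.seq

/-- Started on memory `s`, the program halts after exactly `k` steps with memory `s'`, making no
random draws. -/
inductive Exec : Prog → Mem → ℕ → Mem → Prop
  | skip (s) : Exec .skip s 1 s
  | nset (x e s) : Exec (.nset x e) s 1 (s.setN x (e.eval s))
  | rset (x e s) : Exec (.rset x e) s 1 (s.setR x (e.eval s))
  | nput (a i e s) : Exec (.nput a i e) s 1 (s.putN a (i.eval s) (e.eval s))
  | rput (a i j e s) : Exec (.rput a i j e) s 1 (s.putR a (i.eval s) (j.eval s) (e.eval s))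
  | seq {P Q s k s' l s''} : Exec P s k s' → Exec Q s' l s'' → Exec (.seq P Q) s (k + l + 1) s''
  | iteTrue {b P Q s k s'} : b.Holds s → Exec P s k s' → Exec (.ite b P Q) s (k + 1) s'
  | iteFalse {b P Q s k s'} : ¬ b.Holds s → Exec Q s k s' → Exec (.ite b P Q) s (k + 1) s'
  | loopFalse {b P s} : ¬ b.Holds s → Exec (.loop b P) s 1 s
  | loopTrue {b P s k s' l s''} : b.Holds s → Exec P s k s' → Exec (.loop b P) s' l s'' →
      Exec (.loop b P) s (k + l + 1) s''

theorem run_succ (t : ℕ) (c : Config) : run (t + 1) c = (step c).bind (run t) := rfl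

/-- The continuation `K` and the remaining budget `t` are arbitrary, since in a `seq` or `loop` the
first part runs with the rest of the program still on the stack. -/
theorem Exec.run_eq {P s k s'} (h : Exec P s k s') :
    ∀ K t, run (k + t) (P :: K, s) = run t (K, s') := by
  induction h with
  | skip s => intro K t; rw [Nat.add_comm, run_succ]; simp [step]
  | nset x e s => intro K t; rw [Nat.add_comm, run_succ]; simp [step]
  | rset x e s => intro K t; rw [Nat.add_comm, run_succ]; simp [step]
  | nput a i e s => intro K t; rw [Nat.add_comm, run_succ]; simp [step]
  | rput a i j e s => intro K t; rw [Nat.add_comm, run_succ]; simp [step]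
  | @seq P Q s k s' l s'' _ _ ih1 ih2 =>
    intro K t
    rw [show k + l + 1 + t = (k + (l + t)) + 1 by ring, run_succ]
    simp [step, ih1, ih2]
  | @iteTrue b P Q s k s' hb _ ih =>
    intro K t
    rw [show k + 1 + t = (k + t) + 1 by ring, run_succ]
    simp [step, ih, hb]
  | @iteFalse b P Q s k s' hb _ ih =>
    intro K t
    rw [show k + 1 + t = (k + t) + 1 by ring, run_succ]
    simp [step, ih, hb]
  | @loopFalse b P s hb => intro K t; rw [Nat.add_comm, run_succ]; simp [step, hb]
  | @loopTrue b P s k s' l s'' hb _ _ ih1 ih2 =>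
    intro K t
    rw [show k + l + 1 + t = (k + (l + t)) + 1 by ring, run_succ]
    simp [step, ih1, ih2, hb]

/-- Consecutive execution of a list of programs. -/
inductive ExecList : List Prog → Mem → ℕ → Mem → Prop
  | nil (s) : ExecList [] s 0 s
  | cons {P K s k s' l s''} : Exec P s k s' → ExecList K s' l s'' →
      ExecList (P :: K) s (k + l) s''

theorem run_nil (t : ℕ) (s : Mem) : run t ([], s) = PMF.pure ([], s) := by
  induction t with
  | zero => rfl
  | succ t ih => rw [run_succ]; simp [step, ih]

/-- The converse of `Exec.run_eq`, needed because the norm evaluator is given by the distribution of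
its output. The induction on `t` is over whole stacks: one machine step replaces a compound program
by its parts, and the executions of the parts are reassembled, the added step being the one just
made. -/
theorem execList_of_run {α : Type} {out : Mem → α} {v : α} (t : ℕ) :
    ∀ (K : List Prog) (s : Mem), (∀ P ∈ K, P.Deterministic) →
      (run t (K, s)).map (result out) = PMF.pure (some v) →
      ∃ s' k, k ≤ t ∧ ExecList K s k s' ∧ out s' = v := by
  have pure_inj : ∀ a b : Option α, PMF.pure a = PMF.pure b → a = b := by
    intro a b h
    have := congrArg PMF.support h
    simpa using this
  induction t with
  | zero =>
    intro K s hK h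
    rw [run, PMF.pure_map] at h
    have h := pure_inj _ _ h
    cases K with
    | nil => exact ⟨s, 0, le_rfl, .nil s, by simpa [result] using h⟩
    | cons P K => simp [result] at h
  | succ t ih =>
    intro K s hK h
    cases K with
    | nil =>
      rw [run_nil, PMF.pure_map] at h
      exact ⟨s, 0, by omega, .nil s, by simpa [result] using pure_inj _ _ h⟩
    | cons P K =>
      rw [run_succ] at h
      have hP := hK P (by simp)
      have hK' : ∀ P ∈ K, P.Deterministic := fun Q hQ => hK Q (by simp [hQ])
      have key : ∀ {s1 : Mem}, Exec P s 1 s1 → (run t (K, s1)).map (result out) = PMF.pure (some v) →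
          ∃ s' k, k ≤ t + 1 ∧ ExecList (P :: K) s k s' ∧ out s' = v := by
        intro s1 he hr
        obtain ⟨s', k, hk, hx, ho⟩ := ih K s1 hK' hr
        exact ⟨s', 1 + k, by omega, .cons he hx, ho⟩
      cases P with
      | skip => exact key (.skip s) (by simpa [step] using h)
      | nset x e => exact key (.nset x e s) (by simpa [step] using h)
      | rset x e => exact key (.rset x e s) (by simpa [step] using h)
      | nput a i e => exact key (.nput a i e s) (by simpa [step] using h)
      | rput a i j e => exact key (.rput a i j e s) (by simpa [step] using h)
      | rand x e => exact absurd hP (by simp [Prog.Deterministic])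
      | seq P Q =>
        obtain ⟨s', k, hk, hx, ho⟩ := ih (P :: Q :: K) s
          (by simp only [Prog.Deterministic] at hP; simpa [hP.1, hP.2] using hK')
          (by simpa [step] using h)
        cases hx with
        | cons h1 h2 => cases h2 with
          | cons h2 h3 => exact ⟨s', _, by omega, .cons (.seq h1 h2) h3, ho⟩
      | ite b P Q =>
        simp only [Prog.Deterministic] at hP
        by_cases hb : b.Holds s
        · obtain ⟨s', k, hk, hx, ho⟩ := ih (P :: K) s
            (by simpa [hP.1] using hK') (by simpa [step, hb] using h)
          cases hx with
          | cons h1 h2 => exact ⟨s', _, by omega, .cons (.iteTrue hb h1) h2, ho⟩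
        · obtain ⟨s', k, hk, hx, ho⟩ := ih (Q :: K) s
            (by simpa [hP.2] using hK') (by simpa [step, hb] using h)
          cases hx with
          | cons h1 h2 => exact ⟨s', _, by omega, .cons (.iteFalse hb h1) h2, ho⟩
      | loop b P =>
        by_cases hb : b.Holds s
        · obtain ⟨s', k, hk, hx, ho⟩ := ih (P :: .loop b P :: K) s
            (by simp only [Prog.Deterministic] at hP; simpa [Prog.Deterministic, hP] using hK')
            (by simpa [step, hb] using h)
          cases hx with
          | cons h1 h2 => cases h2 with
            | cons h2 h3 => exact ⟨s', _, by omega, .cons (.loopTrue hb h1 h2) h3, ho⟩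
        · exact key (.loopFalse hb) (by simpa [step, hb] using h)

theorem exec_of_haltsWithin {α : Type} {out : Mem → α} {v : α} {P : Prog} {s : Mem} {t : ℕ}
    (hP : P.Deterministic) (h : HaltsWithin P s t out (PMF.pure v)) :
    ∃ s' k, k ≤ t ∧ Exec P s k s' ∧ out s' = v := by
  obtain ⟨s', k, hk, hx, ho⟩ := execList_of_run (out := out) (v := v) t [P] s (by simpa using hP)
    (by rw [HaltsWithin, PMF.pure_map] at h; exact h)
  cases hx with
  | cons h1 h2 => cases h2; exact ⟨s', _, hk, h1, ho⟩

/-! ## The names written by a program -/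

/-- These tests are Boolean-valued so that, for a concrete program text and name, the side
conditions of `Frame` hold by `rfl`. Only names are tracked, not individual array cells. -/
def Prog.writesN (x : ℕ) : Prog → Bool
  | .nset y _ => x == y
  | .rand y _ => x == y
  | .seq P Q => P.writesN x || Q.writesN x
  | .ite _ P Q => P.writesN x || Q.writesN x
  | .loop _ P => P.writesN x
  | _ => false

def Prog.writesR (x : ℕ) : Prog → Bool
  | .rset y _ => x == y
  | .seq P Q => P.writesR x || Q.writesR x
  | .ite _ P Q => P.writesR x || Q.writesR x
  | .loop _ P => P.writesR x
  | _ => false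

def Prog.writesNA (x : ℕ) : Prog → Bool
  | .nput y _ _ => x == y
  | .seq P Q => P.writesNA x || Q.writesNA x
  | .ite _ P Q => P.writesNA x || Q.writesNA x
  | .loop _ P => P.writesNA x
  | _ => false

def Prog.writesRA (x : ℕ) : Prog → Bool
  | .rput y _ _ _ => x == y
  | .seq P Q => P.writesRA x || Q.writesRA x
  | .ite _ P Q => P.writesRA x || Q.writesRA x
  | .loop _ P => P.writesRA x
  | _ => false

/-- The memories agree on everything that `P` does not write. -/
structure Frame (P : Prog) (s s' : Mem) : Prop where
  nreg : ∀ x, P.writesN x = false → s'.nreg x = s.nreg x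
  rreg : ∀ x, P.writesR x = false → s'.rreg x = s.rreg x
  narr : ∀ x, P.writesNA x = false → s'.narr x = s.narr x
  rarr : ∀ x, P.writesRA x = false → s'.rarr x = s.rarr x

theorem Frame.refl (P : Prog) (s : Mem) : Frame P s s :=
  ⟨fun _ _ => rfl, fun _ _ => rfl, fun _ _ => rfl, fun _ _ => rfl⟩

theorem Frame.trans {P : Prog} {s s' s'' : Mem} (h : Frame P s s') (h' : Frame P s' s'') :
    Frame P s s'' :=
  ⟨fun x hx => (h'.nreg x hx).trans (h.nreg x hx), fun x hx => (h'.rreg x hx).trans (h.rreg x hx),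
    fun x hx => (h'.narr x hx).trans (h.narr x hx), fun x hx => (h'.rarr x hx).trans (h.rarr x hx)⟩

/-- Every name written by `P` is written by `Q`. -/
structure Prog.WritesLE (P Q : Prog) : Prop where
  nreg : ∀ x, Q.writesN x = false → P.writesN x = false
  rreg : ∀ x, Q.writesR x = false → P.writesR x = false
  narr : ∀ x, Q.writesNA x = false → P.writesNA x = false
  rarr : ∀ x, Q.writesRA x = false → P.writesRA x = false

theorem Frame.mono {P Q : Prog} {s s' : Mem} (h : Frame P s s') (hPQ : P.WritesLE Q) :
    Frame Q s s' :=
  ⟨fun x hx => h.nreg x (hPQ.nreg x hx), fun x hx => h.rreg x (hPQ.rreg x hx),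
    fun x hx => h.narr x (hPQ.narr x hx), fun x hx => h.rarr x (hPQ.rarr x hx)⟩

theorem Prog.writesLE_seq_left (P Q : Prog) : P.WritesLE (P ;; Q) := by
  constructor <;> intro x hx <;>
    simp_all [Prog.writesN, Prog.writesR, Prog.writesNA, Prog.writesRA]

theorem Prog.writesLE_seq_right (P Q : Prog) : Q.WritesLE (P ;; Q) := by
  constructor <;> intro x hx <;>
    simp_all [Prog.writesN, Prog.writesR, Prog.writesNA, Prog.writesRA]

theorem Prog.writesLE_ite_left (b : BExp) (P Q : Prog) : P.WritesLE (.ite b P Q) := by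
  constructor <;> intro x hx <;>
    simp_all [Prog.writesN, Prog.writesR, Prog.writesNA, Prog.writesRA]

theorem Prog.writesLE_ite_right (b : BExp) (P Q : Prog) : Q.WritesLE (.ite b P Q) := by
  constructor <;> intro x hx <;>
    simp_all [Prog.writesN, Prog.writesR, Prog.writesNA, Prog.writesRA]

theorem Prog.writesLE_loop (b : BExp) (P : Prog) : P.WritesLE (.loop b P) := by
  constructor <;> intro x hx <;> exact hx

theorem frame_setN (x v : ℕ) (e : NExp) (s : Mem) : Frame (.nset x e) s (s.setN x v) := by
  constructor <;> intro y hy <;>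
    simp_all [Prog.writesN, Mem.setN]

theorem Exec.frame {P s k s'} (h : Exec P s k s') : Frame P s s' := by
  induction h with
  | skip s => exact .refl _ _
  | nset x e s => exact frame_setN _ _ _ _
  | rset x e s => constructor <;> intro y hy <;> simp_all [Prog.writesR, Mem.setR]
  | nput a i e s => constructor <;> intro y hy <;> simp_all [Prog.writesNA, Mem.putN]
  | rput a i j e s => constructor <;> intro y hy <;> simp_all [Prog.writesRA, Mem.putR]
  | seq _ _ ih1 ih2 =>
    exact (ih1.mono (Prog.writesLE_seq_left _ _)).trans (ih2.mono (Prog.writesLE_seq_right _ _))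
  | iteTrue _ _ ih => exact ih.mono (Prog.writesLE_ite_left _ _ _)
  | iteFalse _ _ ih => exact ih.mono (Prog.writesLE_ite_right _ _ _)
  | loopFalse _ => exact .refl _ _
  | loopTrue _ _ _ ih1 ih2 => exact (ih1.mono (Prog.writesLE_loop _ _)).trans ih2

/-! ## Total correctness with a time bound -/

/-- Started on `s`, the program halts within `T` steps, without random draws, and the final
memory satisfies `Q`. -/
def Term (P : Prog) (s : Mem) (T : ℕ) (Q : Mem → Prop) : Prop :=
  ∃ s' k, k ≤ T ∧ Exec P s k s' ∧ Q s'

theorem Term.mono {P s T T' Q Q'} (h : Term P s T Q) (hT : T ≤ T')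
    (hQ : ∀ s', Frame P s s' → Q s' → Q' s') : Term P s T' Q' := by
  obtain ⟨s', k, hk, hx, hq⟩ := h
  exact ⟨s', k, hk.trans hT, hx, hQ s' hx.frame hq⟩

theorem Term.le {P s T T' Q} (h : Term P s T Q) (hT : T ≤ T') : Term P s T' Q :=
  h.mono hT fun _ _ h => h

theorem Term.seq {P P' s T T' Q Q'} (h : Term P s T Q)
    (h' : ∀ s', Frame P s s' → Q s' → Term P' s' T' Q') : Term (P ;; P') s (T + T' + 1) Q' := by
  obtain ⟨s', k, hk, hx, hq⟩ := h
  obtain ⟨s'', k', hk', hx', hq'⟩ := h' s' hx.frame hq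
  exact ⟨s'', k + k' + 1, by omega, hx.seq hx', hq'⟩

theorem Term.ite {b P P' s T Q} (h : b.Holds s → Term P s T Q) (h' : ¬ b.Holds s → Term P' s T Q) :
    Term (.ite b P P') s (T + 1) Q := by
  by_cases hb : b.Holds s
  · obtain ⟨s', k, hk, hx, hq⟩ := h hb
    exact ⟨s', k + 1, by omega, .iteTrue hb hx, hq⟩
  · obtain ⟨s', k, hk, hx, hq⟩ := h' hb
    exact ⟨s', k + 1, by omega, .iteFalse hb hx, hq⟩

/-- The rule for loops: an invariant and a decreasing measure. -/
theorem Term.loop {b P c} (Inv : Mem → Prop) (μ : Mem → ℕ) {s₀ : Mem}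
    (h : ∀ s, Frame P s₀ s → Inv s → b.Holds s → Term P s c fun s' => Inv s' ∧ μ s' < μ s)
    (h₀ : Inv s₀) :
    Term (.loop b P) s₀ (μ s₀ * (c + 1) + 1) fun s' => Inv s' ∧ ¬ b.Holds s' := by
  suffices H : ∀ n s, μ s ≤ n → Frame P s₀ s → Inv s →
      Term (.loop b P) s (n * (c + 1) + 1) fun s' => Inv s' ∧ ¬ b.Holds s' from
    H _ s₀ le_rfl (.refl _ _) h₀
  intro n
  induction n with
  | zero =>
    intro s hn hf hi
    by_cases hb : b.Holds s
    · obtain ⟨s', k, _, _, hq⟩ := h s hf hi hb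
      omega
    · exact ⟨s, 1, by omega, .loopFalse hb, hi, hb⟩
  | succ n ih =>
    intro s hn hf hi
    by_cases hb : b.Holds s
    · obtain ⟨s', k, hk, hx, hq⟩ := h s hf hi hb
      obtain ⟨s'', k', hk', hx', hq'⟩ := ih s' (by omega) (hf.trans hx.frame) hq.1
      exact ⟨s'', k + k' + 1, by rw [Nat.succ_mul]; omega, .loopTrue hb hx hx', hq'⟩
    · exact ⟨s, 1, by omega, .loopFalse hb, hi, hb⟩

/-- `for x = lo, …, hi - 1 do body`. -/
def forUp (x : ℕ) (lo hi : NExp) (body : Prog) : Prog :=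
  .nset x lo ;; .loop (.nlt (.reg x) hi) (body ;; .nset x (.add (.reg x) (.const 1)))

theorem Mem.setN_nreg (s : Mem) (x v y : ℕ) :
    (s.setN x v).nreg y = if y = x then v else s.nreg y := by
  simp [Mem.setN, Function.update_apply]

/-- The invariant takes the index as an argument and must not depend on the counter register, which
is changed between two rounds. Everything the loop does not write is available through the frame, so
invariants describe only what changes. A round costs the body plus the test, the sequencing and the
increment. -/
theorem Term.forUp {x lo hi body c s} (n : ℕ) (Inv : ℕ → Mem → Prop)
    (hx : body.writesN x = false)
    (hlo : lo.eval s ≤ n)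
    (hhi : ∀ s', Frame (forUp x lo hi body) s s' → hi.eval s' = n)
    (hInv : ∀ i s v, Inv i s → Inv i (s.setN x v))
    (h₀ : Inv (lo.eval s) s)
    (hstep : ∀ i s', lo.eval s ≤ i → i < n → Frame (_root_.forUp x lo hi body) s s' →
      s'.nreg x = i → Inv i s' → Term body s' c (Inv (i + 1))) :
    Term (forUp x lo hi body) s ((n - lo.eval s) * (c + 3) + 3) (Inv n) := by
  have hw : (body ;; Prog.nset x (.add (.reg x) (.const 1))).WritesLE (_root_.forUp x lo hi body) :=
    ⟨fun y hy => by simp_all [_root_.forUp, Prog.writesN],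
     fun y hy => by simp_all [_root_.forUp, Prog.writesR],
     fun y hy => by simp_all [_root_.forUp, Prog.writesNA],
     fun y hy => by simp_all [_root_.forUp, Prog.writesRA]⟩
  have hf0 : Frame (_root_.forUp x lo hi body) s (s.setN x (lo.eval s)) :=
    (frame_setN x _ lo s).mono (Prog.writesLE_seq_left _ _)
  have hloop := Term.loop (b := .nlt (.reg x) hi)
    (P := body ;; .nset x (.add (.reg x) (.const 1))) (c := c + 2)
    (fun s' => lo.eval s ≤ s'.nreg x ∧ s'.nreg x ≤ n ∧ Inv (s'.nreg x) s')
    (fun s' => n - s'.nreg x) (s₀ := s.setN x (lo.eval s)) ?_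
    (by simp only [Mem.setN_nreg, if_true]; exact ⟨le_rfl, hlo, hInv _ _ _ h₀⟩)
  · obtain ⟨s', k, hk, hx, ⟨h1, h2, h3⟩, h4⟩ := hloop
    refine ⟨s', 1 + k + 1, ?_, .seq (.nset _ _ _) hx, ?_⟩
    · simp only [Mem.setN_nreg, if_true, show c + 2 + 1 = c + 3 from rfl] at hk
      omega
    · have : s'.nreg x = n := by
        simp only [BExp.Holds, NExp.eval,
          hhi s' (hf0.trans (hx.frame.mono (Prog.writesLE_seq_right _ _)))] at h4
        omega
      rwa [this] at h3
  · intro s' hf ⟨h1, h2, h3⟩ hb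
    have hf' := hf0.trans (hf.mono hw)
    simp only [BExp.Holds, NExp.eval, hhi s' hf'] at hb
    refine Term.mono (Term.seq (T' := 1) (hstep _ s' h1 hb hf' rfl h3) (Q' := fun s'' =>
      ∃ s1, Frame body s' s1 ∧ Inv (s'.nreg x + 1) s1 ∧ s'' = s1.setN x (s1.nreg x + 1)) ?_) le_rfl ?_
    · intro s1 hf1 hi1
      exact ⟨_, 1, le_rfl, .nset _ _ _, s1, hf1, hi1, by simp [NExp.eval]⟩
    · rintro _ - ⟨s1, hf1, hi1, rfl⟩
      have := hf1.nreg x hx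
      simp only [Mem.setN_nreg, if_true, this]
      exact ⟨⟨by omega, by omega, hInv _ _ _ hi1⟩, by omega⟩

/-! ### Straight-line programs -/

def Prog.straight : Prog → Bool
  | .rand _ _ => false
  | .seq P Q => P.straight && Q.straight
  | .ite _ P Q => P.straight && Q.straight
  | .loop _ _ => false
  | _ => true

def Prog.cost : Prog → ℕ
  | .seq P Q => P.cost + Q.cost + 1
  | .ite _ P Q => max P.cost Q.cost + 1
  | _ => 1

-- The default case also covers draws and loops, where the value is meaningless; it is used only for
-- programs with `straight = true`. A function, unlike a relation, can be evaluated by `simp`.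
open Classical in
noncomputable def Prog.effect : Prog → Mem → Mem
  | .nset x e, s => s.setN x (e.eval s)
  | .rset x e, s => s.setR x (e.eval s)
  | .nput a i e, s => s.putN a (i.eval s) (e.eval s)
  | .rput a i j e, s => s.putR a (i.eval s) (j.eval s) (e.eval s)
  | .seq P Q, s => Q.effect (P.effect s)
  | .ite b P Q, s => if b.Holds s then P.effect s else Q.effect s
  | _, s => s

theorem Prog.exec_straight (P : Prog) (h : P.straight = true) (s : Mem) :
    ∃ k ≤ P.cost, Exec P s k (P.effect s) := by
  induction P generalizing s with
  | skip => exact ⟨1, le_rfl, .skip s⟩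
  | nset x e => exact ⟨1, le_rfl, .nset x e s⟩
  | rset x e => exact ⟨1, le_rfl, .rset x e s⟩
  | nput a i e => exact ⟨1, le_rfl, .nput a i e s⟩
  | rput a i j e => exact ⟨1, le_rfl, .rput a i j e s⟩
  | rand x e => simp [straight] at h
  | seq P Q ih1 ih2 =>
    simp only [straight, Bool.and_eq_true] at h
    obtain ⟨k, hk, hx⟩ := ih1 h.1 s
    obtain ⟨l, hl, hy⟩ := ih2 h.2 (P.effect s)
    exact ⟨k + l + 1, by simp only [cost]; omega, hx.seq hy⟩
  | ite b P Q ih1 ih2 =>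
    simp only [straight, Bool.and_eq_true] at h
    obtain ⟨k, hk, hx⟩ := ih1 h.1 s
    obtain ⟨l, hl, hy⟩ := ih2 h.2 s
    by_cases hb : b.Holds s
    · exact ⟨k + 1, by simp only [cost]; omega, by simpa [effect, hb] using Exec.iteTrue hb hx⟩
    · exact ⟨l + 1, by simp only [cost]; omega, by simpa [effect, hb] using Exec.iteFalse hb hy⟩
  | loop b P => simp [straight] at h

theorem Term.straight {P s T Q} (h : P.straight = true) (hT : P.cost ≤ T) (hQ : Q (P.effect s)) :
    Term P s T Q := by
  obtain ⟨k, hk, hx⟩ := P.exec_straight h s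
  exact ⟨_, k, hk.trans hT, hx, hQ⟩

section MemLemmas
variable (s : Mem) (x y a b i j k l v : ℕ) (r : ℝ)

theorem Mem.setN_rreg : (s.setN x v).rreg = s.rreg := rfl
theorem Mem.setN_narr : (s.setN x v).narr = s.narr := rfl
theorem Mem.setN_rarr : (s.setN x v).rarr = s.rarr := rfl
theorem Mem.setR_nreg : (s.setR x r).nreg = s.nreg := rfl
theorem Mem.setR_narr : (s.setR x r).narr = s.narr := rfl
theorem Mem.setR_rarr : (s.setR x r).rarr = s.rarr := rfl
theorem Mem.putN_nreg : (s.putN a i v).nreg = s.nreg := rfl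
theorem Mem.putN_rreg : (s.putN a i v).rreg = s.rreg := rfl
theorem Mem.putN_rarr : (s.putN a i v).rarr = s.rarr := rfl
theorem Mem.putR_nreg : (s.putR a i j r).nreg = s.nreg := rfl
theorem Mem.putR_rreg : (s.putR a i j r).rreg = s.rreg := rfl
theorem Mem.putR_narr : (s.putR a i j r).narr = s.narr := rfl
theorem Mem.setR_rreg : (s.setR x r).rreg y = if y = x then r else s.rreg y := by
  simp [Mem.setR, Function.update_apply]
theorem Mem.putN_narr :
    (s.putN a i v).narr b j = if b = a then (if j = i then v else s.narr a j) else s.narr b j := by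
  by_cases h : b = a <;> simp [Mem.putN, Function.update_apply, h]
theorem Mem.putR_rarr : (s.putR a i j r).rarr b k l =
    if b = a then (if k = i ∧ l = j then r else s.rarr a k l) else s.rarr b k l := by
  by_cases h : b = a
  · by_cases h' : k = i <;> simp [Mem.putR, Function.update_apply, h, h']
  · simp [Mem.putR, h]
end MemLemmas

attribute [simp] Mem.setN_nreg Mem.setN_rreg Mem.setN_narr Mem.setN_rarr Mem.setR_nreg Mem.setR_rreg
  Mem.setR_narr Mem.setR_rarr Mem.putN_nreg Mem.putN_rreg Mem.putN_narr Mem.putN_rarr Mem.putR_nreg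
  Mem.putR_rreg Mem.putR_narr Mem.putR_rarr

/-! ## Renaming -/

def NExp.shift (d : ℕ) : NExp → NExp
  | .const c => .const c
  | .reg x => .reg (x + d)
  | .arr a i => .arr (a + d) (i.shift d)
  | .add e f => .add (e.shift d) (f.shift d)
  | .sub e f => .sub (e.shift d) (f.shift d)

def RExp.shift (d : ℕ) : RExp → RExp
  | .ofNat e => .ofNat (e.shift d)
  | .reg x => .reg (x + d)
  | .arr a i j => .arr (a + d) (i.shift d) (j.shift d)
  | .add e f => .add (e.shift d) (f.shift d)
  | .sub e f => .sub (e.shift d) (f.shift d)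
  | .mul e f => .mul (e.shift d) (f.shift d)
  | .div e f => .div (e.shift d) (f.shift d)
  | .sqrt e => .sqrt (e.shift d)
  | .arctan e => .arctan (e.shift d)

def BExp.shift (d : ℕ) : BExp → BExp
  | .nlt e f => .nlt (e.shift d) (f.shift d)
  | .rlt e f => .rlt (e.shift d) (f.shift d)
  | .not b => .not (b.shift d)
  | .and b c => .and (b.shift d) (c.shift d)

/-- The program with all register and array names increased by `d`. -/
def Prog.shift (d : ℕ) : Prog → Prog
  | .skip => .skip
  | .nset x e => .nset (x + d) (e.shift d)
  | .rset x e => .rset (x + d) (e.shift d)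
  | .nput a i e => .nput (a + d) (i.shift d) (e.shift d)
  | .rput a i j e => .rput (a + d) (i.shift d) (j.shift d) (e.shift d)
  | .rand x e => .rand (x + d) (e.shift d)
  | .seq P Q => .seq (P.shift d) (Q.shift d)
  | .ite b P Q => .ite (b.shift d) (P.shift d) (Q.shift d)
  | .loop b P => .loop (b.shift d) (P.shift d)

def Mem.unshift (d : ℕ) (s : Mem) : Mem where
  nreg x := s.nreg (x + d)
  rreg x := s.rreg (x + d)
  narr x := s.narr (x + d)
  rarr x := s.rarr (x + d)

theorem NExp.eval_shift (d : ℕ) (s : Mem) (e : NExp) :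
    (e.shift d).eval s = e.eval (s.unshift d) := by
  induction e <;> simp_all [NExp.shift, NExp.eval, Mem.unshift]

theorem RExp.eval_shift (d : ℕ) (s : Mem) (e : RExp) :
    (e.shift d).eval s = e.eval (s.unshift d) := by
  induction e <;> simp_all [RExp.shift, RExp.eval, NExp.eval_shift] <;> rfl

theorem BExp.holds_shift (d : ℕ) (s : Mem) (b : BExp) :
    (b.shift d).Holds s ↔ b.Holds (s.unshift d) := by
  induction b <;> simp_all [BExp.shift, BExp.Holds, NExp.eval_shift, RExp.eval_shift]

/-- Evaluation and assignment commute with `Mem.unshift`, so the renamed program simulates the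
original one on the names from `d` upwards, step for step. -/
theorem Exec.shift (d : ℕ) {P s k s'} (h : Exec P s k s') :
    ∀ S : Mem, S.unshift d = s → ∃ S', Exec (P.shift d) S k S' ∧ S'.unshift d = s' := by
  induction h with
  | skip s => exact fun S hS => ⟨S, .skip S, hS⟩
  | nset x e s =>
    rintro S rfl
    refine ⟨_, .nset _ _ S, ?_⟩
    simp only [NExp.eval_shift, Mem.unshift, Mem.setN]
    congr 1; ext y; simp [Function.update_apply]
  | rset x e s =>
    rintro S rfl
    refine ⟨_, .rset _ _ S, ?_⟩
    simp only [RExp.eval_shift, Mem.unshift, Mem.setR]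
    congr 1; ext y; simp [Function.update_apply]
  | nput a i e s =>
    rintro S rfl
    refine ⟨_, .nput _ _ _ S, ?_⟩
    simp only [NExp.eval_shift, Mem.unshift, Mem.putN]
    congr 1; ext y; simp [Function.update_apply]
  | rput a i j e s =>
    rintro S rfl
    refine ⟨_, .rput _ _ _ _ S, ?_⟩
    simp only [NExp.eval_shift, RExp.eval_shift, Mem.unshift, Mem.putR]
    congr 1; ext y; simp [Function.update_apply]
  | seq _ _ ih1 ih2 =>
    intro S hS
    obtain ⟨S', hx, hS'⟩ := ih1 S hS
    obtain ⟨S'', hx', hS''⟩ := ih2 S' hS'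
    exact ⟨S'', hx.seq hx', hS''⟩
  | iteTrue hb _ ih =>
    intro S hS
    obtain ⟨S', hx, hS'⟩ := ih S hS
    exact ⟨S', .iteTrue ((BExp.holds_shift _ _ _).2 (hS ▸ hb)) hx, hS'⟩
  | iteFalse hb _ ih =>
    intro S hS
    obtain ⟨S', hx, hS'⟩ := ih S hS
    exact ⟨S', .iteFalse (fun h => hb (hS ▸ (BExp.holds_shift _ _ _).1 h)) hx, hS'⟩
  | loopFalse hb =>
    intro S hS
    exact ⟨S, .loopFalse (fun h => hb (hS ▸ (BExp.holds_shift _ _ _).1 h)), hS⟩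
  | loopTrue hb _ _ ih1 ih2 =>
    intro S hS
    obtain ⟨S', hx, hS'⟩ := ih1 S hS
    obtain ⟨S'', hx', hS''⟩ := ih2 S' hS'
    exact ⟨S'', .loopTrue ((BExp.holds_shift _ _ _).2 (hS ▸ hb)) hx hx', hS''⟩

theorem Prog.shift_writes {d x : ℕ} (hx : x < d) (P : Prog) :
    (P.shift d).writesN x = false ∧ (P.shift d).writesR x = false ∧
      (P.shift d).writesNA x = false ∧ (P.shift d).writesRA x = false := by
  have hne : ∀ y, (x == y + d) = false := fun y => by
    rw [beq_eq_false_iff_ne]; omega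
  induction P <;> simp_all [shift, writesN, writesR, writesNA, writesRA]

theorem Prog.Deterministic.shift (d : ℕ) {P : Prog} (h : P.Deterministic) :
    (P.shift d).Deterministic := by
  induction P <;> simp_all [Prog.shift, Prog.Deterministic]

/-! ## Randomized programs -/

/-- From the configuration `c`, the machine halts within `T` steps, whatever the random draws,
and its output has distribution `μ`. -/
def Res {α : Type} (out : Mem → α) (c : Config) (T : ℕ) (μ : PMF α) : Prop :=
  ∀ t, T ≤ t → (run t c).map (result out) = μ.map some

section Res
variable {α : Type} {out : Mem → α} {K : List Prog} {s : Mem} {T : ℕ} {μ : PMF α}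

theorem Res.le {c : Config} {T' : ℕ} (h : Res out c T μ) (hT : T ≤ T') : Res out c T' μ :=
  fun t ht => h t (hT.trans ht)

theorem Res.haltsWithin {P : Prog} (h : Res out ([P], s) T μ) : HaltsWithin P s T out μ :=
  h T le_rfl

theorem Res.nil : Res out ([], s) 0 (PMF.pure (out s)) := by
  intro t _
  simp [run_nil, PMF.pure_map, result]

/-- Distributions are reasoned about backwards, from the end of the stack: a part without draws only
changes the memory and leaves the output distribution `μ` alone. -/
theorem Res.term {P : Prog} {T' : ℕ} {Q : Mem → Prop} (h : Term P s T Q)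
    (h' : ∀ s', Frame P s s' → Q s' → Res out (K, s') T' μ) : Res out (P :: K, s) (T + T') μ := by
  obtain ⟨s', k, hk, hx, hq⟩ := h
  intro t ht
  rw [show t = k + (t - k) by omega, hx.run_eq]
  exact h' s' hx.frame hq _ (by omega)

theorem Res.of_step {c c' : Config} (hc : step c = PMF.pure c') (h : Res out c' T μ) :
    Res out c (T + 1) μ := by
  intro t ht
  rw [show t = (t - 1) + 1 by omega, run_succ, hc, PMF.pure_bind]
  exact h _ (by omega)

theorem Res.seq {P Q : Prog} (h : Res out (P :: Q :: K, s) T μ) :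
    Res out ((P ;; Q) :: K, s) (T + 1) μ := h.of_step rfl

theorem Res.loopFalse {b : BExp} {P : Prog} (hb : ¬ b.Holds s) (h : Res out (K, s) T μ) :
    Res out (.loop b P :: K, s) (T + 1) μ := h.of_step (by simp [step, hb])

theorem Res.loopTrue {b : BExp} {P : Prog} (hb : b.Holds s)
    (h : Res out (P :: .loop b P :: K, s) T μ) :
    Res out (.loop b P :: K, s) (T + 1) μ := h.of_step (by simp [step, hb])

theorem Res.rand {x : ℕ} {e : NExp} {G : ℕ → PMF α} {n : ℕ} (he : e.eval s = n)
    (h : ∀ v ≤ n, Res out (K, s.setN x v) T (G v)) :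
    Res out (.rand x e :: K, s) (T + 1)
      ((PMF.uniformOfFintype (Fin (n + 1))).bind fun v => G v) := by
  subst he
  intro t ht
  rw [show t = (t - 1) + 1 by omega, run_succ]
  simp only [step, PMF.bind_map, PMF.map_bind, Function.comp_def]
  congr 1
  funext v
  exact h v (by omega) _ (by omega)

theorem Term.haltsWithin {P : Prog} {v : α} (h : Term P s T fun s' => out s' = v) :
    HaltsWithin P s T out (PMF.pure v) := by
  refine Res.haltsWithin (Res.term (T' := 0) h ?_)
  rintro s' - rfl
  exact Res.nil
end Res

/-! ## The Hungarian method: invariants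

Rows and columns are numbered `1, …, N`; column `0` is an auxiliary column. `p j` is the row matched
to column `j` (`0` if there is none), `u` and `v` are the dual variables, `w j` is the time at which
column `j` joined the alternating tree (`0` if it has not), `rm` marks the rows of the tree,
`way j` is the column before `j` on the alternating path, and `mv j` is the least slack between
column `j` and a row of the tree. -/

/-- `p` matches the rows `1, …, i` with columns other than `h`, `u` and `v` are dual feasible, and
matched edges are tight. -/
structure DualMatching (N i : ℕ) (c : ℕ → ℕ → ℝ) (p : ℕ → ℕ) (u v : ℕ → ℝ) (h : ℕ) : Prop where
  le : ∀ j ≤ N, j ≠ h → p j ≤ i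
  inj : ∀ j ≤ N, ∀ j' ≤ N, j ≠ h → j' ≠ h → p j ≠ 0 → p j = p j' → j = j'
  surj : ∀ r, 1 ≤ r → r ≤ i → ∃ j ≤ N, j ≠ h ∧ p j = r
  feas : ∀ r j, 1 ≤ r → r ≤ N → 1 ≤ j → j ≤ N → u r + v j ≤ c r j
  tight : ∀ j, 1 ≤ j → j ≤ N → j ≠ h → p j ≠ 0 → u (p j) + v j = c (p j) j

/-- The alternating tree, grown for `t` steps. -/
structure AltTree (N t : ℕ) (c : ℕ → ℕ → ℝ) (p w rm way : ℕ → ℕ) (u v : ℕ → ℝ) : Prop where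
  matched : ∀ j ≤ N, w j ≠ 0 → p j ≠ 0 ∧ w j ≤ t
  parent : ∀ j, 1 ≤ j → j ≤ N → w j ≠ 0 → way j ≤ N ∧ w (way j) ≠ 0 ∧ w (way j) < w j ∧
    u (p (way j)) + v j = c (p (way j)) j
  mark : ∀ r, 1 ≤ r → r ≤ N → (rm r ≠ 0 ↔ ∃ j ≤ N, w j ≠ 0 ∧ p j = r)
  count : t + ((Finset.range (N + 1)).filter fun j => w j = 0).card = N + 1

/-- `mv` and `way` describe the least slack of the columns outside the tree. -/
def Frontier (N : ℕ) (c : ℕ → ℕ → ℝ) (p w way : ℕ → ℕ) (u v mv : ℕ → ℝ) : Prop :=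
  ∀ j, 1 ≤ j → j ≤ N → w j = 0 → way j ≤ N ∧ w (way j) ≠ 0 ∧
    mv j = c (p (way j)) j - u (p (way j)) - v j ∧
    ∀ l ≤ N, w l ≠ 0 → mv j ≤ c (p l) j - u (p l) - v j

/-- The state in which column `j₀` is about to join the tree. -/
structure GrowState (N i t : ℕ) (c : ℕ → ℕ → ℝ) (p w rm way : ℕ → ℕ) (u v mv : ℕ → ℝ)
    (j₀ : ℕ) : Prop where
  dual : DualMatching N i c p u v (N + 1)
  root : p 0 ≠ 0
  tree : AltTree N t c p w rm way u v
  le : j₀ ≤ N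
  unused : w j₀ = 0
  front : (j₀ = 0 ∧ ∀ j ≤ N, w j = 0) ∨
    (j₀ ≠ 0 ∧ w 0 ≠ 0 ∧ Frontier N c p w way u v mv ∧ mv j₀ = 0)

/-- The new row is parked in the auxiliary column `0`, which carries no tightness condition. The
index `N + 1` is out of range, so a hole at `N + 1` means that there is none. -/
theorem DualMatching.start {N i c p u v} (h : DualMatching N i c p u v 0) :
    DualMatching N (i + 1) c (Function.update p 0 (i + 1)) u v (N + 1) where
  le j hj _ := by
    by_cases hj0 : j = 0
    · simp [hj0]
    · simpa [hj0] using (h.le j hj hj0).trans (Nat.le_succ i)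
  inj j hj j' hj' _ _ hp he := by
    by_cases h0 : j = 0 <;> by_cases h0' : j' = 0 <;>
      simp only [Function.update_apply, h0, h0', if_true, if_false] at he hp ⊢
    · have := h.le j' hj' h0'; omega
    · have := h.le j hj h0; omega
    · exact h.inj j hj j' hj' h0 h0' hp he
  surj r hr hri := by
    by_cases hr' : r = i + 1
    · exact ⟨0, by omega, by omega, by simp [hr']⟩
    · obtain ⟨j, hj, hj0, hp⟩ := h.surj r hr (by omega)
      exact ⟨j, hj, by omega, by simp [hj0, hp]⟩
  feas := h.feas
  tight j hj hjN _ hp := by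
    have hj0 : j ≠ 0 := by omega
    simp only [Function.update_apply, hj0, if_false] at hp ⊢
    exact h.tight j hj hjN hj0 hp

theorem DualMatching.hole {N i c p u v h} (hm : DualMatching N i c p u v (N + 1))
    (hp : p h = 0) : DualMatching N i c p u v h where
  le j hj _ := hm.le j hj (by omega)
  inj j hj j' hj' _ _ := hm.inj j hj j' hj' (by omega) (by omega)
  surj r hr hri := by
    obtain ⟨j, hj, _, hpj⟩ := hm.surj r hr hri
    refine ⟨j, hj, ?_, hpj⟩
    rintro rfl
    omega
  feas := hm.feas
  tight j hj hjN _ := hm.tight j hj hjN (by omega)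

/-- One flip of the alternating path: the row of column `k` moves along a tight edge into the hole
`h`, and `k` becomes the hole. The dual variables stay the same. -/
theorem DualMatching.move {N i c p u v h k} (hm : DualMatching N i c p u v h) (hN : h ≤ N)
    (hkN : k ≤ N) (hk : k ≠ h) (htight : u (p k) + v h = c (p k) h) :
    DualMatching N i c (Function.update p h (p k)) u v k where
  le j hj hjk := by
    by_cases hjh : j = h
    · simpa [hjh] using hm.le k hkN hk
    · simpa [hjh] using hm.le j hj hjh
  inj j hj j' hj' hjk hjk' hp he := by
    by_cases h0 : j = h <;> by_cases h0' : j' = h <;>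
      simp only [Function.update_apply, h0, h0', if_true, if_false] at he hp ⊢
    · exact absurd (hm.inj k hkN j' hj' hk h0' hp he).symm hjk'
    · exact absurd (hm.inj j hj k hkN h0 hk hp he) hjk
    · exact hm.inj j hj j' hj' h0 h0' hp he
  surj r hr hri := by
    obtain ⟨j, hj, hjh, hp⟩ := hm.surj r hr hri
    by_cases hjk : j = k
    · exact ⟨h, hN, hk.symm, by simp [← hjk, hp]⟩
    · exact ⟨j, hj, hjk, by simp [hjh, hp]⟩
  feas := hm.feas
  tight j hj hjN hjk hp := by
    by_cases hjh : j = h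
    · simpa [hjh] using htight
    · simp only [Function.update_apply, hjh, if_false] at hp ⊢
      exact hm.tight j hj hjN hjh hp

theorem growState_start {N i c p rm way u v mv} {w : ℕ → ℕ} (hm : DualMatching N i c p u v (N + 1))
    (hp : p 0 ≠ 0) (hw : ∀ j ≤ N, w j = 0) (hrm : ∀ j ≤ N, rm j = 0) :
    GrowState N i 0 c p w rm way u v mv 0 where
  dual := hm
  root := hp
  tree :=
    { matched := fun j hj h => absurd (hw j hj) h
      parent := fun j _ hj h => absurd (hw j hj) h
      mark := fun r _ hr => by
        constructor
        · intro h; exact absurd (hrm r hr) h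
        · rintro ⟨j, hj, h, _⟩; exact absurd (hw j hj) h
      count := by
        rw [Finset.filter_true_of_mem fun j hj => hw j (by simp at hj; omega)]
        simp }
  le := Nat.zero_le _
  unused := hw 0 (Nat.zero_le _)
  front := .inl ⟨rfl, hw⟩

/-- The edge from `way j₀` to `j₀` is tight because the recorded slack of `j₀` is zero. Its parent
joined at a time at most `t`, before the new stamp `t + 1`; these stamps exclude cycles when the
path is followed back. -/
theorem GrowState.mark_tree {N i t c p w rm way u v mv j₀}
    (h : GrowState N i t c p w rm way u v mv j₀) (hp : p j₀ ≠ 0) :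
    AltTree N (t + 1) c p (Function.update w j₀ (t + 1)) (Function.update rm (p j₀) 1) way u v where
  matched j hj hw := by
    by_cases hj0 : j = j₀
    · simp [hj0, hp]
    · simp only [Function.update_apply, hj0, if_false] at hw ⊢
      exact ⟨(h.tree.matched j hj hw).1, (h.tree.matched j hj hw).2.trans (Nat.le_succ t)⟩
  parent j hj hjN hw := by
    have hpar : way j ≤ N ∧ w (way j) ≠ 0 ∧ w (way j) < Function.update w j₀ (t + 1) j ∧
        u (p (way j)) + v j = c (p (way j)) j := by
      by_cases hj0 : j = j₀
      · subst hj0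
        obtain ⟨h0, _⟩ | ⟨_, _, hF, hz⟩ := h.front
        · omega
        · obtain ⟨h1, h2, h3, _⟩ := hF j hj hjN h.unused
          have := (h.tree.matched _ h1 h2).2
          exact ⟨h1, h2, by simp; omega, by linarith⟩
      · simp only [Function.update_apply, hj0, if_false] at hw ⊢
        exact h.tree.parent j hj hjN hw
    obtain ⟨h1, h2, h3, h4⟩ := hpar
    have hne : way j ≠ j₀ := fun he => h2 (he ▸ h.unused)
    simp only [Function.update_apply, hne, if_false] at h3 ⊢
    exact ⟨h1, h2, h3, h4⟩
  mark r hr hrN := by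
    by_cases hr' : r = p j₀
    · subst hr'
      simp only [Function.update_self, ne_eq, one_ne_zero, not_false_eq_true, true_iff]
      exact ⟨j₀, h.le, by simp, rfl⟩
    · simp only [Function.update_apply, hr', if_false]
      rw [h.tree.mark r hr hrN]
      constructor
      · rintro ⟨j, hj, hw, rfl⟩
        refine ⟨j, hj, ?_, rfl⟩
        split_ifs
        · omega
        · exact hw
      · rintro ⟨j, hj, hw, rfl⟩
        refine ⟨j, hj, ?_, rfl⟩
        have : j ≠ j₀ := fun he => hr' (he ▸ rfl)
        simpa [this] using hw
  count := by
    have : (Finset.range (N + 1)).filter (fun j => Function.update w j₀ (t + 1) j = 0) =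
        ((Finset.range (N + 1)).filter fun j => w j = 0).erase j₀ := by
      ext j
      by_cases hj0 : j = j₀ <;> simp [hj0, Function.update_apply]
    have hmem : j₀ ∈ (Finset.range (N + 1)).filter fun j => w j = 0 := by
      simp [h.unused, Nat.lt_succ_of_le h.le]
    have := h.tree.count
    have := Finset.card_pos.2 ⟨_, hmem⟩
    rw [‹Finset.filter _ _ = _›, Finset.card_erase_of_mem hmem]
    omega

/-- The effect of comparing all columns outside the tree with the row of the new column `j₀`. -/
structure Relaxed (N : ℕ) (c : ℕ → ℕ → ℝ) (p w way : ℕ → ℕ) (u v mv : ℕ → ℝ) (j₀ : ℕ)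
    (way' : ℕ → ℕ) (mv' : ℕ → ℝ) : Prop where
  inside : ∀ j ≤ N, w j ≠ 0 → way' j = way j
  new : ∀ j, 1 ≤ j → j ≤ N → w j = 0 →
    (j₀ = 0 ∨ c (p j₀) j - u (p j₀) - v j < mv j) →
    way' j = j₀ ∧ mv' j = c (p j₀) j - u (p j₀) - v j
  old : ∀ j, 1 ≤ j → j ≤ N → w j = 0 →
    ¬ (j₀ = 0 ∨ c (p j₀) j - u (p j₀) - v j < mv j) → way' j = way j ∧ mv' j = mv j

theorem AltTree.relax {N t c p w rm way u v mv j₀ way' mv'} (h : AltTree N t c p w rm way u v)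
    (hr : Relaxed N c p w way u v mv j₀ way' mv') : AltTree N t c p w rm way' u v where
  matched := h.matched
  parent j hj hjN hw := by
    rw [hr.inside j hjN hw]
    exact h.parent j hj hjN hw
  mark := h.mark
  count := h.count

/-- The least slack over the enlarged tree is the smaller of the old minimum and the slack against
the row of `j₀`. For `j₀ = 0` the tree was empty and the stored slacks are left over from earlier,
so they have to be overwritten unconditionally. -/
theorem GrowState.frontier {N i t c p w rm way u v mv j₀ way' mv'}
    (h : GrowState N i t c p w rm way u v mv j₀)
    (hr : Relaxed N c p (Function.update w j₀ (t + 1)) way u v mv j₀ way' mv') :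
    Frontier N c p (Function.update w j₀ (t + 1)) way' u v mv' := by
  intro j hj hjN hw
  have hj0 : j ≠ j₀ := by rintro rfl; simp at hw
  have hw0 : w j = 0 := by simpa [hj0] using hw
  by_cases hc : j₀ = 0 ∨ c (p j₀) j - u (p j₀) - v j < mv j
  · obtain ⟨h1, h2⟩ := hr.new j hj hjN hw hc
    rw [h1, h2]
    refine ⟨h.le, by simp, rfl, fun l hl hwl => ?_⟩
    by_cases hl0 : l = j₀
    · rw [hl0]
    · simp only [Function.update_apply, hl0, if_false] at hwl
      obtain ⟨-, hn⟩ | ⟨hn0, -, hF, -⟩ := h.front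
      · exact absurd (hn l hl) hwl
      · have := (hF j hj hjN hw0).2.2.2 l hl hwl
        have := hc.resolve_left hn0
        linarith
  · obtain ⟨h1, h2⟩ := hr.old j hj hjN hw hc
    push Not at hc
    obtain ⟨h0, -⟩ | ⟨-, -, hF, -⟩ := h.front
    · exact absurd h0 hc.1
    · obtain ⟨f1, f2, f3, f4⟩ := hF j hj hjN hw0
      rw [h1, h2]
      refine ⟨f1, ?_, f3, fun l hl hwl => ?_⟩
      · simp only [Function.update_apply]; split_ifs
        · omega
        · exact f2
      · by_cases hl0 : l = j₀
        · rw [hl0]; exact hc.2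
        · simp only [Function.update_apply, hl0, if_false] at hwl
          exact f4 l hl hwl

/-- Pigeonhole: columns of the tree are matched injectively to rows `1, …, i` with `i ≤ N`, whereas
there are `N + 1` columns including the auxiliary one. -/
theorem AltTree.exists_unused {N i t c p w rm way u v} (hi : i ≤ N)
    (hm : DualMatching N i c p u v (N + 1)) (ht : AltTree N t c p w rm way u v) (h0 : w 0 ≠ 0) :
    ∃ j, 1 ≤ j ∧ j ≤ N ∧ w j = 0 := by
  by_contra! hall
  have hw : ∀ j ≤ N, w j ≠ 0 := fun j hj => by
    rcases Nat.eq_zero_or_pos j with rfl | hpos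
    · exact h0
    · exact hall j hpos hj
  obtain ⟨x, hx, y, hy, hne, he⟩ := Finset.exists_ne_map_eq_of_card_lt_of_maps_to
    (s := Finset.range (N + 1)) (t := Finset.Icc 1 i) (f := p) (by simp; omega) (fun j hj => by
      have hj : j ≤ N := by simpa [Nat.lt_succ_iff] using hj
      have := (ht.matched j hj (hw j hj)).1
      have := hm.le j hj (by omega)
      simp only [Finset.coe_Icc, Set.mem_Icc]
      omega)
  have hx : x ≤ N := by simpa [Nat.lt_succ_iff] using hx
  have hy : y ≤ N := by simpa [Nat.lt_succ_iff] using hy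
  exact hne (hm.inj x hx y hy (by omega) (by omega) (ht.matched x hx (hw x hx)).1 he)

/-- The dual step by the least slack `d = mv j₁`, which is nonnegative by feasibility. Rows of the
tree gain `d` and columns of the tree lose `d`, so pairs inside the tree keep their slack. A row
inside and a column outside lose `d`, which minimality allows; a row outside and a column inside
gain slack. Column `j₁` now has slack zero and can join. -/
theorem growState_update {N i t c p w rm way u v mv j₁ u' v' mv'} (hi : i ≤ N)
    (hm : DualMatching N i c p u v (N + 1)) (hp0 : p 0 ≠ 0)
    (ht : AltTree N t c p w rm way u v) (hF : Frontier N c p w way u v mv) (hw0 : w 0 ≠ 0)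
    (hj : 1 ≤ j₁) (hjN : j₁ ≤ N) (hw : w j₁ = 0)
    (hmin : ∀ j, 1 ≤ j → j ≤ N → w j = 0 → mv j₁ ≤ mv j)
    (hu : ∀ r ≤ N, u' r = if rm r ≠ 0 then u r + mv j₁ else u r)
    (hv : ∀ j ≤ N, v' j = if w j ≠ 0 then v j - mv j₁ else v j)
    (hmv : ∀ j ≤ N, w j = 0 → mv' j = mv j - mv j₁) :
    GrowState N i t c p w rm way u' v' mv' j₁ := by
  have hrow : ∀ l ≤ N, w l ≠ 0 → 1 ≤ p l ∧ p l ≤ N := fun l hl hwl =>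
    ⟨Nat.one_le_iff_ne_zero.2 (ht.matched l hl hwl).1, (hm.le l hl (by omega)).trans hi⟩
  have hd : 0 ≤ mv j₁ := by
    obtain ⟨h1, h2, h3, -⟩ := hF j₁ hj hjN hw
    have := hm.feas _ j₁ (hrow _ h1 h2).1 (hrow _ h1 h2).2 hj hjN
    linarith
  have hu_in : ∀ l ≤ N, w l ≠ 0 → u' (p l) = u (p l) + mv j₁ := fun l hl hwl => by
    rw [hu _ (hrow l hl hwl).2, if_pos]
    exact (ht.mark _ (hrow l hl hwl).1 (hrow l hl hwl).2).2 ⟨l, hl, hwl, rfl⟩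
  refine ⟨⟨hm.le, hm.inj, hm.surj, ?_, ?_⟩, hp0, ⟨ht.matched, ?_, ht.mark, ht.count⟩, hjN, hw,
    .inr ⟨by omega, hw0, ?_, by rw [hmv j₁ hjN hw, sub_self]⟩⟩
  · intro r j hr hrN hj' hj'N
    have hf := hm.feas r j hr hrN hj' hj'N
    rw [hu r hrN, hv j hj'N]
    by_cases hwj : w j = 0
    · by_cases hrm : rm r ≠ 0
      · obtain ⟨l, hl, hwl, rfl⟩ := (ht.mark r hr hrN).1 hrm
        have h4 := (hF j hj' hj'N hwj).2.2.2 l hl hwl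
        have h5 := hmin j hj' hj'N hwj
        rw [if_pos hrm, if_neg (by simpa using hwj)]
        linarith
      · simp only [hrm, hwj, ne_eq, not_true_eq_false, if_false]
        exact hf
    · simp only [hwj, ne_eq, not_false_eq_true, if_true]
      split_ifs <;> linarith
  · intro j hj' hj'N hne hpj
    have hf := hm.tight j hj' hj'N hne hpj
    by_cases hwj : w j = 0
    · have hr1 : 1 ≤ p j := Nat.one_le_iff_ne_zero.2 hpj
      have hrN : p j ≤ N := (hm.le j hj'N (by omega)).trans hi
      -- A marked row is the partner of some tree column, and by injectivity it is not matched to a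
      -- column outside. Hence neither end of this matched edge is shifted.
      have hrm : ¬ rm (p j) ≠ 0 := by
        intro hrm
        obtain ⟨l, hl, hwl, he⟩ := (ht.mark _ hr1 hrN).1 hrm
        have := hm.inj l hl j hj'N (by omega) (by omega) (ht.matched l hl hwl).1 he
        exact hwl (this ▸ hwj)
      rw [hu _ hrN, hv j hj'N, if_neg hrm, if_neg (by simpa using hwj)]
      exact hf
    · rw [hu_in j hj'N hwj, hv j hj'N, if_pos hwj]
      linarith
  · intro j hj' hj'N hwj
    obtain ⟨h1, h2, h3, h4⟩ := ht.parent j hj' hj'N hwj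
    refine ⟨h1, h2, h3, ?_⟩
    rw [hu_in _ h1 h2, hv j hj'N, if_pos hwj]
    linarith
  · intro j hj' hj'N hwj
    obtain ⟨h1, h2, h3, h4⟩ := hF j hj' hj'N hwj
    have hvj : v' j = v j := by rw [hv j hj'N, if_neg (by simpa using hwj)]
    refine ⟨h1, h2, ?_, fun l hl hwl => ?_⟩
    · rw [hmv j hj'N hwj, hu_in _ h1 h2, hvj]; linarith
    · rw [hmv j hj'N hwj, hu_in _ hl hwl, hvj]
      have := h4 l hl hwl
      linarith

/-- The state during augmentation: column `j₀` is the hole; the columns that joined the tree before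
`j₀` have not been changed. -/
structure AugState (N i : ℕ) (c : ℕ → ℕ → ℝ) (p p₀ w way : ℕ → ℕ) (u v : ℕ → ℝ) (j₀ : ℕ) : Prop where
  dual : DualMatching N i c p u v j₀
  le : j₀ ≤ N
  used : w j₀ ≠ 0
  same : ∀ j ≤ N, w j ≠ 0 → w j < w j₀ → p j = p₀ j
  parent : ∀ j, 1 ≤ j → j ≤ N → w j ≠ 0 → way j ≤ N ∧ w (way j) ≠ 0 ∧ w (way j) < w j ∧
    u (p₀ (way j)) + v j = c (p₀ (way j)) j

theorem GrowState.augState {N i t c p w rm way u v mv j₀}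
    (h : GrowState N i t c p w rm way u v mv j₀) (hp : p j₀ = 0) :
    AugState N i c p p (Function.update w j₀ (t + 1)) way u v j₀ where
  dual := h.dual.hole hp
  le := h.le
  used := by simp
  same _ _ _ _ := rfl
  parent j hj hjN hw := by
    have hpar : way j ≤ N ∧ w (way j) ≠ 0 ∧ w (way j) < Function.update w j₀ (t + 1) j ∧
        u (p (way j)) + v j = c (p (way j)) j := by
      by_cases hj0 : j = j₀
      · subst hj0
        obtain ⟨h0, _⟩ | ⟨_, _, hF, hz⟩ := h.front
        · omega
        · obtain ⟨h1, h2, h3, _⟩ := hF j hj hjN h.unused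
          have := (h.tree.matched _ h1 h2).2
          exact ⟨h1, h2, by simp; omega, by linarith⟩
      · simp only [Function.update_apply, hj0, if_false] at hw ⊢
        exact h.tree.parent j hj hjN hw
    obtain ⟨h1, h2, h3, h4⟩ := hpar
    have hne : way j ≠ j₀ := fun he => h2 (he ▸ h.unused)
    simp only [Function.update_apply, hne, if_false] at h3 ⊢
    exact ⟨h1, h2, h3, h4⟩

/-- The parent of the hole joined earlier, so its partner is still the one from before the
augmentation, and the edge along which it moves is tight. The time stamp of the hole strictly
decreases, which ends the flipping at column `0`. -/
theorem AugState.move {N i c p p₀ w way u v j₀} (h : AugState N i c p p₀ w way u v j₀)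
    (hj : j₀ ≠ 0) :
    AugState N i c (Function.update p j₀ (p (way j₀))) p₀ w way u v (way j₀) ∧
      w (way j₀) < w j₀ := by
  obtain ⟨h1, h2, h3, h4⟩ := h.parent j₀ (Nat.one_le_iff_ne_zero.2 hj) h.le h.used
  have hs := h.same _ h1 h2 h3
  refine ⟨⟨h.dual.move h.le h1 ?_ (by rw [hs]; exact h4), h1, h2, ?_, h.parent⟩, h3⟩
  · intro he
    rw [he] at h3
    exact lt_irrefl _ h3
  · intro j hjN hw hlt
    have : j ≠ j₀ := by
      rintro rfl
      exact lt_asymm hlt h3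
    simpa [this] using h.same j hjN hw (hlt.trans h3)

/-- A complete dual matching yields an optimal assignment. -/
theorem DualMatching.exists_perm {N c p u v} (h : DualMatching N N c p u v 0) :
    ∃ σ : Equiv.Perm (Fin N), (∀ j : Fin N, p (j + 1) = σ j + 1) ∧
      ∀ j : Fin N, u (σ j + 1) + v (j + 1) = c (σ j + 1) (j + 1) := by
  have hsurj : ∀ r : Fin N, ∃ j : Fin N, p (j + 1) = r + 1 := by
    intro r
    obtain ⟨j, hj, hj0, hp⟩ := h.surj (r + 1) (by omega) (by omega)
    exact ⟨⟨j - 1, by omega⟩, by simp only [Nat.sub_add_cancel (Nat.one_le_iff_ne_zero.2 hj0), hp]⟩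
  choose τ hτ using hsurj
  have hτi : Function.Injective τ := fun r r' he => by
    have := (hτ r).symm.trans (by rw [he, hτ r'])
    exact Fin.ext (by omega)
  let e : Equiv.Perm (Fin N) := Equiv.ofBijective τ (Finite.injective_iff_bijective.1 hτi)
  have hp : ∀ j : Fin N, p (j + 1) = e.symm j + 1 := fun j => by
    have := hτ (e.symm j)
    rwa [show τ (e.symm j) = j from e.apply_symm_apply j] at this
  refine ⟨e.symm, hp, fun j => ?_⟩
  have := h.tight (j + 1) (by omega) (by omega) (by omega) (by rw [hp]; omega)
  rwa [hp] at this

/-! ## The Hungarian method: program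

The size `N` is in natural-number register `10`, the costs are in real array `12`. The dual
variables `u`, `v` and the slacks `mv` are in row `0` of the real arrays `13`, `14`, `15`, and
`w`, `p`, `way`, `rm` are the arrays `10`, `11`, `12`, `13` of natural numbers. The registers
`12`, `13`, `14`, `15`, `16` hold the phase, the current column, the loop counter, the time, and the
next column. -/

def RExp.zero : RExp := .ofNat (.const 0)

def succN : NExp := .add (.reg 10) (.const 1)

def hungInit : Prog :=
  forUp 14 (.const 0) succN
    (.rput 13 (.const 0) (.reg 14) .zero ;; .rput 14 (.const 0) (.reg 14) .zero ;;
      .nput 11 (.reg 14) (.const 0))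

def hungReset : Prog :=
  forUp 14 (.const 0) succN (.nput 10 (.reg 14) (.const 0) ;; .nput 13 (.reg 14) (.const 0))

def hungMark : Prog :=
  .nset 15 (.add (.reg 15) (.const 1)) ;; .nput 10 (.reg 13) (.reg 15) ;;
    .nput 13 (.arr 11 (.reg 13)) (.const 1)

/-- The slack between the row of the current column and column `j`. -/
def slackExp : RExp :=
  .sub (.sub (.arr 12 (.arr 11 (.reg 13)) (.reg 14)) (.arr 13 (.const 0) (.arr 11 (.reg 13))))
    (.arr 14 (.const 0) (.reg 14))

/-- The comparison is bypassed when the current column is the root `0`, because row `0` of real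
array `15` then holds no meaningful slacks. -/
def hungRelax : Prog :=
  forUp 14 (.const 1) succN
    (.ite (.nlt (.const 0) (.arr 10 (.reg 14))) .skip
      (.rset 11 slackExp ;;
        .ite (.and (.nlt (.const 0) (.reg 13)) (.not (.rlt (.reg 11) (.arr 15 (.const 0) (.reg 14)))))
          .skip
          (.rput 15 (.const 0) (.reg 14) (.reg 11) ;; .nput 12 (.reg 14) (.reg 13))))

/-- Real columns are numbered from `1`, so the value `0` in register `16` encodes that no candidate
has been seen. -/
def hungMin : Prog :=
  .nset 16 (.const 0) ;;
  forUp 14 (.const 1) succN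
    (.ite (.nlt (.const 0) (.arr 10 (.reg 14))) .skip
      (.ite (.and (.nlt (.const 0) (.reg 16))
          (.not (.rlt (.arr 15 (.const 0) (.reg 14)) (.arr 15 (.const 0) (.reg 16)))))
        .skip (.nset 16 (.reg 14))))

/-- The minimum is saved in a register first: the pass sets the slack of the minimizing column
itself to zero, and later columns still need the old value. -/
def hungUpdate : Prog :=
  .rset 12 (.arr 15 (.const 0) (.reg 16)) ;;
  forUp 14 (.const 0) succN
    (.ite (.nlt (.const 0) (.arr 10 (.reg 14)))
        (.rput 14 (.const 0) (.reg 14) (.sub (.arr 14 (.const 0) (.reg 14)) (.reg 12)))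
        (.rput 15 (.const 0) (.reg 14) (.sub (.arr 15 (.const 0) (.reg 14)) (.reg 12))) ;;
      .ite (.nlt (.const 0) (.arr 13 (.reg 14)))
        (.rput 13 (.const 0) (.reg 14) (.add (.arr 13 (.const 0) (.reg 14)) (.reg 12))) .skip)

def hungStep : Prog :=
  hungMark ;; hungRelax ;; hungMin ;; hungUpdate ;; .nset 13 (.reg 16)

def hungGrow : Prog := .loop (.nlt (.const 0) (.arr 11 (.reg 13))) hungStep

def hungFlipStep : Prog :=
  .nset 16 (.arr 12 (.reg 13)) ;; .nput 11 (.reg 13) (.arr 11 (.reg 16)) ;; .nset 13 (.reg 16)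

def hungFlip : Prog := .loop (.nlt (.const 0) (.reg 13)) hungFlipStep

def hungAugment : Prog :=
  .nset 15 (.add (.reg 15) (.const 1)) ;; .nput 10 (.reg 13) (.reg 15) ;; hungFlip

def hungPhase : Prog :=
  .nput 11 (.const 0) (.reg 12) ;; .nset 13 (.const 0) ;; .nset 15 (.const 0) ;; hungReset ;;
    hungGrow ;; hungAugment

def hungTotal : Prog :=
  .rset 10 .zero ;;
  forUp 14 (.const 1) succN
    (.rset 10 (.add (.reg 10) (.arr 12 (.arr 11 (.reg 14)) (.reg 14)))) ;;
  .rset 10 (.div (.reg 10) (.ofNat (.reg 10)))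

/-- Computes the least mean cost of an assignment. -/
def hungarian : Prog :=
  hungInit ;; forUp 12 (.const 1) succN hungPhase ;; hungTotal

/-! ### Correctness and running time of the Hungarian program. -/

theorem eval_succN (s : Mem) : succN.eval s = s.nreg 10 + 1 := rfl

theorem RExp.eval_zero (s : Mem) : RExp.zero.eval s = 0 := by simp [RExp.zero, RExp.eval, NExp.eval]

theorem hungInit_term {s : Mem} {N : ℕ} (hN : s.nreg 10 = N) :
    Term hungInit s ((N + 1) * 8 + 3) fun s' => ∀ j ≤ N,
      s'.narr 11 j = 0 ∧ s'.rarr 13 0 j = 0 ∧ s'.rarr 14 0 j = 0 := by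
  refine (Term.forUp (c := 5) (N + 1) (fun i s' => ∀ j < i,
    s'.narr 11 j = 0 ∧ s'.rarr 13 0 j = 0 ∧ s'.rarr 14 0 j = 0) rfl (by simp [NExp.eval]) ?_
    (fun _ _ _ h => h) (by simp [NExp.eval]) ?_).mono (by simp [NExp.eval]) ?_
  · intro s' hf
    rw [eval_succN, hf.nreg 10 rfl, hN]
  · intro i s' _ hi hf hj hI
    refine Term.straight rfl (by decide) ?_
    intro j hj'
    simp only [Prog.effect, RExp.eval_zero, NExp.eval, Mem.putN_narr, Mem.putN_rarr, Mem.putR_rarr,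
      Mem.putR_nreg, Mem.putR_narr, hj]
    by_cases hji : j = i
    · simp [hji]
    · simpa [hji] using hI j (by omega)
  · intro s' _ h j hj
    exact h j (by omega)

theorem hungReset_term {s : Mem} {N : ℕ} (hN : s.nreg 10 = N) :
    Term hungReset s ((N + 1) * 6 + 3) fun s' => ∀ j ≤ N, s'.narr 10 j = 0 ∧ s'.narr 13 j = 0 := by
  refine (Term.forUp (c := 3) (N + 1) (fun i s' => ∀ j < i,
    s'.narr 10 j = 0 ∧ s'.narr 13 j = 0) rfl (by simp [NExp.eval]) ?_
    (fun _ _ _ h => h) (by simp [NExp.eval]) ?_).mono (by simp [NExp.eval]) ?_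
  · intro s' hf
    rw [eval_succN, hf.nreg 10 rfl, hN]
  · intro i s' _ hi hf hj hI
    refine Term.straight rfl (by decide) ?_
    intro j hj'
    simp only [Prog.effect, NExp.eval, Mem.putN_narr, Mem.putN_nreg, hj]
    by_cases hji : j = i
    · simp [hji]
    · simpa [hji] using hI j (by omega)
  · intro s' _ h j hj
    exact h j (by omega)

theorem hungRelax_term {s : Mem} {N : ℕ} (hN : s.nreg 10 = N) :
    Term hungRelax s (N * 10 + 3) fun s' =>
      Relaxed N (s.rarr 12) (s.narr 11) (s.narr 10) (s.narr 12) (s.rarr 13 0) (s.rarr 14 0)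
        (s.rarr 15 0) (s.nreg 13) (s'.narr 12) (s'.rarr 15 0) := by
  -- At counter value `i` the columns `1, …, i - 1` are done. The first clause says that columns not
  -- yet reached still hold the old data, which the comparison at column `i` reads.
  refine (Term.forUp (c := 7) (N + 1) (fun i s' =>
    (∀ j, i ≤ j ∨ s.narr 10 j ≠ 0 → s'.narr 12 j = s.narr 12 j ∧ s'.rarr 15 0 j = s.rarr 15 0 j) ∧
    Relaxed (i - 1) (s.rarr 12) (s.narr 11) (s.narr 10) (s.narr 12) (s.rarr 13 0) (s.rarr 14 0)
        (s.rarr 15 0) (s.nreg 13) (s'.narr 12) (s'.rarr 15 0)) rfl (by simp [NExp.eval]) ?_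
    (fun _ _ _ h => h) ?_ ?_).mono (by simp [NExp.eval]) ?_
  · intro s' hf
    rw [eval_succN, hf.nreg 10 rfl, hN]
  · exact ⟨fun _ _ => ⟨rfl, rfl⟩, fun _ _ _ => rfl, fun j h1 h2 => by simp [NExp.eval] at h2; omega,
      fun j h1 h2 => by simp [NExp.eval] at h2; omega⟩
  · intro i s' hi1 hi hf hj ⟨hI1, hI2⟩
    simp only [NExp.eval] at hi1
    refine Term.straight rfl (by decide) ?_
    have e10 := hf.narr 10 rfl
    have e11 := hf.narr 11 rfl
    have r12 := hf.rarr 12 rfl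
    have r13 := hf.rarr 13 rfl
    have r14 := hf.rarr 14 rfl
    have n13 := hf.nreg 13 rfl
    obtain ⟨o1, o2⟩ := hI1 i (.inl le_rfl)
    by_cases hw : s.narr 10 i = 0
    · have hwi : ∀ j, s.narr 10 j ≠ 0 → j ≠ i := fun j hj he => hj (he ▸ hw)
      by_cases hc : s.nreg 13 = 0 ∨
          s.rarr 12 (s.narr 11 (s.nreg 13)) i - s.rarr 13 0 (s.narr 11 (s.nreg 13)) - s.rarr 14 0 i <
          s.rarr 15 0 i
      · have hc' : ¬ (0 < s.nreg 13 ∧ ¬ s.rarr 12 (s.narr 11 (s.nreg 13)) i -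
            s.rarr 13 0 (s.narr 11 (s.nreg 13)) - s.rarr 14 0 i < s.rarr 15 0 i) := by
          rintro ⟨h1, h2⟩
          exact hc.elim (by omega) h2
        simp only [Prog.effect, slackExp, RExp.eval, NExp.eval, BExp.Holds, Mem.setR_rreg,
          Mem.setR_nreg, Mem.setR_narr, Mem.setR_rarr, Mem.putR_nreg, Mem.putR_narr,
          e10, e11, r12, r13, r14, n13, hj, hw, lt_irrefl, if_false, if_true, o2, if_neg hc',
          Mem.putN_narr, Mem.putN_rarr, Mem.putR_rarr]
        refine ⟨fun j hj' => ?_, fun j hj' hwj => ?_, fun j h1 h2 h3 h4 => ?_, fun j h1 h2 h3 h4 => ?_⟩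
        · have : j ≠ i := hj'.elim (by omega) (hwi j)
          simpa [this] using hI1 j (hj'.imp (by omega) id)
        · simpa [hwi j hwj] using (hI1 j (.inr hwj)).1
        · by_cases hji : j = i
          · simp [hji]
          · simpa [hji] using hI2.new j h1 (by omega) h3 h4
        · by_cases hji : j = i
          · subst hji; exact absurd hc h4
          · simpa [hji] using hI2.old j h1 (by omega) h3 h4
      · have hc' : 0 < s.nreg 13 ∧ ¬ s.rarr 12 (s.narr 11 (s.nreg 13)) i -
            s.rarr 13 0 (s.narr 11 (s.nreg 13)) - s.rarr 14 0 i < s.rarr 15 0 i := by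
          push Not at hc
          exact ⟨by omega, not_lt.2 hc.2⟩
        simp only [Prog.effect, slackExp, RExp.eval, NExp.eval, BExp.Holds, Mem.setR_rreg,
          Mem.setR_nreg, Mem.setR_narr, Mem.setR_rarr,
          e10, e11, r12, r13, r14, n13, hj, hw, lt_irrefl, if_false, if_true, o2, if_pos hc']
        refine ⟨fun j hj' => hI1 j (hj'.imp (by omega) id), fun j hj' hwj => (hI1 j (.inr hwj)).1,
          fun j h1 h2 h3 h4 => ?_, fun j h1 h2 h3 h4 => ?_⟩
        · by_cases hji : j = i
          · subst hji; exact absurd h4 hc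
          · exact hI2.new j h1 (by omega) h3 h4
        · by_cases hji : j = i
          · subst hji; exact ⟨o1, o2⟩
          · exact hI2.old j h1 (by omega) h3 h4
    · have hw' : 0 < s.narr 10 i := Nat.pos_of_ne_zero hw
      simp only [Prog.effect, NExp.eval, BExp.Holds, e10, hj, hw', if_true]
      have hwi : ∀ j, s.narr 10 j = 0 → j ≠ i := fun j hj he => hw (he ▸ hj)
      refine ⟨fun j hj' => hI1 j (hj'.imp (by omega) id), fun j hj' hwj => (hI1 j (.inr hwj)).1,
        fun j h1 h2 h3 => hI2.new j h1 ?_ h3, fun j h1 h2 h3 => hI2.old j h1 ?_ h3⟩ <;>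
      · have := hwi j h3
        omega
  · intro s' _ h
    exact h.2

theorem hungMin_term {s : Mem} {N : ℕ} (hN : s.nreg 10 = N) :
    Term hungMin s (N * 6 + 5) fun s' =>
      (∃ j, 1 ≤ j ∧ j ≤ N ∧ s.narr 10 j = 0) → 1 ≤ s'.nreg 16 ∧ s'.nreg 16 ≤ N ∧
        s.narr 10 (s'.nreg 16) = 0 ∧
        ∀ j, 1 ≤ j → j ≤ N → s.narr 10 j = 0 → s.rarr 15 0 (s'.nreg 16) ≤ s.rarr 15 0 j := by
  refine (Term.seq (T := 1) (Q := fun s' => s'.nreg 16 = 0)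
    (Term.straight rfl (by decide) (by simp [Prog.effect, NExp.eval, Mem.setN_nreg])) ?_).mono
    (T := 1 + (N * 6 + 3) + 1) (by omega) fun _ _ h => h
  intro s1 hf1 h16
  have hN1 : s1.nreg 10 = N := (hf1.nreg 10 rfl).trans hN
  rw [show s.narr 10 = s1.narr 10 from (hf1.narr 10 rfl).symm,
    show s.rarr 15 = s1.rarr 15 from (hf1.rarr 15 rfl).symm]
  refine (Term.forUp (c := 3) (N + 1) (fun i s' =>
    (s'.nreg 16 = 0 ∧ ∀ j, 1 ≤ j → j < i → s1.narr 10 j ≠ 0) ∨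
    (1 ≤ s'.nreg 16 ∧ s'.nreg 16 < i ∧ s1.narr 10 (s'.nreg 16) = 0 ∧
        ∀ j, 1 ≤ j → j < i → s1.narr 10 j = 0 → s1.rarr 15 0 (s'.nreg 16) ≤ s1.rarr 15 0 j))
    rfl (by simp [NExp.eval]) ?_ ?_ ?_ ?_).mono (by simp [NExp.eval]) ?_
  · intro s' hf
    rw [eval_succN, hf.nreg 10 rfl, hN1]
  · intro i s' v h
    simpa [Mem.setN_nreg] using h
  · exact .inl ⟨h16, fun j h1 h2 => by simp [NExp.eval] at h2; omega⟩
  · intro i s' hi1 hi hf hj hI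
    simp only [NExp.eval] at hi1
    refine Term.straight rfl (by decide) ?_
    have e10 := hf.narr 10 rfl
    have r15 := hf.rarr 15 rfl
    by_cases hw : s1.narr 10 i = 0
    · by_cases hc : 0 < s'.nreg 16 ∧ ¬ s1.rarr 15 0 i < s1.rarr 15 0 (s'.nreg 16)
      · simp only [Prog.effect, NExp.eval, RExp.eval, BExp.Holds, e10, r15, hj, hw, lt_irrefl, if_false, if_pos hc]
        obtain h | ⟨h1, h2, h3, h4⟩ := hI
        · omega
        · refine .inr ⟨h1, by omega, h3, fun j hj1 hj2 hj3 => ?_⟩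
          by_cases hji : j = i
          · rw [hji]; exact not_lt.1 hc.2
          · exact h4 j hj1 (by omega) hj3
      · simp only [Prog.effect, NExp.eval, RExp.eval, BExp.Holds, e10, r15, hj, hw, lt_irrefl, if_false, if_neg hc,
          Mem.setN_nreg, if_true]
        refine .inr ⟨hi1, by omega, trivial, fun j hj1 hj2 hj3 => ?_⟩
        by_cases hji : j = i
        · rw [hji]
        · obtain h | ⟨h1, h2, h3, h4⟩ := hI
          · exact absurd hj3 (h.2 j hj1 (by omega))
          · have : s1.rarr 15 0 i < s1.rarr 15 0 (s'.nreg 16) := by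
              by_contra hn; exact hc ⟨by omega, hn⟩
            exact this.le.trans (h4 j hj1 (by omega) hj3)
    · have hw' : 0 < s1.narr 10 i := Nat.pos_of_ne_zero hw
      simp only [Prog.effect, NExp.eval, BExp.Holds, e10, hj, hw', if_true]
      have hwi : ∀ j, s1.narr 10 j = 0 → j ≠ i := fun j hj he => hw (he ▸ hj)
      obtain h | ⟨h1, h2, h3, h4⟩ := hI
      · refine .inl ⟨h.1, fun j hj1 hj2 => ?_⟩
        by_cases hji : j = i
        · rw [hji]; exact hw
        · exact h.2 j hj1 (by omega)
      · refine .inr ⟨h1, by omega, h3, fun j hj1 hj2 hj3 => h4 j hj1 ?_ hj3⟩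
        have := hwi j hj3
        omega
  · rintro s' - h ⟨j, hj1, hj2, hj3⟩
    obtain h | ⟨h1, h2, h3, h4⟩ := h
    · exact absurd hj3 (h.2 j hj1 (by omega))
    · exact ⟨h1, by omega, h3, fun j hj1 hj2 => h4 j hj1 (by omega)⟩

theorem hungUpdate_term {s : Mem} {N : ℕ} (hN : s.nreg 10 = N) :
    Term hungUpdate s ((N + 1) * 8 + 5) fun s' => ∀ j ≤ N,
      (s'.rarr 13 0 j = if s.narr 13 j ≠ 0 then s.rarr 13 0 j + s.rarr 15 0 (s.nreg 16)
        else s.rarr 13 0 j) ∧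
      (s'.rarr 14 0 j = if s.narr 10 j ≠ 0 then s.rarr 14 0 j - s.rarr 15 0 (s.nreg 16)
        else s.rarr 14 0 j) ∧
      (s'.rarr 15 0 j = if s.narr 10 j ≠ 0 then s.rarr 15 0 j
        else s.rarr 15 0 j - s.rarr 15 0 (s.nreg 16)) := by
  refine (Term.seq (T := 1) (Q := fun s' => s'.rreg 12 = s.rarr 15 0 (s.nreg 16))
    (Term.straight rfl (by decide) (by simp [Prog.effect, NExp.eval, RExp.eval, Mem.setR_rreg])) ?_).mono
    (T := 1 + ((N + 1) * 8 + 3) + 1) (by omega) fun _ _ h => h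
  intro s1 hf1 hd
  have hN1 : s1.nreg 10 = N := (hf1.nreg 10 rfl).trans hN
  rw [← hd, show s.narr 10 = s1.narr 10 from (hf1.narr 10 rfl).symm,
    show s.narr 13 = s1.narr 13 from (hf1.narr 13 rfl).symm,
    show s.rarr 13 = s1.rarr 13 from (hf1.rarr 13 rfl).symm,
    show s.rarr 14 = s1.rarr 14 from (hf1.rarr 14 rfl).symm,
    show s.rarr 15 = s1.rarr 15 from (hf1.rarr 15 rfl).symm]
  refine (Term.forUp (c := 5) (N + 1) (fun i s' => ∀ j,
      (s'.rarr 13 0 j = if j < i ∧ s1.narr 13 j ≠ 0 then s1.rarr 13 0 j + s1.rreg 12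
        else s1.rarr 13 0 j) ∧
      (s'.rarr 14 0 j = if j < i ∧ s1.narr 10 j ≠ 0 then s1.rarr 14 0 j - s1.rreg 12
        else s1.rarr 14 0 j) ∧
      (s'.rarr 15 0 j = if j < i ∧ s1.narr 10 j = 0 then s1.rarr 15 0 j - s1.rreg 12
        else s1.rarr 15 0 j)) rfl (by simp [NExp.eval]) ?_
    (fun _ _ _ h => h) (by simp [NExp.eval]) ?_).mono (by simp [NExp.eval]) ?_
  · intro s' hf
    rw [eval_succN, hf.nreg 10 rfl, hN1]
  · intro i s' hi1 hi hf hj hI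
    refine Term.straight rfl (by decide) ?_
    have e10 := hf.narr 10 rfl
    have e13 := hf.narr 13 rfl
    have r12 := hf.rreg 12 rfl
    obtain ⟨i1, i2, i3⟩ := hI i
    simp only [lt_irrefl, false_and, if_false] at i1 i2 i3
    have hlt : ∀ j, j ≠ i → (j < i + 1 ↔ j < i) := fun j hj => by omega
    intro j
    obtain ⟨j1, j2, j3⟩ := hI j
    by_cases hw : s1.narr 10 i = 0 <;> by_cases hr : s1.narr 13 i = 0 <;> by_cases hji : j = i <;>
      simp [Prog.effect, NExp.eval, RExp.eval, BExp.Holds, Mem.putR_narr, Mem.putR_nreg,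
        Mem.putR_rreg, e10, e13, r12, hj, hw, hr, Nat.pos_iff_ne_zero, Mem.putR_rarr, i1, i2, i3,
        hji, hlt, j1, j2, j3]
  · intro s' _ h j hj
    obtain ⟨h1, h2, h3⟩ := h j
    have : j < N + 1 := by omega
    simp only [this, true_and] at h1 h2 h3
    exact ⟨h1, h2, by rw [h3]; by_cases hw : s1.narr 10 j = 0 <;> simp [hw]⟩

theorem hungMark_effect (s : Mem) :
    (hungMark.effect s).nreg 15 = s.nreg 15 + 1 ∧
    (hungMark.effect s).narr 10 = Function.update (s.narr 10) (s.nreg 13) (s.nreg 15 + 1) ∧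
    (hungMark.effect s).narr 13 = Function.update (s.narr 13) (s.narr 11 (s.nreg 13)) 1 := by
  refine ⟨by simp [hungMark, Prog.effect, NExp.eval], ?_, ?_⟩ <;> funext j <;>
    simp [hungMark, Prog.effect, NExp.eval, Function.update_apply]

/-- The invariant of the loop that grows the tree. -/
def MemGrow (N i : ℕ) (s : Mem) : Prop :=
  GrowState N i (s.nreg 15) (s.rarr 12) (s.narr 11) (s.narr 10) (s.narr 13) (s.narr 12)
    (s.rarr 13 0) (s.rarr 14 0) (s.rarr 15 0) (s.nreg 13)

/-- The number of columns outside the tree. -/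
def unusedCard (N : ℕ) (s : Mem) : ℕ :=
  ((Finset.range (N + 1)).filter fun j => s.narr 10 j = 0).card

/-- Links the clock to the number of unused columns; it bounds both the number of growth steps and,
through the time stamps, the length of the augmenting path. -/
theorem MemGrow.count {N i s} (h : MemGrow N i s) : s.nreg 15 + unusedCard N s = N + 1 := h.tree.count

theorem hungStep_term {s : Mem} {N i : ℕ} (hN : s.nreg 10 = N) (hi : i ≤ N)
    (h : MemGrow N i s) (hp : s.narr 11 (s.nreg 13) ≠ 0) :
    Term hungStep s (24 * N + 40) fun s' => MemGrow N i s' ∧ unusedCard N s' < unusedCard N s := by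
  refine (Term.seq (T := 5) (Q := fun s' => s' = hungMark.effect s)
    (Term.straight rfl (by decide) rfl) (Q' := fun s' => MemGrow N i s' ∧ s'.nreg 15 = s.nreg 15 + 1)
    (T' := 24 * N + 34) ?_).mono (by omega) ?_
  swap
  · rintro s' - ⟨h1, h2⟩
    -- The clock advanced by one, so `count` before and after gives one unused column fewer.
    have := h1.count
    have := h.count
    exact ⟨h1, by omega⟩
  rintro s1 f1 rfl
  obtain ⟨t1, w1, m1⟩ := hungMark_effect s
  set s1 := hungMark.effect s
  have hN1 : s1.nreg 10 = N := (f1.nreg 10 rfl).trans hN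
  have j1 : s1.nreg 13 = s.nreg 13 := f1.nreg 13 rfl
  have hT1 := h.mark_tree hp
  refine (Term.seq (hungRelax_term hN1) (T' := (N * 6 + 5) + ((N + 1) * 8 + 5 + 1 + 1) + 1) ?_).le
    (by omega)
  intro s2 f2 hr
  have hN2 : s2.nreg 10 = N := (f2.nreg 10 rfl).trans hN1
  rw [f1.rarr 12 rfl, f1.narr 11 rfl, w1, f1.narr 12 rfl, f1.rarr 13 rfl, f1.rarr 14 rfl,
    f1.rarr 15 rfl, j1] at hr
  have hF := h.frontier hr
  have hT2 := hT1.relax hr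
  have hw0 : Function.update (s.narr 10) (s.nreg 13) (s.nreg 15 + 1) 0 ≠ 0 := by
    simp only [Function.update_apply]
    split_ifs with h0
    · omega
    · exact (h.front.resolve_left fun hh => h0 hh.1.symm).2.1
  have hex := AltTree.exists_unused hi h.dual hT2 hw0
  refine Term.seq (hungMin_term hN2) ?_
  intro s3 f3 hmin
  have hN3 : s3.nreg 10 = N := (f3.nreg 10 rfl).trans hN2
  have e2w : s2.narr 10 = Function.update (s.narr 10) (s.nreg 13) (s.nreg 15 + 1) :=
    (f2.narr 10 rfl).trans w1
  rw [e2w] at hmin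
  obtain ⟨m1', m2, m3, m4⟩ := hmin hex
  refine Term.seq (T := (N + 1) * 8 + 5) (T' := 1) (hungUpdate_term hN3) ?_
  intro s4 f4 hu
  refine Term.straight rfl (by decide) ?_
  simp only [Prog.effect, NExp.eval, MemGrow, Mem.setN_nreg, Mem.setN_narr, Mem.setN_rarr]
  have e4w : s4.narr 10 = Function.update (s.narr 10) (s.nreg 13) (s.nreg 15 + 1) :=
    (f4.narr 10 rfl).trans ((f3.narr 10 rfl).trans e2w)
  have e3w : s3.narr 10 = Function.update (s.narr 10) (s.nreg 13) (s.nreg 15 + 1) :=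
    (f3.narr 10 rfl).trans e2w
  have e3m : s3.narr 13 = Function.update (s.narr 13) (s.narr 11 (s.nreg 13)) 1 :=
    (f3.narr 13 rfl).trans ((f2.narr 13 rfl).trans m1)
  have e4m : s4.narr 13 = Function.update (s.narr 13) (s.narr 11 (s.nreg 13)) 1 :=
    (f4.narr 13 rfl).trans e3m
  have e4p : s4.narr 11 = s.narr 11 :=
    (f4.narr 11 rfl).trans ((f3.narr 11 rfl).trans ((f2.narr 11 rfl).trans (f1.narr 11 rfl)))
  have e4way : s4.narr 12 = s2.narr 12 := (f4.narr 12 rfl).trans (f3.narr 12 rfl)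
  have e4c : s4.rarr 12 = s.rarr 12 :=
    (f4.rarr 12 rfl).trans ((f3.rarr 12 rfl).trans ((f2.rarr 12 rfl).trans (f1.rarr 12 rfl)))
  have e3u : s3.rarr 13 = s.rarr 13 :=
    (f3.rarr 13 rfl).trans ((f2.rarr 13 rfl).trans (f1.rarr 13 rfl))
  have e3v : s3.rarr 14 = s.rarr 14 :=
    (f3.rarr 14 rfl).trans ((f2.rarr 14 rfl).trans (f1.rarr 14 rfl))
  have e3mv : s3.rarr 15 = s2.rarr 15 := f3.rarr 15 rfl
  have e4t : s4.nreg 15 = s.nreg 15 + 1 :=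
    (f4.nreg 15 rfl).trans ((f3.nreg 15 rfl).trans ((f2.nreg 15 rfl).trans t1))
  have e4j : s4.nreg 16 = s3.nreg 16 := f4.nreg 16 rfl
  rw [e3w, e3m, e3u, e3v, e3mv] at hu
  rw [e4w, e4m, e4p, e4way, e4c, e4t, e4j]
  refine ⟨?_, rfl⟩
  refine growState_update hi h.dual h.root hT2 hF hw0 m1' m2 m3 m4 (fun r hr' => (hu r hr').1)
    (fun j hj => (hu j hj).2.1) (fun j hj hwj => ?_)
  rw [(hu j hj).2.2, if_neg (by simpa using hwj), if_pos trivial]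

theorem hungGrow_term {s : Mem} {N i : ℕ} (hN : s.nreg 10 = N) (hi : i ≤ N) (h : MemGrow N i s) :
    Term hungGrow s ((N + 1) * (24 * N + 41) + 1) fun s' =>
      MemGrow N i s' ∧ s'.narr 11 (s'.nreg 13) = 0 := by
  refine (Term.loop (c := 24 * N + 40) (MemGrow N i) (unusedCard N) ?_ h).mono ?_ ?_
  · intro s' hf hs' hb
    simp only [BExp.Holds, NExp.eval] at hb
    exact hungStep_term ((hf.nreg 10 rfl).trans hN) hi hs' (by omega)
  · have := h.count
    gcongr
    omega
  · rintro s' - ⟨h1, h2⟩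
    simp only [BExp.Holds, NExp.eval] at h2
    exact ⟨h1, by omega⟩

theorem hungFlipStep_effect (s : Mem) :
    (hungFlipStep.effect s).rarr = s.rarr ∧ (hungFlipStep.effect s).narr 10 = s.narr 10 ∧
    (hungFlipStep.effect s).narr 12 = s.narr 12 ∧
    (hungFlipStep.effect s).nreg 13 = s.narr 12 (s.nreg 13) ∧
    (hungFlipStep.effect s).narr 11 =
      Function.update (s.narr 11) (s.nreg 13) (s.narr 11 (s.narr 12 (s.nreg 13))) := by
  refine ⟨rfl, ?_, ?_, ?_, ?_⟩
  · funext j; simp [hungFlipStep, Prog.effect]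
  · funext j; simp [hungFlipStep, Prog.effect]
  · simp [hungFlipStep, Prog.effect, NExp.eval]
  · funext j; simp [hungFlipStep, Prog.effect, NExp.eval, Function.update_apply]

theorem hungAugment_term {s : Mem} {N i : ℕ} (h : MemGrow N i s)
    (hp : s.narr 11 (s.nreg 13) = 0) :
    Term hungAugment s ((N + 2) * 6 + 5) fun s' =>
      DualMatching N i (s'.rarr 12) (s'.narr 11) (s'.rarr 13 0) (s'.rarr 14 0) 0 := by
  have h0 := h.augState hp
  have hcount := h.count
  refine (Term.seq (T := 1) (T' := 1 + ((N + 2) * 6 + 1) + 1) (Q := fun s' => s' = s.setN 15 (s.nreg 15 + 1))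
    (Term.straight rfl (by decide) rfl) ?_).le (by omega)
  rintro _ - rfl
  refine (Term.seq (T := 1) (Q := fun s' =>
      s'.narr 10 = Function.update (s.narr 10) (s.nreg 13) (s.nreg 15 + 1) ∧
      s'.nreg 13 = s.nreg 13 ∧ s'.narr 11 = s.narr 11 ∧ s'.narr 12 = s.narr 12 ∧
      s'.rarr = s.rarr)
    (Term.straight rfl (by decide) ?_) ?_)
  · refine ⟨?_, by simp [Prog.effect], ?_, ?_, rfl⟩ <;> funext j <;>
      simp [Prog.effect, NExp.eval, Function.update_apply]
  rintro s1 - ⟨w1, j1, p1, y1, r1⟩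
  -- The measure is the time stamp of the hole; it starts at the clock plus one, hence at most `N +
  -- 2`.
  refine (Term.loop (c := 5)
    (fun s' => AugState N i (s'.rarr 12) (s'.narr 11) (s.narr 11) (s'.narr 10) (s'.narr 12)
      (s'.rarr 13 0) (s'.rarr 14 0) (s'.nreg 13)) (fun s' => s'.narr 10 (s'.nreg 13)) ?_ ?_).mono ?_ ?_
  · intro s' hf hs' hb
    simp only [BExp.Holds, NExp.eval] at hb
    obtain ⟨h1, h2⟩ := hs'.move (by omega)
    obtain ⟨e1, e2, e3, e4, e5⟩ := hungFlipStep_effect s'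
    refine Term.straight rfl (by decide) ⟨?_, ?_⟩
    · rw [e1, e2, e3, e4, e5]; exact h1
    · rw [e2, e4]; exact h2
  · rw [w1, j1, p1, y1, r1]
    exact h0
  · rw [w1, j1, Function.update_self]
    exact Nat.add_le_add_right (Nat.mul_le_mul_right 6 (by omega)) 1
  · rintro s' - ⟨h1, h2⟩
    simp only [BExp.Holds, NExp.eval] at h2
    have := h1.dual
    rwa [show s'.nreg 13 = 0 by omega] at this

theorem hungPhase_term {s : Mem} {N i : ℕ} (hN : s.nreg 10 = N) (hi : i + 1 ≤ N)
    (hreg : s.nreg 12 = i + 1)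
    (h : DualMatching N i (s.rarr 12) (s.narr 11) (s.rarr 13 0) (s.rarr 14 0) 0) :
    Term hungPhase s (24 * N * N + 77 * N + 80) fun s' =>
      DualMatching N (i + 1) (s'.rarr 12) (s'.narr 11) (s'.rarr 13 0) (s'.rarr 14 0) 0 := by
  refine (Term.seq (T := 1) (T' := 1 + (1 + ((N + 1) * 6 + 3 + ((N + 1) * (24 * N + 41) + 1 +
    ((N + 2) * 6 + 5) + 1) + 1) + 1) + 1)
    (Q := fun s' => s'.narr 11 = Function.update (s.narr 11) 0 (i + 1))
    (Term.straight rfl (by decide) ?_) ?_).le (by ring_nf; omega)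
  · funext j
    simp [Prog.effect, NExp.eval, Function.update_apply, hreg]
  intro s1 f1 p1
  refine Term.seq (Q := fun s' => s'.nreg 13 = 0) (Term.straight rfl (by decide)
    (by simp [Prog.effect, NExp.eval])) ?_
  intro s2 f2 j2
  refine Term.seq (Q := fun s' => s'.nreg 15 = 0) (Term.straight rfl (by decide)
    (by simp [Prog.effect, NExp.eval])) ?_
  intro s3 f3 t3
  have hN3 : s3.nreg 10 = N :=
    (f3.nreg 10 rfl).trans ((f2.nreg 10 rfl).trans ((f1.nreg 10 rfl).trans hN))
  refine Term.seq (hungReset_term hN3) ?_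
  intro s4 f4 hz
  have hp4 : s4.narr 11 = Function.update (s.narr 11) 0 (i + 1) :=
    (f4.narr 11 rfl).trans ((f3.narr 11 rfl).trans ((f2.narr 11 rfl).trans p1))
  have r4 : ∀ a, a = 12 ∨ a = 13 ∨ a = 14 → s4.rarr a = s.rarr a := fun a ha =>
    (f4.rarr a rfl).trans ((f3.rarr a rfl).trans ((f2.rarr a rfl).trans (f1.rarr a rfl)))
  have hG : MemGrow N (i + 1) s4 := by
    rw [MemGrow, (f4.nreg 15 rfl).trans t3, (f4.nreg 13 rfl).trans ((f3.nreg 13 rfl).trans j2), hp4,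
      r4 12 (by simp), r4 13 (by simp), r4 14 (by simp)]
    exact growState_start h.start (by simp) (fun j hj => (hz j hj).1) (fun j hj => (hz j hj).2)
  have hN4 : s4.nreg 10 = N := (f4.nreg 10 rfl).trans hN3
  exact Term.seq (hungGrow_term hN4 hi hG) fun s5 _ h5 => hungAugment_term h5.1 h5.2

/-- Correctness of the Hungarian method, for nonnegative costs. -/
theorem hungarian_term {s : Mem} {N : ℕ} (hN : s.nreg 10 = N)
    (hc : ∀ i j : Fin N, 0 ≤ s.rarr 12 (i + 1) (j + 1)) :
    Term hungarian s (500 * (N + 1) ^ 3) fun s' => ∃ (σ : Equiv.Perm (Fin N)) (u v : Fin N → ℝ),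
      (∀ i j : Fin N, u i + v j ≤ s.rarr 12 (i + 1) (j + 1)) ∧
      (∀ j, u (σ j) + v j = s.rarr 12 (σ j + 1) (j + 1)) ∧
      s'.rreg 10 = (∑ j, s.rarr 12 (σ j + 1) (j + 1)) / N := by
  refine (Term.seq (hungInit_term hN) (T' := (N * (24 * N * N + 77 * N + 83) + 3) +
    (1 + ((N * 4 + 3) + 1 + 1) + 1) + 1) ?_).le (by ring_nf; omega)
  intro s1 f1 h1
  have hN1 : s1.nreg 10 = N := (f1.nreg 10 rfl).trans hN
  refine Term.seq ((Term.forUp (c := 24 * N * N + 77 * N + 80) (N + 1) (fun i s' =>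
      DualMatching N (i - 1) (s'.rarr 12) (s'.narr 11) (s'.rarr 13 0) (s'.rarr 14 0) 0) rfl
      (by simp [NExp.eval]) ?_ (fun _ _ _ h => h) ?_ ?_).le (by simp [NExp.eval])) ?_
  · intro s' hf
    rw [eval_succN, hf.nreg 10 rfl, hN1]
  · simp only [NExp.eval]
    constructor
    · intro j hj _
      exact (h1 j hj).1.le
    · intro j hj _ _ _ _ hp
      exact absurd (h1 j hj).1 hp
    · intro r h h'; omega
    -- Zero dual variables are feasible because the costs are nonnegative.
    · intro r j hr1 hr hj1 hj
      rw [(h1 r hr).2.1, (h1 j hj).2.2, add_zero, f1.rarr 12 rfl]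
      simpa [Nat.sub_add_cancel hr1, Nat.sub_add_cancel hj1] using
        hc ⟨r - 1, by omega⟩ ⟨j - 1, by omega⟩
    · intro j _ hj _ hp
      exact absurd (h1 j hj).1 hp
  · intro i s' hi1 hi hf hreg hI
    simp only [NExp.eval] at hi1
    have := hungPhase_term (i := i - 1) ((hf.nreg 10 rfl).trans hN1) (by omega) (by omega) hI
    rwa [show i - 1 + 1 = i + 1 - 1 by omega] at this
  intro s2 f2 h2
  rw [Nat.add_sub_cancel] at h2
  obtain ⟨σ, hσ, ht⟩ := h2.exists_perm
  have e12 : s2.rarr 12 = s.rarr 12 := (f2.rarr 12 rfl).trans (f1.rarr 12 rfl)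
  have hfeas := h2.feas
  have hN2 : s2.nreg 10 = N := (f2.nreg 10 rfl).trans hN1
  refine Term.seq (Q := fun s' => s'.rreg 10 = 0) (Term.straight rfl (by decide)
    (by simp [Prog.effect, RExp.eval_zero])) ?_
  intro s3 f3 h3
  have hN3 : s3.nreg 10 = N := (f3.nreg 10 rfl).trans hN2
  refine Term.seq (T := N * 4 + 3) (T' := 1) ((Term.forUp (c := 1) (N + 1) (fun i s' =>
      s'.rreg 10 = ∑ j ∈ Finset.range (i - 1), s2.rarr 12 (s2.narr 11 (j + 1)) (j + 1)) rfl
      (by simp [NExp.eval]) ?_ (fun _ _ _ h => h) ?_ ?_).le (by simp [NExp.eval])) ?_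
  · intro s' hf
    rw [eval_succN, hf.nreg 10 rfl, hN3]
  · simp [NExp.eval, h3]
  · intro i s' hi1 hi hf hreg hI
    simp only [NExp.eval] at hi1
    refine Term.straight rfl (by decide) ?_
    obtain ⟨i, rfl⟩ : ∃ k, i = k + 1 := ⟨i - 1, by omega⟩
    rw [Nat.add_sub_cancel] at hI
    rw [Nat.add_sub_cancel, Finset.sum_range_succ, ← hI]
    simp [Prog.effect, RExp.eval, NExp.eval, hreg, hf.narr 11 rfl, hf.rarr 12 rfl, f3.narr 11 rfl,
      f3.rarr 12 rfl]
  intro s4 f4 h4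
  refine Term.straight rfl (by decide) ⟨σ, fun i => s2.rarr 13 0 (i + 1),
    fun j => s2.rarr 14 0 (j + 1), fun i j => ?_, fun j => ?_, ?_⟩
  · rw [← e12]
    exact hfeas _ _ (by omega) (by omega) (by omega) (by omega)
  · rw [← e12]; exact ht j
  · rw [Nat.add_sub_cancel, Finset.sum_range] at h4
    simp only [Prog.effect, RExp.eval, NExp.eval, Mem.setR_rreg, if_true, h4,
      (f4.nreg 10 rfl).trans hN3, hσ, e12]

/-! ## Duality for the earth mover's distance -/

/-- Expanding in the standard basis bounds `p` by a multiple of the sup norm. `lipClass` demands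
continuity, and the optimal potential below is built from `p`. -/
theorem Seminorm.continuous_pi {m : ℕ} (p : Seminorm ℝ (Fin m → ℝ)) : Continuous p := by
  have hb : ∀ z, p z ≤ (∑ i, p (Pi.single i 1)) * ‖z‖ := by
    intro z
    have hz : z = ∑ i, z i • (Pi.single i (1 : ℝ) : Fin m → ℝ) := by
      funext j
      simp [Finset.sum_apply, Pi.single_apply]
    calc p z = p (∑ i, z i • (Pi.single i (1 : ℝ) : Fin m → ℝ)) := by rw [← hz]
      _ ≤ ∑ i, p (z i • (Pi.single i (1 : ℝ) : Fin m → ℝ)) :=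
        Finset.le_sum_of_subadditive p (map_zero p).le (map_add_le_add p) _ _
      _ ≤ ∑ i, p (Pi.single i 1) * ‖z‖ := by
        refine Finset.sum_le_sum fun i _ => ?_
        rw [map_smul_eq_mul, mul_comm]
        exact mul_le_mul_of_nonneg_left (norm_le_pi_norm z i) (apply_nonneg p _)
      _ = _ := by rw [Finset.sum_mul]
  have hC : 0 ≤ ∑ i, p (Pi.single i 1) := Finset.sum_nonneg fun i _ => apply_nonneg p _
  refine (LipschitzWith.of_dist_le_mul (K := ⟨_, hC⟩) fun x y => ?_).continuous
  rw [Real.dist_eq, dist_eq_norm]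
  exact (abs_sub_map_le_sub p x y).trans (hb _)

theorem integral_empirical {m N : ℕ} (x : Fin N → Fin m → ℝ) (f : (Fin m → ℝ) → ℝ) :
    ∫ z, f z ∂(empirical x) = (∑ i, f (x i)) / N := by
  rw [empirical, integral_smul_measure, integral_finsetSum_measure]
  · simp [div_eq_inv_mul]
  · intro i _
    exact integrable_dirac (by simp)

theorem emd_nonneg {m M N : ℕ} (p : Seminorm ℝ (Fin m → ℝ))
    (x : Fin M → Fin m → ℝ) (y : Fin N → Fin m → ℝ) : 0 ≤ emd p x y :=
  Real.sSup_nonneg (by rintro _ ⟨f, -, rfl⟩; exact abs_nonneg _)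

/-- The distance sees a sample only through its means, and listing every point twice leaves these
unchanged. This reduces sizes `2 N` and `N` to equal sizes. -/
theorem emd_append_self {m M N : ℕ} (p : Seminorm ℝ (Fin m → ℝ))
    (x : Fin M → Fin m → ℝ) (y : Fin N → Fin m → ℝ) : emd p x (Fin.append y y) = emd p x y := by
  have : ∀ f : (Fin m → ℝ) → ℝ,
      ∫ z, f z ∂(empirical (Fin.append y y)) = ∫ z, f z ∂(empirical y) := by
    intro f
    rw [integral_empirical, integral_empirical, Fin.sum_univ_add]
    simp only [Fin.append_left, Fin.append_right]
    push_cast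
    rw [← two_mul, ← two_mul, mul_div_mul_left _ _ two_ne_zero]
  simp only [emd, ipm, this]

/-- An assignment and dual variables that certify its optimality determine the earth mover's
distance. -/
theorem emd_eq_of_dual {m N : ℕ} (hN : 1 ≤ N) (p : Seminorm ℝ (Fin m → ℝ))
    (x y : Fin N → Fin m → ℝ) (σ : Equiv.Perm (Fin N)) (u v : Fin N → ℝ)
    (hfeas : ∀ i j, u i + v j ≤ p (x i - y j))
    (htight : ∀ j, u (σ j) + v j = p (x (σ j) - y j)) :
    emd p x y = (∑ j, p (x (σ j) - y j)) / N := by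
  have hN0 : (0 : ℝ) < N := by exact_mod_cast hN
  have : Nonempty (Fin N) := ⟨⟨0, hN⟩⟩
  have hval : ∀ f : (Fin m → ℝ) → ℝ, (∫ z, f z ∂(empirical x)) - ∫ z, f z ∂(empirical y) =
      (∑ j, (f (x (σ j)) - f (y j))) / N := by
    intro f
    rw [integral_empirical, integral_empirical, ← Equiv.sum_comp σ (fun i => f (x i)), ← sub_div,
      Finset.sum_sub_distrib]
  -- Weak duality: pair the points by `σ` and apply the Lipschitz bound to each pair.
  have hle : ∀ f ∈ lipClass p, |(∫ z, f z ∂(empirical x)) - ∫ z, f z ∂(empirical y)| ≤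
      (∑ j, p (x (σ j) - y j)) / N := by
    intro f hf
    rw [hval, abs_div, abs_of_pos hN0]
    gcongr
    exact (Finset.abs_sum_le_sum_abs _ _).trans (Finset.sum_le_sum fun j _ => hf.2 _ _)
  -- The potential that attains the bound: a minimum of translates of `p`, hence Lipschitz.
  -- Feasibility gives `f (x i) ≥ u i`, and the term `j` at `y j` gives `f (y j) ≤ -v j`.
  let f : (Fin m → ℝ) → ℝ := fun z => Finset.univ.inf' Finset.univ_nonempty fun j => p (z - y j) - v j
  have hfle : ∀ z j, f z ≤ p (z - y j) - v j := fun z j => Finset.inf'_le _ (Finset.mem_univ j)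
  have hf : f ∈ lipClass p := by
    constructor
    · refine Continuous.finset_inf'_apply _ fun j _ => ?_
      exact (p.continuous_pi.comp (continuous_id.sub continuous_const)).sub continuous_const
    · have h1 : ∀ a b, f a - f b ≤ p (a - b) := by
        intro a b
        obtain ⟨j, -, hj⟩ := Finset.exists_mem_eq_inf' Finset.univ_nonempty fun j => p (b - y j) - v j
        have h2 := hfle a j
        have h3 : f b = p (b - y j) - v j := hj
        have h4 := map_add_le_add p (a - b) (b - y j)
        rw [sub_add_sub_cancel] at h4
        linarith
      intro a b
      rw [abs_sub_le_iff]
      exact ⟨h1 a b, by rw [map_sub_rev]; exact h1 b a⟩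
  refine le_antisymm (csSup_le ⟨_, Set.mem_image_of_mem _ hf⟩ ?_)
    (le_csSup_of_le ⟨(∑ j, p (x (σ j) - y j)) / N, ?_⟩ (Set.mem_image_of_mem _ hf) ?_)
  · rintro _ ⟨g, hg, rfl⟩
    exact hle g hg
  · rintro _ ⟨g, hg, rfl⟩
    exact hle g hg
  · refine le_trans ?_ (le_abs_self _)
    rw [hval]
    gcongr with j
    have h1 : u (σ j) ≤ f (x (σ j)) := by
      refine Finset.le_inf' _ _ fun k _ => ?_
      have := hfeas (σ j) k
      linarith
    have h2 := hfle (y j) j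
    rw [sub_self, map_zero] at h2
    rw [← htight j]
    linarith

/-! ## The distance program

The sample size is in natural-number register `10`, the dimension in register `11`, and the samples
are in the real arrays `10` and `11`; the distance is left in real register `10`. The evaluation of
the norm uses the names from `40` on. -/

/-- `P` evaluates the norms `ν m` in time `C (m + 1)`, with input and output shifted by `40`. -/
structure NormProg (ν : ∀ m : ℕ, Seminorm ℝ (Fin m → ℝ)) (P : Prog) (C : ℕ) : Prop where
  det : P.Deterministic
  writes : ∀ x < 40, P.writesN x = false ∧ P.writesR x = false ∧
    P.writesNA x = false ∧ P.writesRA x = false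
  term : ∀ (m : ℕ) (x : Fin m → ℝ) (s : Mem), s.nreg 40 = m → (∀ j : Fin m, s.rarr 40 0 j = x j) →
    Term P s (C * (m + 1)) fun s' => s'.rreg 40 = ν m x

/-- The evaluator is correct whatever the other memory cells contain, so after renaming it can be
called again and again without clearing its workspace. -/
theorem EvaluableInLinearTime.exists_normProg {ν : ∀ m : ℕ, Seminorm ℝ (Fin m → ℝ)}
    (h : EvaluableInLinearTime ν) : ∃ P C, NormProg ν P C := by
  obtain ⟨P, hP, C, h⟩ := h
  refine ⟨P.shift 40, C, hP.shift 40, fun x hx => P.shift_writes hx, fun m x s hm hx => ?_⟩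
  obtain ⟨s', k, hk, he, ho⟩ := exec_of_haltsWithin hP (h m x (s.unshift 40) hm hx)
  obtain ⟨S', hS, rfl⟩ := he.shift 40 s rfl
  exact ⟨S', k, hk, hS, ho⟩

def distDiff : Prog :=
  forUp 14 (.const 0) (.reg 11) (.rput 40 (.const 0) (.reg 14)
    (.sub (.arr 10 (.reg 12) (.reg 14)) (.arr 11 (.reg 13) (.reg 14))))

def distEntry (P : Prog) : Prog :=
  distDiff ;; .nset 40 (.reg 11) ;; P ;;
    .rput 12 (.add (.reg 12) (.const 1)) (.add (.reg 13) (.const 1)) (.reg 40)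

def distRow (P : Prog) : Prog := forUp 13 (.const 0) (.reg 10) (distEntry P)

def distMatrix (P : Prog) : Prog := forUp 12 (.const 0) (.reg 10) (distRow P)

def emdProg (P : Prog) : Prog := distMatrix P ;; hungarian

theorem distDiff_term {s : Mem} {m : ℕ} (hm : s.nreg 11 = m) :
    Term distDiff s (m * 4 + 3) fun s' => ∀ l < m,
      s'.rarr 40 0 l = s.rarr 10 (s.nreg 12) l - s.rarr 11 (s.nreg 13) l := by
  refine (Term.forUp (c := 1) m (fun i s' => ∀ l < i,
    s'.rarr 40 0 l = s.rarr 10 (s.nreg 12) l - s.rarr 11 (s.nreg 13) l) rfl (by simp [NExp.eval]) ?_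
    (fun _ _ _ h => h) (by simp [NExp.eval]) ?_).le (by simp [NExp.eval])
  · intro s' hf
    simp only [NExp.eval]
    rw [hf.nreg 11 rfl, hm]
  · intro i s' _ hi hf hj hI
    refine Term.straight rfl (by decide) ?_
    intro l hl
    by_cases hli : l = i
    · simp [Prog.effect, NExp.eval, RExp.eval, hj, hli, hf.rarr 10 rfl, hf.rarr 11 rfl,
        hf.nreg 12 rfl, hf.nreg 13 rfl]
    · simpa [Prog.effect, NExp.eval, hj, hli] using hI l (by omega)

section
variable {ν : ∀ m : ℕ, Seminorm ℝ (Fin m → ℝ)} {P : Prog} {C : ℕ}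

/-- The text of `P` is unknown, so frame conditions cannot be decided by computation here; for names
below `40` they follow from the renaming. -/
theorem distEntry_writes (hP : NormProg ν P C) {x : ℕ} (hx : x < 40) :
    ((distEntry P).writesN x = false ↔ x ≠ 14) ∧ (distEntry P).writesR x = false ∧
      (distEntry P).writesNA x = false ∧ ((distEntry P).writesRA x = false ↔ x ≠ 12) := by
  obtain ⟨h1, h2, h3, h4⟩ := hP.writes x hx
  have : x ≠ 40 := by omega
  simp [distEntry, distDiff, forUp, Prog.writesN, Prog.writesR, Prog.writesNA, Prog.writesRA,
    h1, h2, h3, h4, this]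

theorem distMatrix_writes (hP : NormProg ν P C) {x : ℕ} (hx : x < 40) :
    ((distMatrix P).writesN x = false ↔ x ≠ 12 ∧ x ≠ 13 ∧ x ≠ 14) ∧
      (distMatrix P).writesR x = false ∧
      (distMatrix P).writesNA x = false ∧ ((distMatrix P).writesRA x = false ↔ x ≠ 12) := by
  obtain ⟨h1, h2, h3, h4⟩ := distEntry_writes hP hx
  simp [distMatrix, distRow, forUp, Prog.writesN, Prog.writesR, Prog.writesNA, Prog.writesRA,
    h1, h2, h3, h4]
  tauto

theorem emdProg_writes (hP : NormProg ν P C) {x : ℕ} (hx : x < 10) :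
    (emdProg P).writesN x = false ∧ (emdProg P).writesR x = false ∧
      (emdProg P).writesNA x = false ∧ (emdProg P).writesRA x = false := by
  obtain ⟨h1, h2, h3, h4⟩ := distMatrix_writes hP (x := x) (by omega)
  have h1 := h1.2 (by omega)
  have h4 := h4.2 (by omega)
  have : hungarian.writesN x = false ∧ hungarian.writesR x = false ∧
      hungarian.writesNA x = false ∧ hungarian.writesRA x = false := by
    interval_cases x <;> decide
  simp [emdProg, Prog.writesN, Prog.writesR, Prog.writesNA, Prog.writesRA, h1, h2, h3, h4, this]

theorem distEntry_term (hP : NormProg ν P C) {s : Mem} {m : ℕ} (hm : s.nreg 11 = m) :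
    Term (distEntry P) s ((C + 11) * (m + 1)) fun s' => ∀ r j,
      s'.rarr 12 r j = if r = s.nreg 12 + 1 ∧ j = s.nreg 13 + 1 then
        ν m fun l => s.rarr 10 (s.nreg 12) l - s.rarr 11 (s.nreg 13) l else s.rarr 12 r j := by
  refine (Term.seq (T := m * 4 + 3) (T' := 1 + (C * (m + 1) + 1 + 1) + 1) (distDiff_term hm) ?_).le
    (by ring_nf; omega)
  intro s1 f1 h1
  refine Term.seq (Q := fun s' => s'.nreg 40 = m ∧ s'.rarr = s1.rarr) (Term.straight rfl (by decide)
    ⟨by simp [Prog.effect, NExp.eval, f1.nreg 11 rfl, hm], rfl⟩) ?_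
  intro s2 f2 h2
  refine Term.seq (hP.term m (fun l => s.rarr 10 (s.nreg 12) l - s.rarr 11 (s.nreg 13) l) s2 h2.1
    (fun l => by rw [h2.2]; exact h1 l l.2)) ?_
  intro s3 f3 h3
  refine Term.straight rfl (by decide) ?_
  have e1 : s3.nreg 12 = s.nreg 12 :=
    (f3.nreg 12 (hP.writes 12 (by omega)).1).trans ((f2.nreg 12 rfl).trans (f1.nreg 12 rfl))
  have e2 : s3.nreg 13 = s.nreg 13 :=
    (f3.nreg 13 (hP.writes 13 (by omega)).1).trans ((f2.nreg 13 rfl).trans (f1.nreg 13 rfl))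
  have e3 : s3.rarr 12 = s.rarr 12 :=
    (f3.rarr 12 (hP.writes 12 (by omega)).2.2.2).trans ((f2.rarr 12 rfl).trans (f1.rarr 12 rfl))
  intro r j
  simp [Prog.effect, NExp.eval, RExp.eval, e1, e2, e3, h3]

theorem distRow_term (hP : NormProg ν P C) {s : Mem} {m N : ℕ} (hm : s.nreg 11 = m)
    (hN : s.nreg 10 = N) :
    Term (distRow P) s (N * ((C + 11) * (m + 1) + 3) + 3) fun s' =>
      (∀ r j, r ≠ s.nreg 12 + 1 → s'.rarr 12 r j = s.rarr 12 r j) ∧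
      ∀ j < N, s'.rarr 12 (s.nreg 12 + 1) (j + 1) =
        ν m fun l => s.rarr 10 (s.nreg 12) l - s.rarr 11 j l := by
  have hw : ∀ x < 40, x ≠ 13 → x ≠ 14 → (distRow P).writesN x = false := by
    intro x hx h13 h14
    have := (distEntry_writes hP hx).1.2 h14
    simp [distRow, forUp, Prog.writesN, this, h13]
  have hwr : ∀ x < 40, x ≠ 12 → (distRow P).writesRA x = false := by
    intro x hx h12
    have := (distEntry_writes hP hx).2.2.2.2 h12
    simp [distRow, forUp, Prog.writesRA, this]
  refine (Term.forUp (c := (C + 11) * (m + 1)) N (fun i s' =>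
      (∀ r j, r ≠ s.nreg 12 + 1 → s'.rarr 12 r j = s.rarr 12 r j) ∧
      ∀ j < i, s'.rarr 12 (s.nreg 12 + 1) (j + 1) =
        ν m fun l => s.rarr 10 (s.nreg 12) l - s.rarr 11 j l)
    ((distEntry_writes hP (by omega)).1.2 (by omega)) (by simp [NExp.eval]) ?_
    (fun _ _ _ h => h) (by simp [NExp.eval]) ?_).le (by simp [NExp.eval])
  · intro s' hf
    exact (hf.nreg 10 (hw 10 (by omega) (by omega) (by omega))).trans hN
  · intro i s' _ hi hf hj ⟨hI1, hI2⟩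
    have e12 : s'.nreg 12 = s.nreg 12 := hf.nreg 12 (hw 12 (by omega) (by omega) (by omega))
    have r10 : s'.rarr 10 = s.rarr 10 := hf.rarr 10 (hwr 10 (by omega) (by omega))
    have r11 : s'.rarr 11 = s.rarr 11 := hf.rarr 11 (hwr 11 (by omega) (by omega))
    refine (distEntry_term hP
      ((hf.nreg 11 (hw 11 (by omega) (by omega) (by omega))).trans hm)).mono le_rfl ?_
    intro s'' _ h
    rw [hj, e12, r10, r11] at h
    refine ⟨fun r j hr => ?_, fun j hj' => ?_⟩
    · rw [h, if_neg (by tauto), hI1 r j hr]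
    · by_cases hji : j = i
      · rw [h, if_pos (by simp [hji]), hji]
      · rw [h, if_neg (by simp [hji]), hI2 j (by omega)]

theorem distMatrix_term (hP : NormProg ν P C) {s : Mem} {m N : ℕ} (hm : s.nreg 11 = m)
    (hN : s.nreg 10 = N) :
    Term (distMatrix P) s (N * (N * ((C + 11) * (m + 1) + 3) + 3 + 3) + 3) fun s' =>
      ∀ i < N, ∀ j < N, s'.rarr 12 (i + 1) (j + 1) =
        ν m fun l => s.rarr 10 i l - s.rarr 11 j l := by
  have hw : (distRow P).writesN 12 = false := by
    have := (distEntry_writes hP (x := 12) (by omega)).1.2 (by omega)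
    simp [distRow, forUp, Prog.writesN, this]
  refine (Term.forUp (c := N * ((C + 11) * (m + 1) + 3) + 3) N (fun k s' =>
      ∀ i < k, ∀ j < N, s'.rarr 12 (i + 1) (j + 1) =
        ν m fun l => s.rarr 10 i l - s.rarr 11 j l)
    hw (by simp [NExp.eval]) ?_
    (fun _ _ _ h => h) (by simp [NExp.eval]) ?_).le (by simp [NExp.eval])
  · intro s' hf
    exact (hf.nreg 10 ((distMatrix_writes hP (by omega)).1.2 (by omega))).trans hN
  · intro k s' _ hi hf hk hI
    refine (distRow_term hP ((hf.nreg 11 ((distMatrix_writes hP (by omega)).1.2 (by omega))).trans hm)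
      ((hf.nreg 10 ((distMatrix_writes hP (by omega)).1.2 (by omega))).trans hN)).mono le_rfl ?_
    intro s'' _ ⟨h1, h2⟩
    rw [hk, hf.rarr 10 ((distMatrix_writes hP (by omega)).2.2.2.2 (by omega)),
      hf.rarr 11 ((distMatrix_writes hP (by omega)).2.2.2.2 (by omega))] at h2
    rw [hk] at h1
    intro i hi' j hj
    by_cases hik : i = k
    · rw [hik]; exact h2 j hj
    · rw [h1 _ _ (by omega)]; exact hI i (by omega) j hj

theorem emdProg_term (hP : NormProg ν P C) {s : Mem} {m N : ℕ} (hN1 : 1 ≤ N) (hm : s.nreg 11 = m)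
    (hN : s.nreg 10 = N) (x y : Fin N → Fin m → ℝ) (hx : ∀ (i : Fin N) (l : Fin m), s.rarr 10 i l = x i l)
    (hy : ∀ (i : Fin N) (l : Fin m), s.rarr 11 i l = y i l) :
    Term (emdProg P) s ((C + 5000) * (N ^ 3 + m * N ^ 2)) fun s' => s'.rreg 10 = emd (ν m) x y := by
  have hcost : N * (N * ((C + 11) * (m + 1) + 3) + 3 + 3) + 3 + 500 * (N + 1) ^ 3 + 1 ≤
      (C + 5000) * (N ^ 3 + m * N ^ 2) := by
    -- With `N = n + 1` both sides expand into polynomials with natural coefficients, and the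
    -- inequality becomes linear in the monomials, which `omega` treats as atoms. The other cost
    -- bounds are settled in the same way.
    obtain ⟨n, rfl⟩ : ∃ n, N = n + 1 := ⟨N - 1, by omega⟩
    ring_nf
    omega
  refine (Term.seq (distMatrix_term hP hm hN) ?_).le hcost
  intro s1 f1 h1
  have hd : ∀ i j : Fin N, s1.rarr 12 (i + 1) (j + 1) = ν m (x i - y j) := by
    intro i j
    rw [h1 i i.2 j j.2]
    congr 1
    funext l
    rw [hx, hy]; rfl
  refine (hungarian_term ((f1.nreg 10 ((distMatrix_writes hP (by omega)).1.2 (by omega))).trans hN)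
    (fun i j => by rw [hd]; exact apply_nonneg _ _)).mono le_rfl ?_
  rintro s' - ⟨σ, u, v, h2, h3, h4⟩
  rw [h4, emd_eq_of_dual hN1 (ν m) x y σ u v (fun i j => by rw [← hd]; exact h2 i j)
    (fun j => by rw [← hd]; exact h3 j)]
  simp only [hd]
end

/-! ## Student's t-distribution -/

/-- The integral of `cos ^ j` from `0` to `θ`. -/
noncomputable def cosInt (j : ℕ) (θ : ℝ) : ℝ := ∫ x in (0 : ℝ)..θ, Real.cos x ^ j

theorem cosInt_zero (θ : ℝ) : cosInt 0 θ = θ := by simp [cosInt]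

theorem cosInt_one (θ : ℝ) : cosInt 1 θ = Real.sin θ := by simp [cosInt]

theorem cosInt_add_two (j : ℕ) (θ : ℝ) : cosInt (j + 2) θ =
    (Real.cos θ ^ (j + 1) * Real.sin θ + (j + 1) * cosInt j θ) / (j + 2) := by
  rw [cosInt, integral_cos_pow, cosInt, Real.sin_zero]
  ring

theorem hasDerivAt_cosInt (j : ℕ) (θ : ℝ) : HasDerivAt (cosInt j) (Real.cos θ ^ j) θ :=
  intervalIntegral.integral_hasDerivAt_right (by apply Continuous.intervalIntegrable; fun_prop)
    (Continuous.stronglyMeasurableAtFilter (by fun_prop) _ _) (by fun_prop)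

/-- Needed to divide by the total mass of the t-density. -/
theorem cosInt_pi_div_two_pos (j : ℕ) : 0 < cosInt j (Real.pi / 2) := by
  refine intervalIntegral.intervalIntegral_pos_of_pos_on
    (by apply Continuous.intervalIntegrable; fun_prop) (fun x hx => pow_pos ?_ j) (by positivity)
  exact Real.cos_pos_of_mem_Ioo ⟨by linarith [hx.1, Real.pi_pos], hx.2⟩

/-- Under `x = √d tan θ` the unnormalized density times `dx` becomes `√d cos θ ^ (d - 1) dθ`.
Equivalently, `√d * cosInt (d - 1) (arctan (x / √d))` is an antiderivative with a finite limit at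
infinity. Evenness reduces both integrals to half-lines, and the factor `2 √d` cancels in the
quotient. -/
theorem studentTwoTailed_eq {d : ℕ} (hd : 1 ≤ d) (t : ℝ) :
    studentTwoTailed d t =
      1 - cosInt (d - 1) (Real.arctan (|t| / √d)) / cosInt (d - 1) (Real.pi / 2) := by
  obtain ⟨e, rfl⟩ : ∃ e, d = e + 1 := ⟨d - 1, by omega⟩
  rw [Nat.add_sub_cancel]
  have hd0 : (0 : ℝ) < ((e + 1 : ℕ) : ℝ) := by positivity
  set D : ℝ := ((e + 1 : ℕ) : ℝ) with hD
  have hDe : D = e + 1 := by rw [hD]; push_cast; rfl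
  have hs : 0 < √D := Real.sqrt_pos.2 hd0
  set g : ℝ → ℝ := fun x => (1 + x ^ 2 / D) ^ (-(D + 1) / 2) with hg
  set F : ℝ → ℝ := fun x => √D * cosInt e (Real.arctan (x / √D)) with hF
  have hg0 : ∀ x, 0 ≤ g x := fun x => Real.rpow_nonneg (by positivity) _
  have hderiv : ∀ x, HasDerivAt F (g x) x := by
    intro x
    have h1 : HasDerivAt (fun x : ℝ => x / √D) (1 / √D) x := (hasDerivAt_id x).div_const _
    have h2 := ((hasDerivAt_cosInt e (Real.arctan (x / √D))).comp x
      ((Real.hasDerivAt_arctan (x / √D)).comp x h1)).const_mul (√D)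
    refine h2.congr_deriv ?_
    have hB : 0 < 1 + x ^ 2 / D := by positivity
    have hq : (x / √D) ^ 2 = x ^ 2 / D := by rw [div_pow, Real.sq_sqrt hd0.le]
    rw [Real.cos_arctan, hq]
    change _ = (1 + x ^ 2 / D) ^ (-(D + 1) / 2)
    have h3 : (1 / √(1 + x ^ 2 / D)) ^ e = (1 + x ^ 2 / D) ^ (-(e : ℝ) / 2) := by
      rw [one_div, Real.sqrt_eq_rpow, ← Real.rpow_neg hB.le, ← Real.rpow_natCast, ← Real.rpow_mul hB.le]
      congr 1
      ring
    have h4 : 1 / (1 + x ^ 2 / D) = (1 + x ^ 2 / D) ^ (-1 : ℝ) := by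
      rw [Real.rpow_neg_one, one_div]
    rw [h3, h4]
    calc √D * ((1 + x ^ 2 / D) ^ (-(e : ℝ) / 2) * ((1 + x ^ 2 / D) ^ (-1 : ℝ) * (1 / √D)))
        = (1 + x ^ 2 / D) ^ (-(e : ℝ) / 2) * (1 + x ^ 2 / D) ^ (-1 : ℝ) := by
          field_simp
      _ = (1 + x ^ 2 / D) ^ (-(D + 1) / 2) := by
          rw [← Real.rpow_add hB, hDe]
          congr 1
          ring
  have hlim : Filter.Tendsto F Filter.atTop (nhds (√D * cosInt e (Real.pi / 2))) := by
    refine Filter.Tendsto.const_mul _ ?_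
    refine ((hasDerivAt_cosInt e _).continuousAt.tendsto).comp ?_
    exact (tendsto_nhds_of_tendsto_nhdsWithin Real.tendsto_arctan_atTop).comp
      (Filter.tendsto_id.atTop_div_const hs)
  have hIoi : ∀ a, ∫ x in Set.Ioi a, g x = √D * cosInt e (Real.pi / 2) - F a := fun a =>
    integral_Ioi_of_hasDerivAt_of_nonneg' (fun x _ => hderiv x) (fun x _ => hg0 x) hlim
  have habs : ∀ x, g |x| = g x := fun x => by simp [hg]
  have hden : ∫ x, g x = 2 * (√D * cosInt e (Real.pi / 2)) := by
    have := integral_comp_abs (f := g)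
    simp only [habs] at this
    rw [this, hIoi]
    simp [hF, cosInt]
  have hnum : ∫ x in {x : ℝ | |t| ≤ |x|}, g x = 2 * (√D * cosInt e (Real.pi / 2) - F |t|) := by
    rw [← integral_indicator (measurableSet_le measurable_const (by fun_prop))]
    have := integral_comp_abs (f := Set.indicator (Set.Ici |t|) g)
    have hi : ∀ x, Set.indicator (Set.Ici |t|) g |x| =
        Set.indicator {x : ℝ | |t| ≤ |x|} g x := by
      intro x
      simp [Set.indicator_apply, habs]
    simp only [hi] at this
    rw [this, setIntegral_indicator measurableSet_Ici, ← hIoi]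
    congr 1
    refine setIntegral_congr_set ?_
    -- The closed half-line differs from the open one by a null set, and positivity is then implied
    -- by `|t| < x`.
    have h1 : (Set.Ioi (0 : ℝ) ∩ Set.Ici |t| : Set ℝ) =ᵐ[volume] (Set.Ioi 0 ∩ Set.Ioi |t| : Set ℝ) :=
      (Filter.EventuallyEq.refl _ _).inter Ioi_ae_eq_Ici.symm
    refine h1.trans ?_
    rw [Set.Ioi_inter_Ioi, max_eq_right (abs_nonneg t)]
    exact Filter.EventuallyEq.rfl
  have hW := cosInt_pi_div_two_pos e
  rw [studentTwoTailed, ← hD, hnum, hden, hF]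
  simp only
  field_simp

/-! ## The t-test program

The sample size is in natural-number register `0`, and the sample in row `0` of real array `8`; the
p-value is left in real register `9`. -/

def RExp.one : RExp := .ofNat (.const 1)

theorem RExp.eval_one (s : Mem) : RExp.one.eval s = 1 := by simp [RExp.one, RExp.eval, NExp.eval]

/-- The only real comparison of the machine is strict, so equality takes two tests. -/
def BExp.rzero (e : RExp) : BExp := .and (.not (.rlt e .zero)) (.not (.rlt .zero e))

theorem BExp.holds_rzero (e : RExp) (s : Mem) : (BExp.rzero e).Holds s ↔ e.eval s = 0 := by
  simp only [BExp.rzero, BExp.Holds, RExp.eval_zero, not_lt]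
  exact ⟨fun h => le_antisymm h.2 h.1, fun h => ⟨h.ge, h.le⟩⟩

def meanProg : Prog :=
  .rset 1 .zero ;;
  forUp 6 (.const 0) (.reg 0) (.rset 1 (.add (.reg 1) (.arr 8 (.const 0) (.reg 6)))) ;;
  .rset 1 (.div (.reg 1) (.ofNat (.reg 0)))

def devExp : RExp := .sub (.arr 8 (.const 0) (.reg 6)) (.reg 1)

def varProg : Prog :=
  .rset 2 .zero ;;
  forUp 6 (.const 0) (.reg 0) (.rset 2 (.add (.reg 2) (.mul devExp devExp))) ;;
  .rset 2 (.div (.reg 2) (.sub (.ofNat (.reg 0)) .one))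

def absStatProg : Prog :=
  .rset 3 (.div (.reg 1) (.div (.sqrt (.reg 2)) (.sqrt (.ofNat (.reg 0))))) ;;
  .ite (.rlt (.reg 3) .zero) (.rset 3 (.sub .zero (.reg 3))) .skip

/-- With `y = |t| / √(n - 1)` and `θ = arctan y`, the cosine is `1 / √(1 + y²)` and the sine is `y`
times it; `π / 2` is obtained as twice `arctan 1`. Real registers `4`, `5` then hold `cosInt 0` and
`cosInt 1` at `θ`, registers `6`, `7` the same at `π / 2`, and register `8` the current power of the
cosine. -/
def studentInit : Prog :=
  absStatProg ;;
  .rset 3 (.div (.reg 3) (.sqrt (.ofNat (.sub (.reg 0) (.const 1))))) ;;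
  .rset 4 (.arctan (.reg 3)) ;;
  .rset 2 (.div .one (.sqrt (.add .one (.mul (.reg 3) (.reg 3))))) ;;
  .rset 5 (.mul (.reg 3) (.reg 2)) ;;
  .rset 3 (.reg 5) ;;
  .rset 6 (.add (.arctan .one) (.arctan .one)) ;;
  .rset 7 .one ;;
  .rset 8 (.reg 2)

/-- The coefficients `j + 1` and `j + 2` of the recursion for `cosInt`. -/
def coefOne : RExp := .add (.ofNat (.reg 6)) .one

def coefTwo : RExp := .add coefOne .one

/-- Both recursions advance by one index. At `π / 2` the boundary term vanishes with the cosine, so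
only the product with the older value remains. The natural-number register `6` is the loop counter
`j`; the real register `6` is a different cell. -/
def studentStep : Prog :=
  .rset 9 (.div (.add (.mul (.reg 8) (.reg 3)) (.mul coefOne (.reg 4))) coefTwo) ;;
  .rset 4 (.reg 5) ;; .rset 5 (.reg 9) ;;
  .rset 9 (.div (.mul coefOne (.reg 6)) coefTwo) ;;
  .rset 6 (.reg 7) ;; .rset 7 (.reg 9) ;;
  .rset 8 (.mul (.reg 8) (.reg 2))

def studentProg : Prog :=
  studentInit ;; forUp 6 (.const 0) (.sub (.reg 0) (.const 2)) studentStep ;;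
    .rset 9 (.sub .one (.div (.reg 4) (.reg 6)))

def tTestProg : Prog :=
  meanProg ;; varProg ;;
  .ite (.rzero (.reg 2)) (.ite (.rzero (.reg 1)) (.rset 9 .one) (.rset 9 .zero)) studentProg

/-! ### Correctness and running time of the t-test program. -/

theorem meanProg_term {s : Mem} {n : ℕ} (hn : s.nreg 0 = n) (δ : Fin n → ℝ)
    (hδ : ∀ i : Fin n, s.rarr 8 0 i = δ i) :
    Term meanProg s (n * 4 + 7) fun s' => s'.rreg 1 = sampleMean δ := by
  refine (Term.seq (T := 1) (T' := n * 4 + 3 + 1 + 1) (Q := fun s' => s'.rreg 1 = 0)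
    (Term.straight rfl (by decide)
    (by simp [Prog.effect, RExp.eval_zero])) ?_).le (by omega)
  intro s1 f1 h1
  refine Term.seq (T := n * 4 + 3) (T' := 1) ((Term.forUp (c := 1) n (fun i s' =>
    s'.rreg 1 = ∑ j ∈ Finset.range i, s.rarr 8 0 j) rfl (by simp [NExp.eval]) ?_
    (fun _ _ _ h => h) (by simp [NExp.eval, h1]) ?_).le (by simp [NExp.eval])) ?_
  · intro s' hf
    exact (hf.nreg 0 rfl).trans ((f1.nreg 0 rfl).trans hn)
  · intro i s' _ hi hf hj hI
    refine Term.straight rfl (by decide) ?_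
    rw [Finset.sum_range_succ, ← hI]
    simp [Prog.effect, RExp.eval, NExp.eval, hj, hf.rarr 8 rfl, f1.rarr 8 rfl]
  intro s2 f2 h2
  refine Term.straight rfl (by decide) ?_
  rw [Finset.sum_range] at h2
  simp [Prog.effect, RExp.eval, NExp.eval, h2, hδ, sampleMean, f2.nreg 0 rfl, f1.nreg 0 rfl, hn]

theorem varProg_term {s : Mem} {n : ℕ} (hn : s.nreg 0 = n) (δ : Fin n → ℝ)
    (hδ : ∀ i : Fin n, s.rarr 8 0 i = δ i) (hm : s.rreg 1 = sampleMean δ) :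
    Term varProg s (n * 4 + 7) fun s' => s'.rreg 2 = sampleVar δ := by
  refine (Term.seq (T := 1) (T' := n * 4 + 3 + 1 + 1) (Q := fun s' => s'.rreg 2 = 0)
    (Term.straight rfl (by decide)
    (by simp [Prog.effect, RExp.eval_zero])) ?_).le (by omega)
  intro s1 f1 h1
  refine Term.seq (T := n * 4 + 3) (T' := 1) ((Term.forUp (c := 1) n (fun i s' =>
    s'.rreg 2 = ∑ j ∈ Finset.range i, (s.rarr 8 0 j - sampleMean δ) ^ 2) rfl (by simp [NExp.eval]) ?_
    (fun _ _ _ h => h) (by simp [NExp.eval, h1]) ?_).le (by simp [NExp.eval])) ?_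
  · intro s' hf
    exact (hf.nreg 0 rfl).trans ((f1.nreg 0 rfl).trans hn)
  · intro i s' _ hi hf hj hI
    refine Term.straight rfl (by decide) ?_
    rw [Finset.sum_range_succ, ← hI]
    simp [Prog.effect, devExp, RExp.eval, NExp.eval, hj, hf.rarr 8 rfl, f1.rarr 8 rfl,
      hf.rreg 1 rfl, f1.rreg 1 rfl, hm, sq]
  intro s2 f2 h2
  refine Term.straight rfl (by decide) ?_
  rw [Finset.sum_range] at h2
  simp [Prog.effect, RExp.eval, RExp.eval_one, NExp.eval, h2, hδ, sampleVar, f2.nreg 0 rfl,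
    f1.nreg 0 rfl, hn]

theorem studentInit_term {s : Mem} {n : ℕ} (hn : s.nreg 0 = n) {y : ℝ}
    (hy : y = |s.rreg 1 / (√(s.rreg 2) / √n)| / √((n - 1 : ℕ) : ℝ)) :
    Term studentInit s 20 fun s' => s'.rreg 2 = Real.cos (Real.arctan y) ∧
      s'.rreg 3 = Real.sin (Real.arctan y) ∧ s'.rreg 4 = Real.arctan y ∧
      s'.rreg 5 = Real.sin (Real.arctan y) ∧ s'.rreg 6 = Real.pi / 2 ∧ s'.rreg 7 = 1 ∧
      s'.rreg 8 = Real.cos (Real.arctan y) := by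
  have habs : Term absStatProg s 4 fun s' => s'.rreg 3 = |s.rreg 1 / (√(s.rreg 2) / √n)| := by
    refine Term.straight rfl (by decide) ?_
    by_cases ht : s.rreg 1 / (√(s.rreg 2) / √n) < 0
    · simp only [absStatProg, Prog.effect, RExp.eval, RExp.eval_zero, NExp.eval, BExp.Holds,
        Mem.setR_rreg, hn, if_true, if_pos ht, abs_of_neg ht, zero_sub]
    · simp only [absStatProg, Prog.effect, RExp.eval, RExp.eval_zero, NExp.eval, BExp.Holds,
        Mem.setR_rreg, hn, if_true, if_neg ht, abs_of_nonneg (not_lt.1 ht)]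
  refine (Term.seq (T' := 15) habs ?_).le (by omega)
  intro s1 f1 h1
  refine Term.straight rfl (by decide) ?_
  have hpi : Real.pi / 4 + Real.pi / 4 = Real.pi / 2 := by ring
  rw [Real.cos_arctan, Real.sin_arctan]
  simp only [Prog.effect, RExp.eval, RExp.eval_one, NExp.eval, Mem.setR_rreg, h1,
    (f1.nreg 0 rfl).trans hn, if_true, ← hy, ← sq, Real.arctan_one, hpi]
  norm_num [div_eq_mul_inv]

theorem studentProg_term {s : Mem} {n : ℕ} (hn : s.nreg 0 = n) (h2 : 2 ≤ n) :
    Term studentProg s (n * 16 + 30) fun s' =>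
      s'.rreg 9 = studentTwoTailed (n - 1) (s.rreg 1 / (√(s.rreg 2) / √n)) := by
  set y := |s.rreg 1 / (√(s.rreg 2) / √n)| / √((n - 1 : ℕ) : ℝ) with hy
  refine (Term.seq (T' := n * 16 + 3 + 1 + 1) (studentInit_term hn hy) ?_).le (by omega)
  rintro s1 f1 ⟨i2, i3, i4, i5, i6, i7, i8⟩
  -- There are `n - 1` degrees of freedom and the exponent of the cosine is one less, hence `n - 2`
  -- rounds.
  refine Term.seq (T := n * 16 + 3) (T' := 1) ((Term.forUp (c := 13) (n - 2) (fun i s' =>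
    s'.rreg 4 = cosInt i (Real.arctan y) ∧ s'.rreg 5 = cosInt (i + 1) (Real.arctan y) ∧
    s'.rreg 6 = cosInt i (Real.pi / 2) ∧ s'.rreg 7 = cosInt (i + 1) (Real.pi / 2) ∧
    s'.rreg 8 = Real.cos (Real.arctan y) ^ (i + 1)) rfl (by simp [NExp.eval]) ?_
    (fun _ _ _ h => h) ?_ ?_).le (by simp only [NExp.eval]; omega)) ?_
  · intro s' hf
    simp only [NExp.eval]
    rw [hf.nreg 0 rfl, f1.nreg 0 rfl, hn]
  · simp [NExp.eval, i4, i5, i6, i7, i8, cosInt_zero, cosInt_one]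
  · rintro i s' - hi hf hj ⟨I4, I5, I6, I7, I8⟩
    refine Term.straight rfl (by decide) ?_
    have e2 : s'.rreg 2 = _ := (hf.rreg 2 rfl).trans i2
    have e3 : s'.rreg 3 = _ := (hf.rreg 3 rfl).trans i3
    have hc : (i : ℝ) + 1 + 1 = i + 2 := by ring
    have hz : cosInt (i + 2) (Real.pi / 2) = (i + 1) * cosInt i (Real.pi / 2) / (i + 2) := by
      rw [cosInt_add_two]; simp
    rw [cosInt_add_two, hz]
    simp only [studentStep, Prog.effect, coefOne, coefTwo, RExp.eval, NExp.eval, RExp.eval_one,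
      Mem.setR_rreg, Mem.setR_nreg, hj, e2, e3, I4, I5, I6, I7, I8, hc]
    norm_num [pow_succ]
  rintro s2 f2 ⟨I4, -, I6, -, -⟩
  refine Term.straight rfl (by decide) ?_
  rw [studentTwoTailed_eq (by omega), ← hy, show n - 1 - 1 = n - 2 by omega]
  simp [Prog.effect, RExp.eval, RExp.eval_one, I4, I6]

theorem tTestProg_term {s : Mem} {n : ℕ} (hn : s.nreg 0 = n) (h2 : 2 ≤ n) (δ : Fin n → ℝ)
    (hδ : ∀ i : Fin n, s.rarr 8 0 i = δ i) :
    Term tTestProg s (n * 24 + 47) fun s' => s'.rreg 9 = tTestPValue δ := by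
  refine (Term.seq (T' := n * 4 + 7 + (n * 16 + 30 + 1) + 1) (meanProg_term hn δ hδ) ?_).le
    (by omega)
  intro s1 f1 h1
  have hn1 : s1.nreg 0 = n := (f1.nreg 0 rfl).trans hn
  refine Term.seq (varProg_term hn1 δ (fun i => by rw [f1.rarr 8 rfl]; exact hδ i) h1) ?_
  intro s2 f2 hv
  have hm : s2.rreg 1 = sampleMean δ := (f2.rreg 1 rfl).trans h1
  have hn2 : s2.nreg 0 = n := (f2.nreg 0 rfl).trans hn1
  refine Term.ite (fun hb => ?_) fun hb => ?_
  · simp only [BExp.holds_rzero, RExp.eval, hv] at hb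
    refine (Term.ite (T := 1) (fun hb' => ?_) fun hb' => ?_).le (by omega)
    · simp only [BExp.holds_rzero, RExp.eval, hm] at hb'
      exact Term.straight rfl (by decide) (by simp [Prog.effect, RExp.eval_one, tTestPValue, hb, hb'])
    · simp only [BExp.holds_rzero, RExp.eval, hm] at hb'
      exact Term.straight rfl (by decide) (by simp [Prog.effect, RExp.eval_zero, tTestPValue, hb, hb'])
  · simp only [BExp.holds_rzero, RExp.eval, hv] at hb
    refine (studentProg_term hn2 h2).mono le_rfl fun s' _ h => ?_
    rw [h, hm, hv, tTestPValue, if_neg hb]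

/-! ## Copying samples -/

/-- Copies row `row` of the real array `src` to row `off + i` of the real array `dst`, for
`i = 0, …, cnt - 1`. The expression `row` may use `i`, which is in register `20`; the number of
columns is in register `11`. -/
def copyRows (src dst : ℕ) (cnt row off : NExp) : Prog :=
  forUp 20 (.const 0) cnt
    (.nset 22 row ;; .nset 23 (.add off (.reg 20)) ;;
      forUp 21 (.const 0) (.reg 11) (.rput dst (.reg 23) (.reg 21) (.arr src (.reg 22) (.reg 21))))

/-- The registers other than `20, …, 23` and the arrays of natural numbers agree. -/
def SameIndices (s s' : Mem) : Prop :=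
  (∀ x, x < 20 ∨ 23 < x → s'.nreg x = s.nreg x) ∧ s'.narr = s.narr

theorem copyRows_writes (src dst : ℕ) (cnt row off : NExp) (x : ℕ) :
    ((copyRows src dst cnt row off).writesN x = false ↔ x ≠ 20 ∧ x ≠ 21 ∧ x ≠ 22 ∧ x ≠ 23) ∧
    (copyRows src dst cnt row off).writesR x = false ∧
    (copyRows src dst cnt row off).writesNA x = false ∧
    ((copyRows src dst cnt row off).writesRA x = false ↔ x ≠ dst) := by
  simp [copyRows, forUp, Prog.writesN, Prog.writesR, Prog.writesNA, Prog.writesRA]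
  tauto

theorem Frame.sameIndices {src dst : ℕ} {cnt row off : NExp} {s s' : Mem}
    (h : Frame (copyRows src dst cnt row off) s s') : SameIndices s s' :=
  ⟨fun x hx => h.nreg x ((copyRows_writes _ _ _ _ _ x).1.2 (by omega)),
    funext fun x => h.narr x (copyRows_writes _ _ _ _ _ x).2.2.1⟩

theorem copyRow_term {src dst : ℕ} (hne : src ≠ dst) {s : Mem} {m : ℕ} (hm : s.nreg 11 = m) :
    Term (forUp 21 (.const 0) (.reg 11)
      (.rput dst (.reg 23) (.reg 21) (.arr src (.reg 22) (.reg 21)))) s (m * 4 + 3) fun s' =>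
      (∀ l < m, s'.rarr dst (s.nreg 23) l = s.rarr src (s.nreg 22) l) ∧
      ∀ r l, r ≠ s.nreg 23 → s'.rarr dst r l = s.rarr dst r l := by
  refine (Term.forUp (c := 1) m (fun i s' =>
      (∀ l < i, s'.rarr dst (s.nreg 23) l = s.rarr src (s.nreg 22) l) ∧
      ∀ r l, r ≠ s.nreg 23 → s'.rarr dst r l = s.rarr dst r l) rfl (by simp [NExp.eval]) ?_
    (fun _ _ _ h => h) (by simp [NExp.eval]) ?_).le (by simp [NExp.eval])
  · intro s' hf
    simp only [NExp.eval]
    rw [hf.nreg 11 rfl, hm]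
  · rintro i s' - hi hf hj ⟨hI1, hI2⟩
    refine Term.straight rfl (by simp [Prog.cost]) ?_
    have e := hf.rarr src (by simp [forUp, Prog.writesRA, hne])
    refine ⟨fun l hl => ?_, fun r l hr => ?_⟩
    · by_cases hli : l = i
      · simp [Prog.effect, NExp.eval, RExp.eval, hj, hli, e, hf.nreg 22 rfl, hf.nreg 23 rfl]
      · simpa [Prog.effect, NExp.eval, RExp.eval, hj, hli] using hI1 l (by omega)
    · simpa [Prog.effect, NExp.eval, RExp.eval, hf.nreg 23 rfl, hr] using hI2 r l hr

/-- The index expressions are re-evaluated in every round, so their values are required in all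
memories that the copying can produce. Rows outside the target range survive, which allows several
copies into one array. -/
theorem copyRows_term {src dst : ℕ} (hne : src ≠ dst) {cnt row off : NExp} {s : Mem} {m : ℕ}
    (hm : s.nreg 11 = m) (n o : ℕ) (f : ℕ → ℕ)
    (hcnt : ∀ s', SameIndices s s' → cnt.eval s' = n)
    (hoff : ∀ s', SameIndices s s' → off.eval s' = o)
    (hrow : ∀ i < n, ∀ s', SameIndices s s' → s'.nreg 20 = i → row.eval s' = f i) :
    Term (copyRows src dst cnt row off) s (n * (m * 4 + 10) + 3) fun s' =>
      (∀ i < n, ∀ l < m, s'.rarr dst (o + i) l = s.rarr src (f i) l) ∧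
      ∀ r l, r < o ∨ o + n ≤ r → s'.rarr dst r l = s.rarr dst r l := by
  refine (Term.forUp (c := m * 4 + 7) n (fun k s' =>
      (∀ i < k, ∀ l < m, s'.rarr dst (o + i) l = s.rarr src (f i) l) ∧
      ∀ r l, r < o ∨ o + k ≤ r → s'.rarr dst r l = s.rarr dst r l) rfl (by simp [NExp.eval]) ?_
    (fun _ _ _ h => h) (by simp [NExp.eval]) ?_).le (by simp [NExp.eval])
  · exact fun s' hf => hcnt s' (Frame.sameIndices hf)
  · rintro k s' - hk hf hreg ⟨hI1, hI2⟩
    have hs' : SameIndices s s' := Frame.sameIndices hf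
    refine (Term.seq (T := 1) (T' := 1 + (m * 4 + 3) + 1)
      (Q := fun s1 => s1.nreg 22 = f k ∧ s1.nreg 20 = k ∧ SameIndices s s1 ∧ s1.rarr = s'.rarr)
      (Term.straight rfl le_rfl ⟨?_, ?_, ?_, rfl⟩) ?_).le (by omega)
    · simp [Prog.effect, hrow k hk s' hs' hreg]
    · simp [Prog.effect, hreg]
    · refine ⟨fun x hx => ?_, hs'.2⟩
      have : x ≠ 22 := by omega
      simp [Prog.effect, this, hs'.1 x hx]
    rintro s1 - ⟨h1, h2, h3, h4⟩
    refine Term.seq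
      (Q := fun s2 => s2.nreg 22 = f k ∧ s2.nreg 23 = o + k ∧ s2.nreg 11 = m ∧ s2.rarr = s'.rarr)
      (Term.straight rfl le_rfl ⟨?_, ?_, ?_, h4⟩) ?_
    · simp [Prog.effect, h1]
    · simp [Prog.effect, NExp.eval, hoff s1 h3, h2]
    · simp [Prog.effect, h3.1 11 (by omega), hm]
    rintro s2 - ⟨h1, h2, h3, h4⟩
    refine (copyRow_term hne h3).mono le_rfl ?_
    rintro s3 - ⟨h5, h6⟩
    have e : s'.rarr src = s.rarr src := hf.rarr src ((copyRows_writes _ _ _ _ _ src).2.2.2.2 hne)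
    rw [h2, h1, h4, e] at h5
    rw [h2, h4] at h6
    refine ⟨fun i hi l hl => ?_, fun r l hr => ?_⟩
    · by_cases hik : i = k
      · rw [hik]; exact h5 l hl
      · rw [h6 _ _ (by omega)]; exact hI1 i (by omega) l hl
    · rw [h6 _ _ (by omega)]; exact hI2 r l (by omega)

theorem sampleArray_apply {N m : ℕ} (x : Fin N → Fin m → ℝ) (i : Fin N) (l : Fin m) :
    sampleArray x i l = x i l := by
  simp [sampleArray]

/-! ## The distance between two samples -/

def emdMain (P : Prog) : Prog :=
  .nset 10 (.reg 0) ;; .nset 11 (.reg 1) ;;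
  copyRows 0 10 (.reg 10) (.reg 20) (.const 0) ;;
  copyRows 1 11 (.reg 10) (.reg 20) (.const 0) ;;
  emdProg P ;; .rset 0 (.reg 10)

theorem emdProg_deterministic {ν : ∀ m : ℕ, Seminorm ℝ (Fin m → ℝ)} {P : Prog} {C : ℕ}
    (hP : NormProg ν P C) : (emdProg P).Deterministic := by
  simp [emdProg, distMatrix, distRow, distEntry, distDiff, forUp, Prog.Deterministic, hP.det,
    hungarian, hungInit, hungPhase, hungReset, hungGrow, hungStep, hungMark, hungRelax, hungMin,
    hungUpdate, hungAugment, hungFlip, hungFlipStep, hungTotal]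

theorem copyRows_deterministic (src dst : ℕ) (cnt row off : NExp) :
    (copyRows src dst cnt row off).Deterministic := by
  simp [copyRows, forUp, Prog.Deterministic]

section
variable {ν : ∀ m : ℕ, Seminorm ℝ (Fin m → ℝ)} {P : Prog} {C : ℕ}

theorem emdMain_term (hP : NormProg ν P C) {N m : ℕ} (hN : 1 ≤ N) (x y : Fin N → Fin m → ℝ) :
    Term (emdMain P) (emdInput x y) ((C + 5040) * (N ^ 3 + m * N ^ 2)) fun s =>
      s.rreg 0 = emd (ν m) x y := by
  have hcost : 1 + (1 + ((N * (m * 4 + 10) + 3) + ((N * (m * 4 + 10) + 3) +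
      ((C + 5000) * (N ^ 3 + m * N ^ 2) + 1 + 1) + 1) + 1) + 1) + 1 ≤
      (C + 5040) * (N ^ 3 + m * N ^ 2) := by
    obtain ⟨n, rfl⟩ : ∃ n, N = n + 1 := ⟨N - 1, by omega⟩
    ring_nf
    omega
  refine (Term.seq (Q := fun s => s.nreg 10 = N ∧ s.nreg 1 = m ∧ s.rarr = (emdInput x y).rarr)
    (Term.straight rfl le_rfl ⟨?_, ?_, rfl⟩) ?_).le hcost
  · simp [Prog.effect, emdInput, NExp.eval]
  · simp [Prog.effect, emdInput]
  rintro s1 - ⟨h1, h2, h3⟩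
  refine Term.seq (Q := fun s => s.nreg 10 = N ∧ s.nreg 11 = m ∧ s.rarr = (emdInput x y).rarr)
    (Term.straight rfl le_rfl ⟨?_, ?_, h3⟩) ?_
  · simp [Prog.effect, h1]
  · simp [Prog.effect, NExp.eval, h2]
  rintro s2 - ⟨h1, h2, h3⟩
  refine Term.seq (copyRows_term (by decide) h2 N 0 id
    (fun s' h => (h.1 10 (by omega)).trans h1) (fun _ _ => rfl) fun i _ s' _ h => h) ?_
  rintro s3 f3 ⟨hx, -⟩
  have i3 := f3.sameIndices
  refine Term.seq (copyRows_term (by decide) ((i3.1 11 (by omega)).trans h2) N 0 id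
    (fun s' h => (h.1 10 (by omega)).trans ((i3.1 10 (by omega)).trans h1)) (fun _ _ => rfl)
    fun i _ s' _ h => h) ?_
  rintro s4 f4 ⟨hy, -⟩
  have i4 := f4.sameIndices
  refine Term.seq (emdProg_term hP hN ((i4.1 11 (by omega)).trans ((i3.1 11 (by omega)).trans h2))
    ((i4.1 10 (by omega)).trans ((i3.1 10 (by omega)).trans h1)) x y (fun i l => ?_) fun i l => ?_) ?_
  · have := hx i i.2 l l.2
    rw [f4.rarr 10 ((copyRows_writes _ _ _ _ _ _).2.2.2.2 (by decide))]
    rw [Nat.zero_add, id, h3] at this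
    rw [this]
    exact sampleArray_apply x i l
  · have := hy i i.2 l l.2
    rw [f3.rarr 1 ((copyRows_writes _ _ _ _ _ _).2.2.2.2 (by decide))] at this
    rw [Nat.zero_add, id, h3] at this
    rw [this]
    exact sampleArray_apply y i l
  intro s5 _ h5
  exact Term.straight rfl le_rfl (by simp [Prog.effect, RExp.eval, h5])

/-! ## The batched distance algorithm -/

/-- The solver leaves its size, its dimension and its samples intact, so the training batch is
copied once and serves for both distances. -/
theorem emdProg_preserves (hP : NormProg ν P C) {x : ℕ} (hx : x = 10 ∨ x = 11) :
    (emdProg P).writesN x = false ∧ (emdProg P).writesRA x = false := by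
  obtain ⟨h1, h2, h3, h4⟩ := distMatrix_writes hP (x := x) (by omega)
  have h1 := h1.2 (by omega)
  have h4 := h4.2 (by omega)
  have : hungarian.writesN x = false ∧ hungarian.writesRA x = false := by
    obtain rfl | rfl := hx <;> decide
  simp [emdProg, Prog.writesN, Prog.writesRA, h1, h4, this]

/-- The first row of the current batch is in register `5`. -/
def batchRow : NExp := .add (.reg 5) (.reg 20)

/-- Natural numbers cannot be multiplied by the machine; the offset `b * k` of the batch is
maintained by adding `k` at the end of each round. -/
def batchStep (P : Prog) : Prog :=
  copyRows 0 10 (.reg 10) batchRow (.const 0) ;;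
  copyRows 1 11 (.reg 10) batchRow (.const 0) ;;
  emdProg P ;; .rset 5 (.reg 10) ;;
  copyRows 2 11 (.reg 10) batchRow (.const 0) ;;
  emdProg P ;; .rput 8 (.const 0) (.reg 4) (.sub (.reg 5) (.reg 10)) ;;
  .nset 5 (.add (.reg 5) (.reg 1))

def verdictProg : Prog :=
  .ite (.rlt (.reg 9) (.reg 0)) (.nset 0 (.const 1)) (.nset 0 (.const 0)) ;; .rset 0 (.reg 9)

def batchMain (P : Prog) : Prog :=
  .nset 10 (.reg 1) ;; .nset 11 (.reg 2) ;; .nset 5 (.const 0) ;;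
  forUp 4 (.const 0) (.reg 0) (batchStep P) ;; tTestProg ;; verdictProg

theorem verdictProg_term {s : Mem} {α p : ℝ} (hα : s.rreg 0 = α) (hp : s.rreg 9 = p) :
    Term verdictProg s 4 fun s' => driftOutput s' = verdict α p := by
  refine Term.straight rfl (by decide) ?_
  by_cases h : p < α <;>
    simp [verdictProg, Prog.effect, BExp.Holds, RExp.eval, NExp.eval, driftOutput, verdict, hα, hp, h]

theorem batchStep_writes (hP : NormProg ν P C) {x : ℕ} (hx : x < 12) :
    (x ≠ 5 → (batchStep P).writesN x = false) ∧
    (x < 10 → x ≠ 5 → (batchStep P).writesR x = false) ∧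
    (x ≠ 8 → x ≠ 10 → x ≠ 11 → (batchStep P).writesRA x = false) := by
  have e : (emdProg P).writesN x = false := by
    by_cases h : x < 10
    · exact (emdProg_writes hP h).1
    · exact (emdProg_preserves hP (by omega)).1
  have c := fun a b c d e => copyRows_writes a b c d e x
  refine ⟨fun h5 => ?_, fun h10 h5 => ?_, fun h1 h2 h3 => ?_⟩
  · have c' := fun a b c' d e => (c a b c' d e).1.2 (by omega)
    simp [batchStep, Prog.writesN, e, c', h5]
  · have c' := fun a b c' d e => (c a b c' d e).2.1
    simp [batchStep, Prog.writesR, (emdProg_writes hP h10).2.1, c', h5]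
  · have e := (emdProg_writes hP (x := x) (by omega)).2.2.2
    have c1 := fun a c' d e => (c a 10 c' d e).2.2.2.2 h2
    have c2 := fun a c' d e => (c a 11 c' d e).2.2.2.2 h3
    simp [batchStep, Prog.writesRA, e, c1, c2, h1]

theorem batch_apply {n k m : ℕ} (S : Fin (n * k) → Fin m → ℝ) (b : Fin n) (j : Fin k) (l : Fin m) :
    sampleArray S (b * k + j) l = batch S b j l := by
  have : ((finProdFinEquiv (b, j) : Fin (n * k)) : ℕ) = b * k + j := by
    simp [finProdFinEquiv, add_comm, mul_comm]
  rw [← this, sampleArray_apply, batch]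

theorem batchStep_term (hP : NormProg ν P C) {s : Mem} {n k m : ℕ} (hk : 1 ≤ k)
    (h10 : s.nreg 10 = k) (h11 : s.nreg 11 = m) (h1 : s.nreg 1 = k) (b : Fin n)
    (h4 : s.nreg 4 = b) (h5 : s.nreg 5 = b * k) (T R D : Fin (n * k) → Fin m → ℝ)
    (hT : s.rarr 0 = sampleArray T) (hR : s.rarr 1 = sampleArray R) (hD : s.rarr 2 = sampleArray D) :
    Term (batchStep P) s ((2 * C + 10060) * (k ^ 3 + m * k ^ 2)) fun s' =>
      s'.nreg 5 = (b + 1) * k ∧ ∀ i, s'.rarr 8 0 i = if i = b then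
        emd (ν m) (batch T b) (batch R b) - emd (ν m) (batch T b) (batch D b) else s.rarr 8 0 i := by
  set Kc := k * (m * 4 + 10) + 3 with hKc
  set E := (C + 5000) * (k ^ 3 + m * k ^ 2) with hE
  have hcost : Kc + (Kc + (E + (1 + (Kc + (E + (1 + 1 + 1) + 1) + 1) + 1) + 1) + 1) + 1 ≤
      (2 * C + 10060) * (k ^ 3 + m * k ^ 2) := by
    rw [hKc, hE]
    obtain ⟨k, rfl⟩ : ∃ j, k = j + 1 := ⟨k - 1, by omega⟩
    ring_nf
    omega
  have hrow : ∀ s' : Mem, s'.nreg 5 = b * k → ∀ i < k, ∀ s'' : Mem, SameIndices s' s'' →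
      s''.nreg 20 = i → batchRow.eval s'' = b * k + i := by
    intro s' h i _ s'' hs hi
    simp only [batchRow, NExp.eval, hs.1 5 (by omega), h, hi]
  have wR : ∀ a {x y}, x ≠ y → (copyRows a y (.reg 10) batchRow (.const 0)).writesRA x = false :=
    fun a x y h => (copyRows_writes _ _ _ _ _ _).2.2.2.2 h
  refine (Term.seq (copyRows_term (src := 0) (dst := 10) (cnt := .reg 10) (row := batchRow)
    (off := .const 0) (by decide) h11 k 0 (fun i => b * k + i) (fun s' h => (h.1 10 (by omega)).trans h10) (fun _ _ => rfl) (hrow s h5)) ?_).le hcost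
  rintro s1 f1 ⟨a1, -⟩
  have i1 := f1.sameIndices
  refine Term.seq (copyRows_term (by decide) ((i1.1 11 (by omega)).trans h11) k 0
    (fun i => b * k + i) (fun s' h => (h.1 10 (by omega)).trans ((i1.1 10 (by omega)).trans h10))
    (fun _ _ => rfl) (hrow s1 ((i1.1 5 (by omega)).trans h5))) ?_
  rintro s2 f2 ⟨a2, -⟩
  have i2 : ∀ x, x < 20 → s2.nreg x = s.nreg x := fun x hx =>
    (f2.sameIndices.1 x (by omega)).trans (i1.1 x (by omega))
  have x2 : ∀ (i : Fin k) (l : Fin m), s2.rarr 10 i l = batch T b i l := fun i l => by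
    have := a1 i i.2 l l.2
    rw [Nat.zero_add, hT, batch_apply] at this
    rw [f2.rarr 10 (wR 1 (by decide)), this]
  refine Term.seq (emdProg_term hP hk ((i2 11 (by omega)).trans h11) ((i2 10 (by omega)).trans h10)
    (batch T b) (batch R b) x2 fun i l => ?_) ?_
  · have := a2 i i.2 l l.2
    rwa [Nat.zero_add, f1.rarr 1 (wR 0 (by decide)), hR, batch_apply] at this
  intro s3 f3 e3
  have i3 : ∀ x, x < 12 → s3.nreg x = s.nreg x := fun x hx => by
    rw [← i2 x (by omega)]
    by_cases h : x < 10
    · exact f3.nreg x (emdProg_writes hP h).1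
    · exact f3.nreg x (emdProg_preserves hP (by omega)).1
  refine Term.seq (Q := fun s' => s'.rreg 5 = emd (ν m) (batch T b) (batch R b) ∧
    s'.nreg = s3.nreg ∧ s'.rarr = s3.rarr)
    (Term.straight rfl le_rfl ⟨by simp [Prog.effect, RExp.eval, e3], rfl, rfl⟩) ?_
  rintro s4 - ⟨e4, n4, r4⟩
  refine Term.seq (copyRows_term (by decide) (by rw [n4, i3 11 (by omega), h11]) k 0
    (fun i => b * k + i) (fun s' h => (h.1 10 (by omega)).trans (by rw [n4, i3 10 (by omega), h10]))
    (fun _ _ => rfl) (hrow s4 (by rw [n4, i3 5 (by omega), h5]))) ?_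
  rintro s5 f5 ⟨a5, -⟩
  have i5 : ∀ x, x < 12 → s5.nreg x = s.nreg x := fun x hx =>
    (f5.sameIndices.1 x (by omega)).trans (by rw [n4, i3 x hx])
  have x5 : ∀ (i : Fin k) (l : Fin m), s5.rarr 10 i l = batch T b i l := fun i l => by
    rw [f5.rarr 10 (wR 2 (by decide)), r4, f3.rarr 10 (emdProg_preserves hP (by omega)).2, x2]
  refine Term.seq (emdProg_term hP hk ((i5 11 (by omega)).trans h11) ((i5 10 (by omega)).trans h10)
    (batch T b) (batch D b) x5 fun i l => ?_) ?_
  · have := a5 i i.2 l l.2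
    rwa [Nat.zero_add, r4, f3.rarr 2 (emdProg_writes hP (by omega)).2.2.2,
      f2.rarr 2 (wR 1 (by decide)), f1.rarr 2 (wR 0 (by decide)), hD, batch_apply] at this
  intro s6 f6 e6
  have i6 : ∀ x, x < 10 → s6.nreg x = s.nreg x := fun x hx => by
    rw [f6.nreg x (emdProg_writes hP hx).1, i5 x (by omega)]
  have r6 : s6.rreg 5 = emd (ν m) (batch T b) (batch R b) := by
    rw [f6.rreg 5 (emdProg_writes hP (by omega)).2.1,
      f5.rreg 5 (copyRows_writes _ _ _ _ _ _).2.1, e4]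
  have r8 : s6.rarr 8 = s.rarr 8 := by
    rw [f6.rarr 8 (emdProg_writes hP (by omega)).2.2.2, f5.rarr 8 (wR 2 (by decide)), r4,
      f3.rarr 8 (emdProg_writes hP (by omega)).2.2.2, f2.rarr 8 (wR 1 (by decide)),
      f1.rarr 8 (wR 0 (by decide))]
  refine Term.straight rfl le_rfl ⟨?_, fun i => ?_⟩
  · simp [Prog.effect, NExp.eval, i6, h5, h1, add_mul]
  · simp [Prog.effect, NExp.eval, RExp.eval, i6, h4, r6, e6, r8]

theorem batchMain_term (hP : NormProg ν P C) {n k m : ℕ} (hn : 2 ≤ n) (hk : 1 ≤ k) (α : ℝ)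
    (T R D : Fin (n * k) → Fin m → ℝ) :
    Term (batchMain P) (driftInput 0 α T R D) ((2 * C + 10200) * (n * (k ^ 3 + m * k ^ 2))) fun s =>
      driftOutput s = batchedTest (ν m) α T R D := by
  have hcost : 1 + (1 + (1 + (n * ((2 * C + 10060) * (k ^ 3 + m * k ^ 2) + 3) + 3 +
      (n * 24 + 47 + 4 + 1) + 1) + 1) + 1) + 1 ≤ (2 * C + 10200) * (n * (k ^ 3 + m * k ^ 2)) := by
    obtain ⟨k, rfl⟩ : ∃ j, k = j + 1 := ⟨k - 1, by omega⟩
    obtain ⟨n, rfl⟩ : ∃ j, n = j + 1 := ⟨n - 1, by omega⟩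
    ring_nf
    omega
  refine (Term.seq (Q := fun s => s = (driftInput 0 α T R D).setN 10 k)
    (Term.straight rfl le_rfl rfl) ?_).le hcost
  rintro _ - rfl
  refine Term.seq (Q := fun s => s = ((driftInput 0 α T R D).setN 10 k).setN 11 m)
    (Term.straight rfl le_rfl rfl) ?_
  rintro _ - rfl
  refine Term.seq (Q := fun s => s = (((driftInput 0 α T R D).setN 10 k).setN 11 m).setN 5 0)
    (Term.straight rfl le_rfl rfl) ?_
  rintro s - hs
  have hw : ∀ x < 12, x ≠ 5 → x ≠ 4 →
      (forUp 4 (.const 0) (.reg 0) (batchStep P)).writesN x = false := fun x hx h5 h4 => by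
    simp [forUp, Prog.writesN, (batchStep_writes hP hx).1 h5, h4]
  have hwr : ∀ x < 12, x ≠ 8 → x ≠ 10 → x ≠ 11 →
      (forUp 4 (.const 0) (.reg 0) (batchStep P)).writesRA x = false := fun x hx h1 h2 h3 => by
    simp [forUp, Prog.writesRA, (batchStep_writes hP hx).2.2 h1 h2 h3]
  have hwrr : (forUp 4 (.const 0) (.reg 0) (batchStep P)).writesR 0 = false := by
    simp [forUp, Prog.writesR, (batchStep_writes hP (x := 0) (by omega)).2.1]
  set δ : Fin n → ℝ := fun b =>
    emd (ν m) (batch T b) (batch R b) - emd (ν m) (batch T b) (batch D b) with hδ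
  refine Term.seq ((Term.forUp (c := (2 * C + 10060) * (k ^ 3 + m * k ^ 2)) n (fun i s' =>
    s'.nreg 5 = i * k ∧ ∀ b : Fin n, (b : ℕ) < i → s'.rarr 8 0 b = δ b)
    ((batchStep_writes hP (by omega)).1 (by omega)) (by simp [NExp.eval]) ?_ ?_ ?_ ?_).le
    (by simp [NExp.eval])) ?_
  · intro s' hf
    simp only [NExp.eval]
    rw [hf.nreg 0 (hw 0 (by omega) (by omega) (by omega)), hs]
    simp [driftInput]
  · intro i s' v h
    simpa using h
  · simp [NExp.eval, hs]
  · rintro i s' - hi hf h4 ⟨hI1, hI2⟩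
    refine (batchStep_term hP hk ?_ ?_ ?_ (⟨i, hi⟩ : Fin n) h4 hI1 T R D ?_ ?_ ?_).mono le_rfl ?_
    · rw [hf.nreg _ (hw 10 (by omega) (by omega) (by omega)), hs]
      simp
    · rw [hf.nreg _ (hw 11 (by omega) (by omega) (by omega)), hs]
      simp
    · rw [hf.nreg _ (hw 1 (by omega) (by omega) (by omega)), hs]
      simp [driftInput]
    · rw [hf.rarr _ (hwr 0 (by omega) (by omega) (by omega) (by omega)), hs]
      rfl
    · rw [hf.rarr _ (hwr 1 (by omega) (by omega) (by omega) (by omega)), hs]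
      rfl
    · rw [hf.rarr _ (hwr 2 (by omega) (by omega) (by omega) (by omega)), hs]
      rfl
    · rintro s'' - ⟨h1, h2⟩
      refine ⟨h1, fun b hb => ?_⟩
      rw [h2]
      split_ifs with hbi
      · rw [← show b = ⟨i, hi⟩ from Fin.ext hbi]
      · exact hI2 b (by simp at hbi; omega)
  rintro s1 f1 ⟨-, h1⟩
  refine Term.seq (T := n * 24 + 47) (T' := 4) (tTestProg_term (n := n) ?_ hn δ fun i => h1 i i.2) ?_
  · rw [f1.nreg 0 (hw 0 (by omega) (by omega) (by omega)), hs]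
    simp [driftInput]
  intro s2 f2 h2
  refine verdictProg_term ?_ h2
  rw [f2.rreg 0 rfl, f1.rreg 0 hwrr, hs]
  simp [driftInput]

theorem emdMain_deterministic (hP : NormProg ν P C) : (emdMain P).Deterministic := by
  simp [emdMain, Prog.Deterministic, emdProg_deterministic hP, copyRows_deterministic]

theorem batchMain_deterministic (hP : NormProg ν P C) : (batchMain P).Deterministic := by
  simp [batchMain, batchStep, tTestProg, meanProg, varProg, studentProg, studentInit, absStatProg,
    studentStep, verdictProg, forUp, Prog.Deterministic, emdProg_deterministic hP,
    copyRows_deterministic]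
end

/-! ## Uniform distributions -/

/-- Each outcome has exactly one preimage pair, of probability `1 / (|α| |β|)`, and the bijection
gives `|γ| = |α| |β|`. Used for one round of the shuffle and for appending one permutation to a
tuple. -/
theorem uniformOfFintype_bind_map {α β γ : Type*} [Fintype α] [Nonempty α] [Fintype β] [Nonempty β]
    [Fintype γ] [Nonempty γ] (f : α → β → γ)
    (hf : Function.Bijective fun p : α × β => f p.1 p.2) :
    ((PMF.uniformOfFintype α).bind fun a => (PMF.uniformOfFintype β).map (f a)) =
      PMF.uniformOfFintype γ := by
  classical
  ext c
  obtain ⟨⟨a₀, b₀⟩, h₀⟩ := hf.2 c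
  have hcard : Fintype.card γ = Fintype.card α * Fintype.card β := by
    rw [← Fintype.card_prod]
    exact (Fintype.card_of_bijective hf).symm
  have hiff : ∀ a b, c = f a b ↔ a = a₀ ∧ b = b₀ := by
    intro a b
    rw [← h₀]
    constructor
    · intro h
      have := @hf.1 (a₀, b₀) (a, b) h
      simp only [Prod.mk.injEq] at this
      exact ⟨this.1.symm, this.2.symm⟩
    · rintro ⟨rfl, rfl⟩; rfl
  simp only [PMF.bind_apply, PMF.map_apply, PMF.uniformOfFintype_apply, tsum_fintype, hiff]
  rw [Finset.sum_eq_single a₀ (by intro a _ h; simp [h]) (by simp),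
    Finset.sum_eq_single b₀ (by intro b _ h; simp [h]) (by simp)]
  simp only [and_self, if_true]
  rw [hcard, Nat.cast_mul, ENNReal.mul_inv (by simp) (by simp)]

/-! ### Permutations of an initial segment as permutations of the natural numbers. -/

/-- The extension of a permutation of `Fin M` to the natural numbers. -/
def extendPerm {M : ℕ} (σ : Equiv.Perm (Fin M)) : Equiv.Perm ℕ := σ.extendDomain Fin.equivSubtype

theorem extendPerm_apply {M : ℕ} (σ : Equiv.Perm (Fin M)) (j : Fin M) : extendPerm σ j = σ j :=
  σ.extendDomain_apply_image Fin.equivSubtype j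

theorem extendPerm_of_le {M : ℕ} (σ : Equiv.Perm (Fin M)) {j : ℕ} (h : M ≤ j) :
    extendPerm σ j = j :=
  σ.extendDomain_apply_not_subtype Fin.equivSubtype (not_lt.2 h)

theorem extendPerm_injective {M : ℕ} : Function.Injective (extendPerm (M := M)) := by
  intro σ τ h
  ext j
  rw [← extendPerm_apply, ← extendPerm_apply, h]

/-- A point below `M` cannot be sent to a fixed point at or above `M`, so `ρ` restricts.
Permutations of `ℕ` keep all rounds of the shuffle in one type although the shuffled segment grows.
-/
theorem exists_extendPerm_eq {M : ℕ} (ρ : Equiv.Perm ℕ) (h : ∀ j, M ≤ j → ρ j = j) :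
    ∃ σ : Equiv.Perm (Fin M), extendPerm σ = ρ := by
  have hlt : ∀ j : Fin M, ρ j < M := by
    intro j
    by_contra hj
    have := ρ.injective (h _ (not_lt.1 hj))
    omega
  let f : Fin M → Fin M := fun j => ⟨ρ j, hlt j⟩
  have hf : Function.Injective f := fun i j hij =>
    Fin.ext (ρ.injective (by simpa [f] using hij))
  refine ⟨Equiv.ofBijective f (Finite.injective_iff_bijective.1 hf), ?_⟩
  ext j
  by_cases hj : j < M
  · exact extendPerm_apply _ (⟨j, hj⟩ : Fin M)
  · rw [extendPerm_of_le _ (not_lt.1 hj), h j (not_lt.1 hj)]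

/-! ### The Fisher–Yates shuffle and its uniformity. -/

/-- The uniform distribution on `{0, …, n}`. -/
noncomputable def drawUpTo (n : ℕ) : PMF ℕ := (PMF.uniformOfFintype (Fin (n + 1))).map Fin.val

/-- The distribution of the permutation after `k` rounds of the Fisher–Yates shuffle, of which the
first exchanges `i` with a random element of `{0, …, i}`. -/
noncomputable def fisherYates : ℕ → ℕ → Equiv.Perm ℕ → PMF (Equiv.Perm ℕ)
  | 0, _, τ => PMF.pure τ
  | k + 1, i, τ => (drawUpTo i).bind fun r => fisherYates k (i + 1) (τ * Equiv.swap i r)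

/-- The recursion splits off the first round, as the program executes it; uniformity is proved by
induction on the size and needs the last round split off. -/
theorem fisherYates_succ (k : ℕ) : ∀ (i : ℕ) (τ : Equiv.Perm ℕ), fisherYates (k + 1) i τ =
    (fisherYates k i τ).bind fun ρ => (drawUpTo (i + k)).map fun r => ρ * Equiv.swap (i + k) r := by
  induction k with
  | zero =>
    intro i τ
    rw [fisherYates, fisherYates, PMF.pure_bind]
    rfl
  | succ k ih =>
    intro i τ
    rw [fisherYates, fisherYates, PMF.bind_bind]
    congr 1
    funext r
    rw [ih, show i + 1 + k = i + (k + 1) by ring]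

theorem swap_fixes {n r j : ℕ} (hr : r ≤ n) (hj : n + 1 ≤ j) : Equiv.swap n r j = j :=
  Equiv.swap_apply_of_ne_of_ne (by omega) (by omega)

/-- The Fisher–Yates shuffle is uniformly distributed. -/
theorem fisherYates_eq (M : ℕ) :
    fisherYates M 0 1 = (PMF.uniformOfFintype (Equiv.Perm (Fin M))).map extendPerm := by
  induction M with
  | zero =>
    have : PMF.uniformOfFintype (Equiv.Perm (Fin 0)) = PMF.pure 1 := by
      ext σ
      rw [Subsingleton.elim σ 1]
      simp
    rw [this, PMF.pure_map, fisherYates]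
    congr 1
  | succ n ih =>
    have hex : ∀ (σ : Equiv.Perm (Fin n)) (r : Fin (n + 1)), ∃ π : Equiv.Perm (Fin (n + 1)),
        extendPerm π = extendPerm σ * Equiv.swap n (r : ℕ) := by
      intro σ r
      refine exists_extendPerm_eq _ fun j hj => ?_
      rw [Equiv.Perm.mul_apply, swap_fixes (by omega) hj, extendPerm_of_le _ (by omega)]
    choose Φ hΦ using hex
    have hinj : Function.Injective fun p : Equiv.Perm (Fin n) × Fin (n + 1) => Φ p.1 p.2 := by
      rintro ⟨σ, r⟩ ⟨σ', r'⟩ h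
      have h : extendPerm σ * Equiv.swap n (r : ℕ) = extendPerm σ' * Equiv.swap n (r' : ℕ) := by
        rw [← hΦ, ← hΦ]; exact congrArg _ h
      -- The draw `r` is recovered as the point that the product sends to `n`; cancelling the
      -- transposition then gives `σ`. Surjectivity follows by counting, `(n + 1)! = (n + 1) n!`.
      have h1 : (extendPerm σ * Equiv.swap n (r : ℕ)) r = n := by
        rw [Equiv.Perm.mul_apply, Equiv.swap_apply_right, extendPerm_of_le _ le_rfl]
      have h2 : (extendPerm σ * Equiv.swap n (r : ℕ)) r' = n := by
        rw [h, Equiv.Perm.mul_apply, Equiv.swap_apply_right, extendPerm_of_le _ le_rfl]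
      have hr : r = r' := Fin.ext ((Equiv.injective _) (h1.trans h2.symm))
      subst hr
      rw [extendPerm_injective (mul_right_cancel h)]
    have hbij := (Fintype.bijective_iff_injective_and_card _).2 ⟨hinj, by
      rw [Fintype.card_prod, Fintype.card_perm, Fintype.card_perm, Fintype.card_fin,
        Fintype.card_fin, Nat.factorial_succ, mul_comm]⟩
    rw [fisherYates_succ, ih, Nat.zero_add, PMF.bind_map, ← uniformOfFintype_bind_map Φ hbij, PMF.map_bind]
    congr 1
    funext σ
    simp only [Function.comp_apply, drawUpTo, PMF.map_comp]
    congr 1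
    funext r
    exact (hΦ σ r).symm

/-! ## The shuffle program -/

/-- Three times the register `4`. -/
def tripleN : NExp := .add (.add (.reg 4) (.reg 4)) (.reg 4)

/-- The inside-out form: cell `i` is initialized only when it is reached, then receives the content
of the drawn cell, which receives `i`. Since the old permutation fixes `i`, this is right
multiplication by the transposition, also when the draw is `i` itself. -/
def shuffleStep : Prog :=
  .nput 5 (.reg 6) (.reg 6) ;; .rand 9 (.reg 6) ;;
    .nput 5 (.reg 6) (.arr 5 (.reg 9)) ;; .nput 5 (.reg 9) (.reg 6)

/-- Leaves a random permutation of `{0, …, M - 1}` in array `5`, where `M` is three times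
register `4`. -/
def shuffleProg : Prog := forUp 6 (.const 0) tripleN shuffleStep

section Shuffle
variable {β : Type} {out : Mem → β} {K : List Prog} {T : ℕ} {M : ℕ} {E : Mem → Prop}

/-- `E` stands for whatever the continuation relies on; it only has to survive the writes of the
shuffle. `G` is the output distribution of the continuation for a given permutation. -/
theorem shuffle_loop_res {G : Equiv.Perm ℕ → PMF β}
    (hM : ∀ s, E s → tripleN.eval s = M)
    (hE6 : ∀ s v, E s → E (s.setN 6 v)) (hE9 : ∀ s v, E s → E (s.setN 9 v))
    (hE5 : ∀ s i v, E s → E (s.putN 5 i v))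
    (h : ∀ (τ : Equiv.Perm ℕ) (s : Mem), (∀ j, M ≤ j → τ j = j) → E s →
      (∀ j < M, s.narr 5 j = τ j) → Res out (K, s) T (G τ)) :
    ∀ (k i : ℕ) (τ : Equiv.Perm ℕ) (s : Mem), i + k = M → E s → s.nreg 6 = i →
      (∀ j < i, s.narr 5 j = τ j) → (∀ j, i ≤ j → τ j = j) →
      Res out (.loop (.nlt (.reg 6) tripleN)
        (shuffleStep ;; .nset 6 (.add (.reg 6) (.const 1))) :: K, s) (k * 12 + 1 + T)
        ((fisherYates k i τ).bind G) := by
  intro k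
  induction k with
  | zero =>
    intro i τ s hi hE h6 hτ hfix
    obtain rfl : i = M := by omega
    rw [fisherYates, PMF.pure_bind]
    refine (Res.loopFalse ?_ (h τ s hfix hE hτ)).le (by omega)
    simp [BExp.Holds, NExp.eval, hM s hE, h6]
  | succ k ih =>
    intro i τ s hi hE h6 hτ hfix
    have hb : (BExp.nlt (.reg 6) tripleN).Holds s := by
      simp only [BExp.Holds, NExp.eval, hM s hE, h6]
      omega
    rw [fisherYates, drawUpTo, PMF.bind_map, PMF.bind_bind]
    have hstep : ∀ v ≤ i, Res out ((.nput 5 (.reg 6) (.arr 5 (.reg 9)) ;; .nput 5 (.reg 9) (.reg 6)) ::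
        .nset 6 (.add (.reg 6) (.const 1)) :: .loop (.nlt (.reg 6) tripleN)
        (shuffleStep ;; .nset 6 (.add (.reg 6) (.const 1))) :: K, (s.putN 5 i i).setN 9 v)
        (3 + (1 + (k * 12 + 1 + T)))
        ((fisherYates k (i + 1) (τ * Equiv.swap i v)).bind G) := by
      intro v hv
      refine Res.term (Q := fun s' => E s' ∧ s'.nreg 6 = i ∧
        ∀ j < i + 1, s'.narr 5 j = (τ * Equiv.swap i v) j)
        (Term.straight rfl le_rfl ⟨?_, by simp [Prog.effect, h6], fun j hj => ?_⟩) ?_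
      · exact hE5 _ _ _ (hE5 _ _ _ (hE9 _ _ (hE5 _ _ _ hE)))
      · have hi5 : τ i = i := hfix i le_rfl
        rw [Equiv.Perm.mul_apply]
        by_cases hjv : j = v
        · subst hjv
          rw [Equiv.swap_apply_right, hi5]
          simp [Prog.effect, NExp.eval, h6]
        · by_cases hji : j = i
          · subst hji
            rw [Equiv.swap_apply_left, ← hτ v (by omega)]
            have : v ≠ j := by omega
            simp [Prog.effect, NExp.eval, h6, hjv, this]
          · rw [Equiv.swap_apply_of_ne_of_ne hji hjv, ← hτ j (by omega)]
            simp [Prog.effect, NExp.eval, h6, hjv, hji]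
      · rintro s1 - ⟨hE1, h61, hτ1⟩
        refine Res.term (Q := fun s' => s' = s1.setN 6 (i + 1))
          (Term.straight rfl le_rfl (by simp [Prog.effect, NExp.eval, h61])) ?_
        rintro _ - rfl
        refine ih (i + 1) _ _ (by omega) (hE6 _ _ hE1) (by simp) hτ1 fun j hj => ?_
        rw [Equiv.Perm.mul_apply, swap_fixes hv hj, hfix j (by omega)]
    refine (Res.loopTrue hb (Res.seq (Res.seq (Res.term (T := 1) (Q := fun s' => s' = s.putN 5 i i)
      (Term.straight rfl le_rfl (by simp [Prog.effect, NExp.eval, h6])) ?_)))).le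
      (T := 1 + (3 + (1 + (k * 12 + 1 + T)) + 1 + 1) + 1 + 1 + 1) (by omega)
    rintro _ - rfl
    exact Res.seq (Res.rand (by simp [NExp.eval, h6]) hstep)

theorem shuffle_res {G : Equiv.Perm (Fin M) → PMF β}
    (hM : ∀ s, E s → tripleN.eval s = M)
    (hE6 : ∀ s v, E s → E (s.setN 6 v)) (hE9 : ∀ s v, E s → E (s.setN 9 v))
    (hE5 : ∀ s i v, E s → E (s.putN 5 i v))
    (h : ∀ (σ : Equiv.Perm (Fin M)) (s : Mem), E s →
      (∀ j : Fin M, s.narr 5 j = σ j) → Res out (K, s) T (G σ)) {s : Mem} (hs : E s) :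
    Res out (shuffleProg :: K, s) (M * 12 + 3 + T)
      ((PMF.uniformOfFintype (Equiv.Perm (Fin M))).bind G) := by
  -- The loop lemma wants a continuation for permutations of `ℕ`; a left inverse of `extendPerm`
  -- supplies one, and its values off the image do not matter.
  have hG : ∀ σ : Equiv.Perm (Fin M), G (Function.invFun extendPerm (extendPerm σ)) = G σ :=
    fun σ => by rw [Function.leftInverse_invFun extendPerm_injective]
  have hloop := shuffle_loop_res (G := fun τ => G (Function.invFun extendPerm τ)) hM hE6 hE9 hE5
    (T := T) (out := out) (K := K) ?_ M 0 1 (s.setN 6 0) (by omega) (hE6 _ _ hs) (by simp)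
    (by simp) (by simp)
  · rw [fisherYates_eq, PMF.bind_map] at hloop
    simp only [Function.comp_def, hG] at hloop
    refine (Res.seq (Res.term (T := 1) (Q := fun s' => s' = s.setN 6 0)
      (Term.straight rfl le_rfl rfl) ?_)).le (T := 1 + (M * 12 + 1 + T) + 1) (by omega)
    rintro _ - rfl
    exact hloop
  · intro τ s' hτ hE' h5
    obtain ⟨σ, rfl⟩ := exists_extendPerm_eq τ hτ
    rw [hG]
    exact h σ s' hE' fun j => by rw [h5 j j.2, extendPerm_apply]
end Shuffle

/-! ## Permutation testing -/

/-- Computes the distance between the first `2 N` and the last `N` points of the pool in real array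
`5`, rearranged by array `5`. The register `4` contains `N`, and each of the last `N` points is taken
twice. -/
def splitProg (P : Prog) : Prog :=
  .nset 10 (.add (.reg 4) (.reg 4)) ;;
  copyRows 5 10 (.reg 10) (.arr 5 (.reg 20)) (.const 0) ;;
  copyRows 5 11 (.reg 4) (.arr 5 (.add (.reg 10) (.reg 20))) (.const 0) ;;
  copyRows 5 11 (.reg 4) (.arr 5 (.add (.reg 10) (.reg 20))) (.reg 4) ;;
  emdProg P

/-- The product `n * k` by repeated addition; the `O(n)` steps are harmless because `n ≤ n * k`. -/
def sizeProg : Prog :=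
  .nset 4 (.const 0) ;; forUp 6 (.const 0) (.reg 0) (.nset 4 (.add (.reg 4) (.reg 1)))

def poolProg : Prog :=
  copyRows 0 5 (.reg 4) (.reg 20) (.const 0) ;;
  copyRows 1 5 (.reg 4) (.reg 20) (.reg 4) ;;
  copyRows 2 5 (.reg 4) (.reg 20) (.add (.reg 4) (.reg 4))

def identityProg : Prog := forUp 6 (.const 0) tripleN (.nput 5 (.reg 6) (.reg 6))

def permInit (P : Prog) : Prog :=
  sizeProg ;; .nset 11 (.reg 2) ;; poolProg ;; identityProg ;; splitProg P ;; .rset 5 (.reg 10) ;;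
    .nset 7 (.const 0) ;; .nset 8 (.const 0)

/-- Distances are nonnegative, so the absolute values of the p-value can be dropped; ties count as
exceeding. -/
def countProg : Prog :=
  .ite (.rlt (.reg 10) (.reg 5)) .skip (.nset 7 (.add (.reg 7) (.const 1)))

def permStep (P : Prog) : Prog := shuffleProg ;; splitProg P ;; countProg

def permLoop (P : Prog) : Prog :=
  .loop (.nlt (.reg 8) (.reg 3)) (permStep P ;; .nset 8 (.add (.reg 8) (.const 1)))

def permFinal : Prog :=
  .rset 9 (.mul (.div .one (.ofNat (.reg 3))) (.ofNat (.reg 7))) ;; verdictProg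

def permMain (P : Prog) : Prog := permInit P ;; permLoop P ;; permFinal

section
variable {ν : ∀ m : ℕ, Seminorm ℝ (Fin m → ℝ)} {P : Prog} {C : ℕ}

theorem splitProg_writes (hP : NormProg ν P C) {x : ℕ} (hx : x < 10) :
    (splitProg P).writesN x = false ∧ (splitProg P).writesR x = false ∧
      (splitProg P).writesNA x = false ∧ (splitProg P).writesRA x = false := by
  obtain ⟨h1, h2, h3, h4⟩ := emdProg_writes hP hx
  have c := fun a b c d e => copyRows_writes a b c d e x
  have c1 := fun a b c' d e => (c a b c' d e).1.2 (by omega)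
  have c2 := fun a b c' d e => (c a b c' d e).2.1
  have c3 := fun a b c' d e => (c a b c' d e).2.2.1
  have c4 := fun a c' d e => (c a 10 c' d e).2.2.2.2 (by omega)
  have c5 := fun a c' d e => (c a 11 c' d e).2.2.2.2 (by omega)
  have hne : x ≠ 10 := by omega
  simp [splitProg, Prog.writesN, Prog.writesR, Prog.writesNA, Prog.writesRA, h1, h2, h3, h4, c1, c2,
    c3, c4, c5, hne]

theorem splitProg_writes_dim (hP : NormProg ν P C) : (splitProg P).writesN 11 = false := by
  have h := (emdProg_preserves hP (x := 11) (by omega)).1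
  have c1 := fun a b c d e => (copyRows_writes a b c d e 11).1.2 (by omega)
  simp [splitProg, Prog.writesN, h, c1]

theorem splitProg_term (hP : NormProg ν P C) {s : Mem} {N m : ℕ} (hN : 1 ≤ N) (h4 : s.nreg 4 = N)
    (h11 : s.nreg 11 = m) (z : Fin (N + N + N) → Fin m → ℝ)
    (hz : ∀ (i : Fin (N + N + N)) (l : Fin m), s.rarr 5 i l = z i l)
    (σ : Equiv.Perm (Fin (N + N + N))) (hσ : ∀ j : Fin (N + N + N), s.narr 5 j = σ j) :
    Term (splitProg P) s ((8 * C + 40060) * (N ^ 3 + m * N ^ 2)) fun s' =>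
      s'.rreg 10 = splitEmd (ν m) z σ := by
  -- The solver runs with size `2 N`, whence the factor `8` in front of `C`.
  have hcost : 1 + (((N + N) * (m * 4 + 10) + 3) + ((N * (m * 4 + 10) + 3) +
      ((N * (m * 4 + 10) + 3) + ((C + 5000) * ((N + N) ^ 3 + m * (N + N) ^ 2)) + 1) + 1) + 1) + 1 ≤
      (8 * C + 40060) * (N ^ 3 + m * N ^ 2) := by
    obtain ⟨n, rfl⟩ : ∃ j, N = j + 1 := ⟨N - 1, by omega⟩
    ring_nf
    omega
  refine (Term.seq (Q := fun s' => s' = s.setN 10 (N + N))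
    (Term.straight rfl le_rfl (by simp [Prog.effect, NExp.eval, h4])) ?_).le hcost
  rintro s1 - hs1
  have n10 : s1.nreg 10 = N + N := by simp [hs1]
  have n4 : s1.nreg 4 = N := by simp [hs1, h4]
  have n11 : s1.nreg 11 = m := by simp [hs1, h11]
  have a5 : s1.narr 5 = s.narr 5 := by rw [hs1]; rfl
  have r5 : s1.rarr 5 = s.rarr 5 := by rw [hs1]; rfl
  clear hs1
  refine Term.seq (copyRows_term (by decide) n11 (N + N) 0 (s.narr 5)
    (fun s' h => (h.1 10 (by omega)).trans n10) (fun _ _ => rfl)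
    fun i _ s' h hi => by simp only [NExp.eval, h.2, hi, a5]) ?_
  rintro s2 f2 ⟨hx, -⟩
  have i2 := f2.sameIndices
  have hrow : ∀ s2 : Mem, SameIndices s1 s2 → ∀ i < N, ∀ s', SameIndices s2 s' → s'.nreg 20 = i →
      (NExp.arr 5 (.add (.reg 10) (.reg 20))).eval s' = s.narr 5 (N + N + i) := by
    intro s2 h2 i _ s' h hi
    simp only [NExp.eval, h.2, h2.2, a5, h.1 10 (by omega), h2.1 10 (by omega), n10, hi]
  refine Term.seq (copyRows_term (by decide) ((i2.1 11 (by omega)).trans n11) N 0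
    (fun i => s.narr 5 (N + N + i)) (fun s' h => (h.1 4 (by omega)).trans
      ((i2.1 4 (by omega)).trans n4)) (fun _ _ => rfl) (hrow s2 i2)) ?_
  rintro s3 f3 ⟨hy1, -⟩
  have i3 : SameIndices s1 s3 := ⟨fun x hx => (f3.sameIndices.1 x hx).trans (i2.1 x hx),
    f3.sameIndices.2.trans i2.2⟩
  refine Term.seq (copyRows_term (by decide) ((i3.1 11 (by omega)).trans n11) N N
    (fun i => s.narr 5 (N + N + i)) (fun s' h => (h.1 4 (by omega)).trans
      ((i3.1 4 (by omega)).trans n4)) (fun s' h => (h.1 4 (by omega)).trans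
      ((i3.1 4 (by omega)).trans n4)) (hrow s3 i3)) ?_
  rintro s4 f4 ⟨hy2, hy3⟩
  have i4 := f4.sameIndices
  have wR : ∀ {x y a c d e}, x ≠ y → (copyRows a y c d e).writesRA x = false :=
    fun h => (copyRows_writes _ _ _ _ _ _).2.2.2.2 h
  have e2 : s2.rarr 5 = s.rarr 5 := (f2.rarr 5 (wR (by decide))).trans r5
  have e3 : s3.rarr 5 = s.rarr 5 := (f3.rarr 5 (wR (by decide))).trans e2
  have hpt : ∀ j : Fin (N + N + N), ∀ l : Fin m, s.rarr 5 (s.narr 5 j) l = z (σ j) l :=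
    fun j l => by rw [hσ, hz]
  refine (emdProg_term hP (N := N + N) (by omega)
    ((i4.1 11 (by omega)).trans ((i3.1 11 (by omega)).trans n11))
    ((i4.1 10 (by omega)).trans ((i3.1 10 (by omega)).trans n10))
    (fun i : Fin (N + N) => z (σ (Fin.castAdd N i)))
    (Fin.append (fun j : Fin N => z (σ (Fin.natAdd (N + N) j)))
      (fun j : Fin N => z (σ (Fin.natAdd (N + N) j)))) (fun i l => ?_) fun i l => ?_).mono le_rfl ?_
  · have h := hx i i.2 l l.2
    rw [Nat.zero_add, r5] at h
    rw [f4.rarr 10 (wR (by decide)), f3.rarr 10 (wR (by decide)), h]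
    exact hpt (Fin.castAdd N i) l
  · refine Fin.addCases (fun j => ?_) (fun j => ?_) i
    · have h := hy1 j j.2 l l.2
      rw [Nat.zero_add, e2] at h
      rw [Fin.append_left, Fin.val_castAdd, hy3 j l (.inl j.2), h]
      exact hpt (Fin.natAdd (N + N) j) l
    · have h := hy2 j j.2 l l.2
      rw [e3] at h
      rw [Fin.append_right, Fin.val_natAdd, h]
      exact hpt (Fin.natAdd (N + N) j) l
  · intro s' _ h
    rw [h, emd_append_self]; rfl

theorem sizeProg_term {s : Mem} {n k : ℕ} (h0 : s.nreg 0 = n) (h1 : s.nreg 1 = k) :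
    Term sizeProg s (n * 4 + 5) fun s' => s'.nreg 4 = n * k := by
  refine (Term.seq (T := 1) (T' := n * 4 + 3) (Q := fun s' => s'.nreg 4 = 0)
    (Term.straight rfl le_rfl (by simp [Prog.effect, NExp.eval])) ?_).le (by omega)
  intro s1 f1 h4
  refine (Term.forUp (c := 1) n (fun i s' => s'.nreg 4 = i * k) rfl (by simp [NExp.eval]) ?_
    (fun i s v h => by simpa using h) (by simp [NExp.eval, h4]) ?_).le (by simp [NExp.eval])
  · exact fun s' hf => (hf.nreg 0 rfl).trans ((f1.nreg 0 rfl).trans h0)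
  · intro i s' _ _ hf _ hI
    refine Term.straight rfl le_rfl ?_
    simp [Prog.effect, NExp.eval, hI, hf.nreg 1 rfl, f1.nreg 1 rfl, h1, add_mul]

theorem poolProg_term {s : Mem} {N m : ℕ} (h4 : s.nreg 4 = N) (h11 : s.nreg 11 = m)
    (T R D : Fin N → Fin m → ℝ) (hT : s.rarr 0 = sampleArray T) (hR : s.rarr 1 = sampleArray R)
    (hD : s.rarr 2 = sampleArray D) :
    Term poolProg s (3 * (N * (m * 4 + 10)) + 11) fun s' =>
      ∀ (i : Fin (N + N + N)) (l : Fin m),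
        s'.rarr 5 i l = Fin.append (Fin.append T R) D i l := by
  set Kc := N * (m * 4 + 10) with hKc
  have wR : ∀ {x y a c d e}, x ≠ y → (copyRows a y c d e).writesRA x = false :=
    fun h => (copyRows_writes _ _ _ _ _ _).2.2.2.2 h
  refine (Term.seq (copyRows_term (src := 0) (dst := 5) (cnt := .reg 4) (row := .reg 20)
    (off := .const 0) (by decide) h11 N 0 id (fun s' h => (h.1 4 (by omega)).trans h4)
    (fun _ _ => rfl) fun i _ s' _ h => h) (T' := Kc + 3 + (Kc + 3) + 1) ?_).le (by omega)
  rintro s1 f1 ⟨hx, -⟩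
  have i1 := f1.sameIndices
  have n4 := (i1.1 4 (by omega)).trans h4
  have n11 := (i1.1 11 (by omega)).trans h11
  refine Term.seq (T := Kc + 3) (T' := Kc + 3) (copyRows_term (by decide) n11 N N id
    (fun s' h => (h.1 4 (by omega)).trans n4) (fun s' h => (h.1 4 (by omega)).trans n4)
    fun i _ s' _ h => h) ?_
  rintro s2 f2 ⟨hy, hy'⟩
  have i2 := f2.sameIndices
  have m4 := (i2.1 4 (by omega)).trans n4
  refine (copyRows_term (src := 2) (dst := 5) (cnt := .reg 4) (row := .reg 20)
    (off := .add (.reg 4) (.reg 4)) (by decide) ((i2.1 11 (by omega)).trans n11) N (N + N) id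
    (fun s' h => (h.1 4 (by omega)).trans m4)
    (fun s' h => by simp only [NExp.eval, h.1 4 (by omega), m4]) fun i _ s' _ h => h).mono le_rfl ?_
  rintro s3 f3 ⟨hw, hw'⟩
  intro i l
  refine Fin.addCases (fun i => ?_) (fun i => ?_) i
  · rw [Fin.append_left, Fin.val_castAdd, hw' i l (.inl i.2)]
    refine Fin.addCases (fun i => ?_) (fun i => ?_) i
    · have h := hx i i.2 l l.2
      rw [Nat.zero_add, id, hT, sampleArray_apply] at h
      rw [Fin.append_left, Fin.val_castAdd, hy' i l (.inl i.2), h]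
    · have h := hy i i.2 l l.2
      rw [id, f1.rarr 1 (wR (by decide)), hR, sampleArray_apply] at h
      rw [Fin.append_right, Fin.val_natAdd, h]
  · have h := hw i i.2 l l.2
    rw [id, f2.rarr 2 (wR (by decide)), f1.rarr 2 (wR (by decide)), hD, sampleArray_apply] at h
    rw [Fin.append_right, Fin.val_natAdd, h]

theorem identityProg_term {s : Mem} {N : ℕ} (h4 : s.nreg 4 = N) :
    Term identityProg s ((N + N + N) * 4 + 3) fun s' => ∀ j < N + N + N, s'.narr 5 j = j := by
  refine (Term.forUp (c := 1) (N + N + N) (fun i s' => ∀ j < i, s'.narr 5 j = j) rfl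
    (by simp [NExp.eval]) ?_ (fun _ _ _ h => h) (by simp [NExp.eval]) ?_).le (by simp [NExp.eval])
  · intro s' hf
    simp only [tripleN, NExp.eval]
    rw [hf.nreg 4 rfl, h4]
  · intro i s' _ _ hf h6 hI
    refine Term.straight rfl le_rfl fun j hj => ?_
    by_cases hji : j = i
    · simp [Prog.effect, NExp.eval, h6, hji]
    · simpa [Prog.effect, NExp.eval, h6, hji] using hI j (by omega)

/-! ### The permutation loop and the distribution of its output. -/

/-- The part of the memory that does not change during the permutation loop. -/
structure PermEnv {N m : ℕ} (B : ℕ) (z : Fin (N + N + N) → Fin m → ℝ) (α d : ℝ) (s : Mem) : Prop where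
  count : s.nreg 3 = B
  size : s.nreg 4 = N
  dim : s.nreg 11 = m
  pool : ∀ (i : Fin (N + N + N)) (l : Fin m), s.rarr 5 i l = z i l
  level : s.rreg 0 = α
  dist : s.rreg 5 = d

theorem PermEnv.of_eq {N m B : ℕ} {z : Fin (N + N + N) → Fin m → ℝ} {α d : ℝ} {s s' : Mem}
    (h : PermEnv B z α d s) (h3 : s'.nreg 3 = s.nreg 3) (h4 : s'.nreg 4 = s.nreg 4)
    (h11 : s'.nreg 11 = s.nreg 11) (h5 : s'.rarr 5 = s.rarr 5) (h0 : s'.rreg 0 = s.rreg 0)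
    (h5' : s'.rreg 5 = s.rreg 5) : PermEnv B z α d s' :=
  ⟨h3.trans h.count, h4.trans h.size, h11.trans h.dim, fun i l => by rw [h5]; exact h.pool i l,
    h0.trans h.level, h5'.trans h.dist⟩

theorem permInit_term (hP : NormProg ν P C) {n k m B : ℕ} (hn : 1 ≤ n) (hk : 1 ≤ k) (α : ℝ)
    (T R D : Fin (n * k) → Fin m → ℝ) :
    Term (permInit P) (driftInput B α T R D)
      ((8 * C + 40160) * ((n * k) ^ 3 + m * (n * k) ^ 2)) fun s =>
      PermEnv B (Fin.append (Fin.append T R) D) α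
        (splitEmd (ν m) (Fin.append (Fin.append T R) D) 1) s ∧ s.nreg 7 = 0 ∧ s.nreg 8 = 0 := by
  set z := Fin.append (Fin.append T R) D
  have hN : 1 ≤ n * k := Nat.mul_pos hn hk
  have hnN : n ≤ n * k := Nat.le_mul_of_pos_right n hk
  have hcost : ∀ N S, 1 ≤ N → n ≤ N → S = (8 * C + 40060) * (N ^ 3 + m * N ^ 2) →
      n * 4 + 5 + (1 + (3 * (N * (m * 4 + 10)) + 11 + ((N + N + N) * 4 + 3 +
      (S + (1 + (1 + 1 + 1) + 1) + 1) + 1) + 1) + 1) + 1 ≤ (8 * C + 40160) * (N ^ 3 + m * N ^ 2) := by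
    rintro N S hN hnN rfl
    have h2 : N * 4 + 5 + (1 + (3 * (N * (m * 4 + 10)) + 11 + ((N + N + N) * 4 + 3 +
        ((8 * C + 40060) * (N ^ 3 + m * N ^ 2) + (1 + (1 + 1 + 1) + 1) + 1) + 1) + 1) + 1) + 1 ≤
        (8 * C + 40160) * (N ^ 3 + m * N ^ 2) := by
      obtain ⟨N, rfl⟩ : ∃ j, N = j + 1 := ⟨N - 1, by omega⟩
      ring_nf
      omega
    omega
  refine (Term.seq (sizeProg_term (n := n) (k := k) (by simp [driftInput]) (by simp [driftInput]))
    ?_).le (hcost (n * k) _ hN hnN rfl)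
  rintro s1 f1 h1
  refine Term.seq (Q := fun s' => s' = s1.setN 11 m)
    (Term.straight rfl le_rfl (by simp [Prog.effect, NExp.eval, f1.nreg 2 rfl, driftInput])) ?_
  rintro s2 f2 hs2
  have n4 : s2.nreg 4 = n * k := by simp [hs2, h1]
  have n11 : s2.nreg 11 = m := by simp [hs2]
  have r2 : ∀ a, s2.rarr a = (driftInput B α T R D).rarr a := fun a => by
    rw [f2.rarr a rfl, f1.rarr a rfl]
  refine Term.seq (poolProg_term n4 n11 T R D (r2 0) (r2 1) (r2 2)) ?_
  rintro s3 f3 hz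
  have p4 : s3.nreg 4 = n * k := (f3.nreg 4 rfl).trans n4
  refine Term.seq (identityProg_term p4) ?_
  rintro s4 f4 hid
  refine Term.seq (splitProg_term hP hN ((f4.nreg 4 rfl).trans p4)
    ((f4.nreg 11 rfl).trans ((f3.nreg 11 rfl).trans n11)) z
    (fun i l => by rw [f4.rarr 5 rfl]; exact hz i l) 1 fun j => by simpa using hid j j.2) ?_
  intro s5 f5 h5
  refine Term.seq (T := 1) (T' := 1 + 1 + 1) (Q := fun s' => s' = s5.setR 5 (s5.rreg 10))
    (Term.straight rfl le_rfl (by simp [Prog.effect, RExp.eval])) ?_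
  rintro s6 f6 hs6
  refine Term.straight rfl le_rfl ⟨⟨?_, ?_, ?_, fun i l => ?_, ?_, ?_⟩, ?_, ?_⟩
  · simp [Prog.effect, f6.nreg 3 rfl, f5.nreg 3 (splitProg_writes hP (by omega)).1, f4.nreg 3 rfl,
      f3.nreg 3 rfl, f2.nreg 3 rfl, f1.nreg 3 rfl, driftInput]
  · simp [Prog.effect, f6.nreg 4 rfl, f5.nreg 4 (splitProg_writes hP (by omega)).1, f4.nreg 4 rfl,
      p4]
  · simp [Prog.effect, f6.nreg 11 rfl, f5.nreg 11 (splitProg_writes_dim hP), f4.nreg 11 rfl,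
      f3.nreg 11 rfl, n11]
  · have := hz i l
    rw [← f4.rarr 5 rfl, ← f5.rarr 5 (splitProg_writes hP (by omega)).2.2.2, ← f6.rarr 5 rfl] at this
    exact this
  · simp [Prog.effect, f6.rreg 0 rfl, f5.rreg 0 (splitProg_writes hP (by omega)).2.1, f4.rreg 0 rfl,
      f3.rreg 0 rfl, f2.rreg 0 rfl, f1.rreg 0 rfl, driftInput]
  · simp [Prog.effect, hs6, h5]
  · simp [Prog.effect, NExp.eval]
  · simp [Prog.effect, NExp.eval]

open Classical in
/-- `1` if the permutation `σ` gives at least the distance of the original order, and `0`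
otherwise. -/
noncomputable def exceeds {N m : ℕ} (p : Seminorm ℝ (Fin m → ℝ)) (z : Fin (N + N + N) → Fin m → ℝ)
    (σ : Equiv.Perm (Fin (N + N + N))) : ℕ :=
  if |splitEmd p z 1| ≤ |splitEmd p z σ| then 1 else 0

/-- The distribution of the output when `r` permutations remain to be drawn and `c` of those drawn
so far exceed the original distance. -/
noncomputable def permOutcome {N m : ℕ} (p : Seminorm ℝ (Fin m → ℝ)) (B : ℕ) (α : ℝ)
    (z : Fin (N + N + N) → Fin m → ℝ) : ℕ → ℕ → PMF (ℝ × ℕ)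
  | 0, c => PMF.pure (verdict α (1 / (B : ℝ) * c))
  | r + 1, c => (PMF.uniformOfFintype (Equiv.Perm (Fin (N + N + N)))).bind fun σ =>
      permOutcome p B α z r (c + exceeds p z σ)

/-- Drawing one permutation and then the remaining tuple is drawing the whole tuple, since
`Fin.cons` is a bijection. The count `c` is kept general so that the induction goes through. -/
theorem permOutcome_eq {N m : ℕ} (p : Seminorm ℝ (Fin m → ℝ)) (B : ℕ) (α : ℝ)
    (z : Fin (N + N + N) → Fin m → ℝ) (r : ℕ) : ∀ c, permOutcome p B α z r c =
      (PMF.uniformOfFintype (Fin r → Equiv.Perm (Fin (N + N + N)))).map fun σ =>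
        verdict α (1 / (B : ℝ) * ((c + ∑ b, exceeds p z (σ b) : ℕ) : ℝ)) := by
  induction r with
  | zero =>
    intro c
    have : PMF.uniformOfFintype (Fin 0 → Equiv.Perm (Fin (N + N + N))) = PMF.pure default := by
      ext σ
      rw [Subsingleton.elim σ default]
      simp
    rw [this, PMF.pure_map, permOutcome]
    simp
  | succ r ih =>
    intro c
    rw [permOutcome, ← uniformOfFintype_bind_map
      (fun (σ : Equiv.Perm (Fin (N + N + N))) (τ : Fin r → Equiv.Perm (Fin (N + N + N))) =>
        (Fin.cons σ τ : Fin (r + 1) → Equiv.Perm (Fin (N + N + N))))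
      (Fin.consEquiv fun _ : Fin (r + 1) => Equiv.Perm (Fin (N + N + N))).bijective, PMF.map_bind]
    congr 1
    funext σ
    rw [ih, PMF.map_comp]
    congr 1
    funext τ
    simp only [Function.comp_apply, Fin.sum_univ_succ, Fin.cons_zero, Fin.cons_succ, add_assoc]

theorem permOutcome_eq_permTest {N m B : ℕ} (p : Seminorm ℝ (Fin m → ℝ)) (α : ℝ)
    (T R D : Fin N → Fin m → ℝ) :
    permOutcome p B α (Fin.append (Fin.append T R) D) B 0 = permTest p B α T R D := by
  rw [permOutcome_eq, permTest]
  congr 1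
  funext σ
  rw [permPValue]
  congr 2
  push_cast
  rw [zero_add]
  refine Finset.sum_congr rfl fun b _ => ?_
  rw [exceeds]
  split_ifs <;> simp

theorem permFinal_term {N m B c : ℕ} {z : Fin (N + N + N) → Fin m → ℝ} {α d : ℝ}
    {s : Mem} (h : PermEnv B z α d s) (h7 : s.nreg 7 = c) :
    Term permFinal s 6 fun s' => driftOutput s' = verdict α (1 / (B : ℝ) * c) := by
  refine Term.seq (T := 1) (T' := 4) (Q := fun s' => s'.rreg 0 = α ∧ s'.rreg 9 = 1 / (B : ℝ) * c)
    (Term.straight rfl le_rfl ⟨by simp [Prog.effect, h.level], ?_⟩) ?_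
  · simp [Prog.effect, RExp.eval, NExp.eval, RExp.eval_one, h.count, h7]
  · rintro s' - ⟨h1, h2⟩
    exact verdictProg_term h1 h2

/-- Induction on the number `r` of remaining rounds, matching the recursion of `permOutcome`. The
linear cost of the shuffle fits into the gap between the constants `40060` and `40160`. -/
theorem permLoop_res (hP : NormProg ν P C) {N m B : ℕ} (hN : 1 ≤ N)
    {z : Fin (N + N + N) → Fin m → ℝ} {α : ℝ} :
    ∀ (r b c : ℕ) (s : Mem), b + r = B → PermEnv B z α (splitEmd (ν m) z 1) s →
      s.nreg 7 = c → s.nreg 8 = b →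
      Res driftOutput ([permLoop P, permFinal], s)
        (r * ((8 * C + 40160) * (N ^ 3 + m * N ^ 2)) + 7) (permOutcome (ν m) B α z r c) := by
  intro r
  induction r with
  | zero =>
    intro b c s hb hE h7 h8
    obtain rfl : b = B := by omega
    refine (Res.loopFalse ?_ (Res.term (T' := 0) (permFinal_term hE h7) fun s' _ h => ?_)).le
      (by omega)
    · simp [BExp.Holds, NExp.eval, hE.count, h8]
    · rw [permOutcome, ← h]
      exact Res.nil
  | succ r ih =>
    intro b c s hb hE h7 h8
    set I := (8 * C + 40160) * (N ^ 3 + m * N ^ 2) with hI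
    set S := (8 * C + 40060) * (N ^ 3 + m * N ^ 2) with hS
    have hcost : (N + N + N) * 12 + 3 + (S + 2 + 1 + (1 + (r * I + 7))) + 1 + 1 + 1 ≤
        (r + 1) * I + 7 := by
      have : (N + N + N) * 12 + 20 + S ≤ I := by
        rw [hI, hS]
        obtain ⟨N, rfl⟩ : ∃ j, N = j + 1 := ⟨N - 1, by omega⟩
        ring_nf
        omega
      rw [Nat.succ_mul]
      omega
    have hb' : (BExp.nlt (.reg 8) (.reg 3)).Holds s := by
      simp only [BExp.Holds, NExp.eval, hE.count, h8]
      omega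
    refine (Res.loopTrue hb' (Res.seq (Res.seq (shuffle_res
      (E := fun s => PermEnv B z α (splitEmd (ν m) z 1) s ∧ s.nreg 7 = c ∧ s.nreg 8 = b)
      (M := N + N + N) (T := S + 2 + 1 + (1 + (r * I + 7)))
      (G := fun σ => permOutcome (ν m) B α z r (c + exceeds (ν m) z σ)) ?_ ?_ ?_ ?_ ?_
      ⟨hE, h7, h8⟩)))).le hcost
    · rintro s ⟨h, -, -⟩
      simp [tripleN, NExp.eval, h.size]
    · rintro s v ⟨h, h7, h8⟩
      exact ⟨h.of_eq (by simp) (by simp) (by simp) rfl rfl rfl, by simp [h7], by simp [h8]⟩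
    · rintro s v ⟨h, h7, h8⟩
      exact ⟨h.of_eq (by simp) (by simp) (by simp) rfl rfl rfl, by simp [h7], by simp [h8]⟩
    · rintro s i v ⟨h, h7, h8⟩
      exact ⟨h.of_eq rfl rfl rfl rfl rfl rfl, h7, h8⟩
    · rintro σ s1 ⟨hE1, h71, h81⟩ hσ
      refine Res.term (T := S + 2 + 1) (Q := fun s' => PermEnv B z α (splitEmd (ν m) z 1) s' ∧
        s'.nreg 7 = c + exceeds (ν m) z σ ∧ s'.nreg 8 = b) ?_ ?_
      · refine Term.seq (T := S) (T' := 2) (splitProg_term hP hN hE1.size hE1.dim z hE1.pool σ hσ) ?_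
        intro s2 f2 h2
        have w := fun (x : ℕ) (hx : x < 10) => splitProg_writes hP hx
        have hE2 : PermEnv B z α (splitEmd (ν m) z 1) s2 :=
          hE1.of_eq (f2.nreg 3 (w 3 (by omega)).1) (f2.nreg 4 (w 4 (by omega)).1)
            (f2.nreg 11 (splitProg_writes_dim hP)) (f2.rarr 5 (w 5 (by omega)).2.2.2)
            (f2.rreg 0 (w 0 (by omega)).2.1) (f2.rreg 5 (w 5 (by omega)).2.1)
        have h72 : s2.nreg 7 = c := (f2.nreg 7 (w 7 (by omega)).1).trans h71
        have h82 : s2.nreg 8 = b := (f2.nreg 8 (w 8 (by omega)).1).trans h81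
        have hpos : ∀ τ, |splitEmd (ν m) z τ| = splitEmd (ν m) z τ :=
          fun τ => abs_of_nonneg (emd_nonneg _ _ _)
        refine Term.straight rfl le_rfl ?_
        by_cases hlt : splitEmd (ν m) z σ < splitEmd (ν m) z 1
        · have : exceeds (ν m) z σ = 0 := by
            rw [exceeds, hpos, hpos, if_neg (not_le.2 hlt)]
          simp only [countProg, Prog.effect, BExp.Holds, RExp.eval, h2, hE2.dist, if_pos hlt, this]
          exact ⟨hE2, h72, h82⟩
        · have : exceeds (ν m) z σ = 1 := by
            rw [exceeds, hpos, hpos, if_pos (not_lt.1 hlt)]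
          simp only [countProg, Prog.effect, BExp.Holds, RExp.eval, h2, hE2.dist, if_neg hlt, this,
            NExp.eval, h72]
          exact ⟨hE2.of_eq (by simp) (by simp) (by simp) rfl rfl rfl, by simp, by simp [h82]⟩
      · rintro s2 - ⟨hE2, h72, h82⟩
        refine Res.term (Q := fun s' => s' = s2.setN 8 (b + 1))
          (Term.straight rfl le_rfl (by simp [Prog.effect, NExp.eval, h82])) ?_
        rintro _ - rfl
        exact ih (b + 1) _ _ (by omega)
          (hE2.of_eq (by simp) (by simp) (by simp) rfl rfl rfl) (by simp [h72]) (by simp)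

theorem permMain_haltsWithin (hP : NormProg ν P C) {n k m B : ℕ} (hn : 1 ≤ n) (hk : 1 ≤ k)
    (hB : 1 ≤ B) (α : ℝ) (T R D : Fin (n * k) → Fin m → ℝ) :
    HaltsWithin (permMain P) (driftInput B α T R D)
      ((16 * C + 80400) * (B * (n ^ 3 * k ^ 3 + m * n ^ 2 * k ^ 2))) driftOutput
      (permTest (ν m) B α T R D) := by
  rw [← permOutcome_eq_permTest,
    show n ^ 3 * k ^ 3 + m * n ^ 2 * k ^ 2 = (n * k) ^ 3 + m * (n * k) ^ 2 by ring]
  have hN : 1 ≤ n * k := Nat.mul_pos hn hk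
  have hres := Res.seq (Res.term (permInit_term (B := B) hP hn hk α T R D)
    (K := [permLoop P ;; permFinal]) (out := driftOutput) (fun s' _ h => Res.seq
      (permLoop_res hP hN B 0 0 s' (by omega) h.1 h.2.1 h.2.2)))
  refine (hres.le ?_).haltsWithin
  set X := (n * k) ^ 3 + m * (n * k) ^ 2 with hX
  have hX1 : 1 ≤ X := (Nat.one_le_pow _ _ hN).trans (Nat.le_add_right _ _)
  obtain ⟨b, rfl⟩ : ∃ j, B = j + 1 := ⟨B - 1, by omega⟩
  obtain ⟨x, hx⟩ : ∃ j, X = j + 1 := ⟨X - 1, by omega⟩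
  rw [hx]
  ring_nf
  omega
end

theorem lemma2 (ν : ∀ m : ℕ, Seminorm ℝ (Fin m → ℝ))
    (hdef : ∀ (m : ℕ) (x : Fin m → ℝ), ν m x = 0 → x = 0)
    (hlin : EvaluableInLinearTime ν) :
    -- the distance between two samples of size `N`: time `O(N³ + m N²)`
    (∃ P : Prog, P.Deterministic ∧ ∃ C : ℕ, ∀ N m : ℕ, 1 ≤ N →
      ∀ x y : Fin N → Fin m → ℝ,
        HaltsWithin P (emdInput x y) (C * (N ^ 3 + m * N ^ 2))
          (fun s => s.rreg 0) (PMF.pure (emd (ν m) x y))) ∧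
    -- permutation testing: time `O(B (n³ k³ + m n² k²))`
    (∃ P : Prog, ∃ C : ℕ, ∀ n k m B : ℕ, 1 ≤ n → 1 ≤ k → 1 ≤ B →
      ∀ (α : ℝ) (T R D : Fin (n * k) → Fin m → ℝ),
        HaltsWithin P (driftInput B α T R D) (C * (B * (n ^ 3 * k ^ 3 + m * n ^ 2 * k ^ 2)))
          driftOutput (permTest (ν m) B α T R D)) ∧
    -- the batched distance algorithm: time `O(n (k³ + m k²))`
    (∃ P : Prog, P.Deterministic ∧ ∃ C : ℕ, ∀ n k m : ℕ, 2 ≤ n → 1 ≤ k →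
      ∀ (α : ℝ) (T R D : Fin (n * k) → Fin m → ℝ),
        HaltsWithin P (driftInput 0 α T R D) (C * (n * (k ^ 3 + m * k ^ 2)))
          driftOutput (PMF.pure (batchedTest (ν m) α T R D))) ∧
    -- the second bound improves on the first by a factor of at least `n B`
    (∀ n k m B : ℕ, 1 ≤ n →
      (n * B) * (n * (k ^ 3 + m * k ^ 2)) ≤ B * (n ^ 3 * k ^ 3 + m * n ^ 2 * k ^ 2)) := by
  obtain ⟨P, C, hP⟩ := hlin.exists_normProg
  refine ⟨⟨emdMain P, emdMain_deterministic hP, C + 5040, fun N m hN x y =>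
      (emdMain_term hP hN x y).haltsWithin⟩,
    ⟨permMain P, 16 * C + 80400, fun n k m B hn hk hB α T R D =>
      permMain_haltsWithin hP hn hk hB α T R D⟩,
    ⟨batchMain P, batchMain_deterministic hP, 2 * C + 10200, fun n k m hn hk α T R D =>
      (batchMain_term hP hn hk α T R D).haltsWithin⟩, fun n k m B hn => ?_⟩
  -- Only the cubic term leaves room; after multiplication by `n B` the terms with `m` agree
  -- exactly.
  have h : n ^ 2 * k ^ 3 ≤ n ^ 3 * k ^ 3 :=
    Nat.mul_le_mul_right _ (Nat.pow_le_pow_right hn (by norm_num))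
  calc (n * B) * (n * (k ^ 3 + m * k ^ 2)) = B * (n ^ 2 * k ^ 3 + m * n ^ 2 * k ^ 2) := by ring
    _ ≤ B * (n ^ 3 * k ^ 3 + m * n ^ 2 * k ^ 2) :=
      Nat.mul_le_mul_left _ (Nat.add_le_add_right h _)
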